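/- Let $k\ge 1$. A particle of type $i\in\{1,\dots,k\}$ has an exponential lifetime with mean $1/\mu_i$, $\mu_i>0$, and at its death produces a random vector $Y^{(i)}=(Y^{(i)}_1,\dots,Y^{(i)}_k)\in\mathbb N^k$ of new particles of types $1,\dots,k$, independent of its lifetime and with law $p_i$; all particles evolve independently. Assume that the means $m_{i,j}=\mathbb E[Y^{(i)}_j]$ are finite. Let $N^o(t)\in\mathbb N^k$ be the vector of the numbers of particles of each type alive at time $t$ when there is a single particle, of type $1$, at time $0$, so $N^o(0)=\mathbf n_0=(1,0,\dots,0)'$, and let $\varphi^o_t(s)=\mathbb E[e^{\langle s,N^o(t)\rangle}]$ for $s\in(-\infty,0]^k$. Let $A=(a_{ij})$ be the $k\times k$ matrix $a_{ij}=\mu_j(m_{j,i}-\mathbf 1_{[i=j]})$, so that $\mathbb E[N^o(t)]=e^{At}\mathbf n_0$. Assume that $A$ is regular, i.e. all entries of $e^{t_0A}$ are positive for some $t_0>0$, and let $\rho$ be its largest eigenvalue (the largest real part of an eigenvalue; it is itself a real, simple eigenvalue). Let $u$ and $v$ be the right and left eigenvectors, $Au=\rho u$ and $v'A=\rho v'$,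 with positive entries, normalized by $\langle u,\mathbf 1\rangle=1$ and $\langle u,v\rangle=1$. Immigrants of type $1$ arrive at the times $T_1\le T_2\le\cdots$ of a nonhomogeneous Poisson process $S(t)$, $t\ge0$, with locally integrable intensity $\lambda(t)>0$, and the family of the $i$-th immigrant evolves as an independent copy $N^{o,i}$ of $N^o$, independent of the arrival times. Let $N(t)=\sum_{i=1}^{S(t)}N^{o,i}(t-T_i)$. Suppose that $\lambda(t)\sim\lambda_\infty e^{\delta t}$ as $t\to+\infty$ for some $\delta\ge0$ and $\lambda_\infty>0$. Then, as $t\to+\infty$: (i) if $\rho<0$ and $\delta=0$, then $N(t)$ converges in distribution to a probability law $\nu$ on $\mathbb R_+^k$ whose Laplace transform is, with a convergent integral on the right, $$\int_{\mathbb R_+^k}e^{\langle s,x\rangle}\,\nu(dx)=\exp\Big\{\lambda_\infty\int_0^{+\infty}[\varphi^o_y(s)-1]\,dy\Big\},\qquad s\in(-\infty,0]^k;$$ (ii) if [$\rho\le0$ and $\delta>0$] or [$\rho>0$ and $\delta>\rho$], then $\delta I-A$ is invertible and $e^{-\delta t}N(t)$ converges in probability to $\lambda_\infty(\delta I-A)^{-1}\mathbf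 n_0$; (iii) if $\rho=\delta>0$ and moreover $\mathbb E[(Y^{(i)}_j)^2]<\infty$ for all $i,j$, then $e^{-\delta t}N(t)/t$ converges in probability to $\lambda_\infty v_1u$. -/

import Mathlib

open MeasureTheory ProbabilityTheory Filter Topology Matrix
open scoped NNReal ENNReal

noncomputable section

/-! ### The family tree of one initial particle

Particles are labelled in the Ulam-Harris way. The label `[]` is the initial particle, and
`[(j₁, c₁), …, (jₙ, cₙ)]` is the child of type `jₙ` with number `cₙ` (counted from `0` among the
type `jₙ` children) of the particle `[(j₁, c₁), …, (jₙ₋₁, cₙ₋₁)]`. -/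

/-- Labels of (potential) particles. -/
abbrev ParticleLabel (k : ℕ) : Type := List (Fin k × ℕ)

/-- The type of a particle, when the initial particle has type `i`. -/
def particleType {k : ℕ} : Fin k → ParticleLabel k → Fin k
  | i, [] => i
  | _, a :: w => particleType a.1 w

/-- The particle with the given label is born at some time: `y w j` is the number of type `j`
particles that particle `w` produces at its death, and every particle on the path from the initial
particle must be among the particles produced by its parent. -/
def IsBorn {k : ℕ} : (ParticleLabel k → Fin k → ℕ) → ParticleLabel k → Prop
  | _, [] => True
  | y, a :: w => a.2 < y [] a.1 ∧ IsBorn (fun w' => y (a :: w')) w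

/-- The birth time of a particle: the sum of the lifetimes of its ancestors, where `l w` is the
lifetime of particle `w`. -/
def birthTime {k : ℕ} : (ParticleLabel k → ℝ) → ParticleLabel k → ℝ
  | _, [] => 0
  | l, a :: w => l [] + birthTime (fun w' => l (a :: w')) w

/-- The vector of the numbers of particles of each type alive at time `t`, for one initial particle
of type `i` at time `0`, with lifetimes `l` and offspring numbers `y`. -/
def aliveCount {k : ℕ} (i : Fin k) (l : ParticleLabel k → ℝ) (y : ParticleLabel k → Fin k → ℕ)
    (t : ℝ) (j : Fin k) : ℕ :=
  Set.ncard {w : ParticleLabel k | particleType i w = j ∧ IsBorn y w ∧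
    birthTime l w ≤ t ∧ t < birthTime l w + l w}

/-! ### Immigration -/

/-- The number `S(t)` of arrivals up to time `t`, where `τ n` is the time of the arrival with
number `n + 1`. -/
def arrivalCount (τ : ℕ → ℝ) (t : ℝ) : ℕ :=
  Set.ncard {n : ℕ | τ n ≤ t}

/-- `T 0, T 1, …` are the successive arrival times of a nonhomogeneous Poisson process on `[0, ∞)`
with intensity `lam`. -/
structure IsNHPP {Ω : Type*} [MeasurableSpace Ω] (P : Measure Ω) (lam : ℝ → ℝ)
    (T : ℕ → Ω → ℝ) : Prop where
  measurable : ∀ n, Measurable (T n)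
  pos : ∀ᵐ ω ∂P, ∀ n, 0 < T n ω
  monotone : ∀ᵐ ω ∂P, Monotone fun n => T n ω
  tendsto : ∀ᵐ ω ∂P, Tendsto (fun n => T n ω) atTop atTop
  indep_increments :
    HasIndepIncrements (fun (t : ℝ≥0) (ω : Ω) => arrivalCount (fun n => T n ω) t) P
  law_increments : ∀ s t : ℝ, 0 ≤ s → s ≤ t →
    HasLaw (fun ω => arrivalCount (fun n => T n ω) t - arrivalCount (fun n => T n ω) s)
      (poissonMeasure (∫ x in s..t, lam x).toNNReal) P

/-- The random ingredients of the branching process with immigration of type `0` particles.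
`T n` are the arrival times of the immigrants. For the family tree of immigrant `n`, `L n w` is the
lifetime of particle `w` and `Y n w` the vector of the numbers of its children of each type.
A type `i` particle has an exponential lifetime with rate `r i` (mean `1 / r i`), independent of
its offspring vector, which has law `p i`. All particles of all trees are mutually independent, and
independent of the arrival times. -/
structure IsBranchingModel {Ω : Type*} [MeasurableSpace Ω] (P : Measure Ω) {k : ℕ} [NeZero k]
    (r : Fin k → ℝ) (p : Fin k → PMF (Fin k → ℕ)) (lam : ℝ → ℝ)
    (T : ℕ → Ω → ℝ) (L : ℕ → ParticleLabel k → Ω → ℝ)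
    (Y : ℕ → ParticleLabel k → Ω → Fin k → ℕ) : Prop where
  arrivals : IsNHPP P lam T
  measurable_lifetime : ∀ n w, Measurable (L n w)
  measurable_offspring : ∀ n w, Measurable (Y n w)
  law_particle : ∀ n w, HasLaw (fun ω => (L n w ω, Y n w ω))
    ((expMeasure (r (particleType 0 w))).prod (p (particleType 0 w)).toMeasure) P
  indep_particles :
    iIndepFun (fun (x : ℕ × ParticleLabel k) (ω : Ω) => (L x.1 x.2 ω, Y x.1 x.2 ω)) P
  indep_arrivals : IndepFun (fun ω (n : ℕ) => T n ω)
    (fun ω (x : ℕ × ParticleLabel k) => (L x.1 x.2 ω, Y x.1 x.2 ω)) P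

/-- The process `N^{o,n}(t)`: numbers of particles of each type at time `t` after the arrival of
immigrant `n`, in the family tree of that immigrant. -/
def treePopulation {Ω : Type*} {k : ℕ} [NeZero k] (L : ℕ → ParticleLabel k → Ω → ℝ)
    (Y : ℕ → ParticleLabel k → Ω → Fin k → ℕ) (n : ℕ) (t : ℝ) (ω : Ω) : Fin k → ℝ :=
  fun j => (aliveCount 0 (fun w => L n w ω) (fun w => Y n w ω) t j : ℝ)

/-- The process with immigration, `N(t) = ∑_{n ≤ S(t)} N^{o,n}(t - Tₙ)`. -/
def population {Ω : Type*} {k : ℕ} [NeZero k] (T : ℕ → Ω → ℝ) (L : ℕ → ParticleLabel k → Ω → ℝ)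
    (Y : ℕ → ParticleLabel k → Ω → Fin k → ℕ) (t : ℝ) (ω : Ω) : Fin k → ℝ :=
  ∑ n ∈ Finset.range (arrivalCount (fun m => T m ω) t), treePopulation L Y n (t - T n ω) ω

/-- The Laplace transform `s ↦ E[exp ⟨s, X⟩]` of a random vector. -/
def vectorLaplace {Ω : Type*} [MeasurableSpace Ω] {k : ℕ} (P : Measure Ω) (X : Ω → Fin k → ℝ)
    (s : Fin k → ℝ) : ℝ :=
  ∫ ω, Real.exp (s ⬝ᵥ X ω) ∂P

/-! ### The mean matrix -/

/-- `m i j`, the mean number of type `j` children of a type `i` particle. -/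
def meanOffspring {k : ℕ} (p : Fin k → PMF (Fin k → ℕ)) (i j : Fin k) : ℝ :=
  ∫ n, (n j : ℝ) ∂(p i).toMeasure

/-- The matrix `A` with `A i j = r j * (m j i - 1_{i = j})`, which is the generator of the means:
`E[N^o(t)] = exp (t A) n₀` for column vectors. -/
def meanGenerator {k : ℕ} (r : Fin k → ℝ) (p : Fin k → PMF (Fin k → ℕ)) :
    Matrix (Fin k) (Fin k) ℝ :=
  Matrix.of fun i j => r j * (meanOffspring p j i - if i = j then 1 else 0)

/-- All entries of `exp (t₀ A)` are positive for some `t₀ > 0`. -/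
def IsRegularMatrix {k : ℕ} (A : Matrix (Fin k) (Fin k) ℝ) : Prop :=
  ∃ t₀ : ℝ, 0 < t₀ ∧ ∀ i j, 0 < NormedSpace.exp (t₀ • A) i j

/-- The largest real part of a complex eigenvalue of `A`. For a regular matrix this is the largest
eigenvalue, which is real and simple by the Perron-Frobenius theorem. -/
def largestEigenvalue {k : ℕ} (A : Matrix (Fin k) (Fin k) ℝ) : ℝ :=
  sSup (Complex.re '' spectrum ℂ (A.map (algebraMap ℝ ℂ)))

end

/-! Given the arrival times, the families are independent copies of one random tree. For `ζ` with
nonpositive real parts, E exp⟨ζ, N(t)⟩ is therefore the generating functional of a marked Poisson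
process: it equals exp ∫₀ᵗ λ(t-y) (φ_y(ζ) - 1) dy, where φ_y is the transform of a single family
(`IsBranchingModel.integral_cexp_population`). All three assertions are limits of this exponent.

The mean of one family is e^{yA} n₀ (`lintegral_aliveMass_single`). It solves the renewal equation
obtained by conditioning on the death of the root. Truncating at `n` generations allows an induction
on `n` with supersolutions from above and a geometrically small error from below. The spectrum of A
bounds e^{yA} by C e^{βy} for every β > ρ, and integrating an exact derivative identifies (δI - A)⁻¹
with the Laplace transform of e^{yA} (`integral_exp_mul_matrix_exp`).

(i) If ρ < 0, then φ_y - 1 decays exponentially and the exponent converges to λ_∞ ∫₀^∞ (φ_y - 1) dy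
(`tendsto_integral_comp_sub_mul`). The exponential of this limit is the transform of a compound
Poisson law, whose jump measure is the image of dy ⊗ (tree law) under the population count, with the
atom at 0 removed (`exists_stationaryLaw`). Imaginary ζ give convergence in law, real ζ the Laplace
transform.

(ii), (iii) The limits are constants, so it is enough to follow Laplace transforms of single
coordinates (`tendstoInMeasure_const_of_tendsto_laplace`). With ζ = -θ e^{-δt} e_j, the quantity
e^{δt}(φ_y - 1) tends to -θ times the mean and is dominated by it; e^{-δy} e^{yA} is integrable
because ρ < δ. If ρ = δ, e^{-δy} e^{yA} is only bounded, and the additional factor 1/t produces a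
time average, which tends to the entries of u v' (`tendsto_average_matrix_exp`). The error of
linearisation is then controlled by second moments of order e^{2ρy}
(`exists_integral_treeCount_sq_le`). -/

/-! ### Matrix exponentials -/

section MatrixExponential

open scoped Matrix.Norms.Operator

theorem hasDerivAt_matrix_exp_apply {n : Type*} [Fintype n] [DecidableEq n]
    (A : Matrix n n ℝ) (i j : n) (t : ℝ) :
    HasDerivAt (fun t : ℝ => NormedSpace.exp (t • A) i j) ((NormedSpace.exp (t • A) * A) i j) t := by
  have h := hasDerivAt_exp_smul_const (𝕂 := ℝ) A t
  have h1 := (hasDerivAt_pi.1 h i)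
  exact hasDerivAt_pi.1 h1 j

theorem hasDerivAt_matrix_exp_apply' {n : Type*} [Fintype n] [DecidableEq n]
    (A : Matrix n n ℝ) (i j : n) (t : ℝ) :
    HasDerivAt (fun t : ℝ => NormedSpace.exp (t • A) i j) ((A * NormedSpace.exp (t • A)) i j) t := by
  have h := hasDerivAt_exp_smul_const' (𝕂 := ℝ) A t
  have h1 := (hasDerivAt_pi.1 h i)
  exact hasDerivAt_pi.1 h1 j

theorem continuous_matrix_exp_apply {n : Type*} [Fintype n] [DecidableEq n]
    (A : Matrix n n ℝ) (i j : n) : Continuous fun t : ℝ => NormedSpace.exp (t • A) i j :=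
  continuous_iff_continuousAt.2 fun t => (hasDerivAt_matrix_exp_apply A i j t).continuousAt

theorem matrix_exp_smul_one {n : Type*} [Fintype n] [DecidableEq n] {𝕜 : Type*} [RCLike 𝕜] (c : 𝕜) :
    NormedSpace.exp (c • (1 : Matrix n n 𝕜)) = NormedSpace.exp c • 1 := by
  have h := NormedSpace.algebraMap_exp_comm (𝕂 := 𝕜) (𝔸 := Matrix n n 𝕜) c
  rw [Algebra.algebraMap_eq_smul_one, Algebra.algebraMap_eq_smul_one] at h
  exact h.symm

theorem matrix_exp_smul_add_smul_one {n : Type*} [Fintype n] [DecidableEq n] {𝕜 : Type*} [RCLike 𝕜]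
    (B : Matrix n n 𝕜) (t c : 𝕜) :
    NormedSpace.exp (t • (B + c • (1 : Matrix n n 𝕜))) =
      NormedSpace.exp (t * c) • NormedSpace.exp (t • B) := by
  rw [smul_add, Matrix.exp_add_of_commute, smul_smul, matrix_exp_smul_one, mul_smul_comm, mul_one]
  rw [smul_smul]
  exact (Commute.one_right _).smul_right _

theorem matrix_exp_nonneg_of_nonneg {n : Type*} [Fintype n] [DecidableEq n]
    {A : Matrix n n ℝ} (hA : ∀ i j, 0 ≤ A i j) (i j : n) : 0 ≤ NormedSpace.exp A i j := by
  have hpow : ∀ m : ℕ, ∀ i j, 0 ≤ (A ^ m) i j := by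
    intro m
    induction m with
    | zero => intro i j; by_cases h : i = j <;> simp [h]
    | succ m ih =>
      intro i j
      rw [pow_succ, Matrix.mul_apply]
      exact Finset.sum_nonneg fun l _ => mul_nonneg (ih i l) (hA l j)
  have h := NormedSpace.exp_series_hasSum_exp' (𝕂 := ℝ) A
  have h1 := Pi.hasSum.1 (Pi.hasSum.1 h i) j
  refine h1.nonneg fun m => ?_
  simp only [Matrix.smul_apply, smul_eq_mul]
  exact mul_nonneg (by positivity) (hpow m i j)

/-- The exponential of a matrix with nonnegative off-diagonal entries is nonnegative. -/
theorem matrix_exp_nonneg {n : Type*} [Fintype n] [DecidableEq n]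
    {A : Matrix n n ℝ} (hA : ∀ i j, i ≠ j → 0 ≤ A i j) {t : ℝ} (ht : 0 ≤ t) (i j : n) :
    0 ≤ NormedSpace.exp (t • A) i j := by
  -- Adding `c` to the diagonal makes the matrix entrywise nonnegative and only multiplies the
  -- exponential by a positive scalar.
  set c : ℝ := ∑ i, |A i i| with hc
  have hB : ∀ i j, 0 ≤ (A + c • (1 : Matrix n n ℝ)) i j := by
    intro i j
    by_cases h : i = j
    · subst h
      have h1 : |A i i| ≤ c := Finset.single_le_sum (f := fun i => |A i i|)
        (fun _ _ => abs_nonneg _) (Finset.mem_univ i)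
      simp only [Matrix.add_apply, Matrix.smul_apply, Matrix.one_apply_eq, smul_eq_mul, mul_one]
      linarith [neg_abs_le (A i i)]
    · simpa [h] using hA i j h
  have h1 : A = (A + c • (1 : Matrix n n ℝ)) + (-c) • (1 : Matrix n n ℝ) := by
    rw [add_assoc, ← add_smul]; simp
  rw [h1, matrix_exp_smul_add_smul_one, Matrix.smul_apply, smul_eq_mul, ← Real.exp_eq_exp_ℝ]
  refine mul_nonneg (Real.exp_pos _).le (matrix_exp_nonneg_of_nonneg (fun i j => ?_) i j)
  exact mul_nonneg ht (hB i j)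

/-- Applied to `v`, the exponential series stops at `m`, and each remaining power satisfies t^l / l!
≤ ε^{-l} e^{εt}. -/
theorem norm_matrix_exp_mulVec_le_of_nilpotent {n : Type*} [Fintype n] [DecidableEq n]
    (N : Matrix n n ℂ) (v : n → ℂ) (m : ℕ) (hv : N ^ m *ᵥ v = 0) {ε : ℝ} (hε : 0 < ε) :
    ∃ C, ∀ t : ℝ, 0 ≤ t → ‖NormedSpace.exp ((t : ℂ) • N) *ᵥ v‖ ≤ C * Real.exp (ε * t) := by
  refine ⟨∑ l ∈ Finset.range m, (ε⁻¹) ^ l * ‖N ^ l *ᵥ v‖, fun t ht => ?_⟩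
  have h := NormedSpace.exp_series_hasSum_exp' (𝕂 := ℂ) ((t : ℂ) • N)
  have h1 : HasSum (fun l : ℕ => (((l.factorial : ℂ)⁻¹ * (t : ℂ) ^ l)) • (N ^ l *ᵥ v))
      (NormedSpace.exp ((t : ℂ) • N) *ᵥ v) := by
    have h2 := h.map (Matrix.mulVec.addMonoidHomLeft v)
      (by
        change Continuous fun M : Matrix n n ℂ => M *ᵥ v
        fun_prop)
    convert! h2 using 1
    ext1 l
    simp [Matrix.mulVec.addMonoidHomLeft, smul_pow, Matrix.smul_mulVec, mul_smul,
      ← Complex.ofReal_pow, Complex.coe_smul]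
  have hz : ∀ l, l ∉ Finset.range m → (((l.factorial : ℂ)⁻¹ * (t : ℂ) ^ l)) • (N ^ l *ᵥ v) = 0 := by
    intro l hl
    obtain ⟨d, rfl⟩ := Nat.exists_eq_add_of_le (not_lt.1 (by simpa using hl))
    rw [add_comm m d, pow_add N, ← Matrix.mulVec_mulVec, hv, Matrix.mulVec_zero, smul_zero]
  rw [h1.unique (hasSum_sum_of_ne_finset_zero hz), Finset.sum_mul]
  refine (norm_sum_le _ _).trans (Finset.sum_le_sum fun l _ => ?_)
  rw [norm_smul, norm_mul, norm_inv, norm_pow, Complex.norm_natCast, Complex.norm_real,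
    Real.norm_of_nonneg ht]
  have h3 := Real.pow_div_factorial_le_exp (ε * t) (by positivity) l
  rw [mul_pow, div_le_iff₀ (by positivity)] at h3
  have h4 : ((l.factorial : ℝ))⁻¹ * t ^ l ≤ (ε⁻¹) ^ l * Real.exp (ε * t) := by
    rw [inv_pow, inv_mul_le_iff₀ (by positivity), ← mul_assoc, mul_comm _ ((ε ^ l)⁻¹), mul_assoc,
      le_inv_mul_iff₀ (by positivity)]
    linarith
  calc _ ≤ (ε⁻¹) ^ l * Real.exp (ε * t) * ‖N ^ l *ᵥ v‖ := by gcongr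
    _ = _ := by ring

/-- The vectors satisfying such a bound form a subspace. It contains each generalized eigenspace,
where e^{tB} is e^{tμ} times the exponential of a matrix nilpotent on the vector; the gap β - Re μ
absorbs the polynomial growth. Over ℂ these spaces span everything. -/
theorem exists_norm_matrix_exp_mulVec_le {n : Type*} [Fintype n] [DecidableEq n]
    (B : Matrix n n ℂ) {β : ℝ} (hβ : ∀ z ∈ spectrum ℂ B, z.re < β) (v : n → ℂ) :
    ∃ C, ∀ t : ℝ, 0 ≤ t → ‖NormedSpace.exp ((t : ℂ) • B) *ᵥ v‖ ≤ C * Real.exp (β * t) := by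
  let S : Submodule ℂ (n → ℂ) :=
    { carrier := {v | ∃ C, ∀ t : ℝ, 0 ≤ t →
        ‖NormedSpace.exp ((t : ℂ) • B) *ᵥ v‖ ≤ C * Real.exp (β * t)}
      add_mem' := by
        rintro a b ⟨C, hC⟩ ⟨D, hD⟩
        refine ⟨C + D, fun t ht => ?_⟩
        rw [Matrix.mulVec_add, add_mul]
        exact (norm_add_le _ _).trans (add_le_add (hC t ht) (hD t ht))
      zero_mem' := ⟨0, fun t _ => by simp⟩
      smul_mem' := by
        rintro c a ⟨C, hC⟩
        refine ⟨‖c‖ * C, fun t ht => ?_⟩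
        rw [Matrix.mulVec_smul, norm_smul, mul_assoc]
        exact mul_le_mul_of_nonneg_left (hC t ht) (norm_nonneg _) }
  have hS : S = ⊤ := by
    rw [eq_top_iff, ← Module.End.iSup_maxGenEigenspace_eq_top (Matrix.toLin' B), iSup_le_iff]
    intro μ x hx
    by_cases hμ : μ ∈ spectrum ℂ B
    · obtain ⟨m, hm⟩ := (Module.End.mem_maxGenEigenspace _ _ _).1 hx
      set N : Matrix n n ℂ := B - μ • 1 with hN
      have hNx : N ^ m *ᵥ x = 0 := by
        have h1 : (Matrix.toLin' B - μ • 1) = Matrix.toLin' N := by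
          rw [hN, map_sub, map_smul, Matrix.toLin'_one]; rfl
        rw [h1, ← Matrix.toLin'_pow, Matrix.toLin'_apply] at hm
        exact hm
      obtain ⟨C, hC⟩ := norm_matrix_exp_mulVec_le_of_nilpotent N x m hNx
        (ε := β - μ.re) (sub_pos.2 (hβ μ hμ))
      refine ⟨C, fun t ht => ?_⟩
      have h2 : B = N + μ • 1 := by rw [hN]; simp
      rw [h2, matrix_exp_smul_add_smul_one, Matrix.smul_mulVec, norm_smul,
        ← Complex.exp_eq_exp_ℂ, Complex.norm_exp]
      have h3 : ((t : ℂ) * μ).re = t * μ.re := by simp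
      rw [h3]
      calc _ ≤ Real.exp (t * μ.re) * (C * Real.exp ((β - μ.re) * t)) := by
            gcongr; exact hC t ht
        _ = C * (Real.exp (t * μ.re) * Real.exp ((β - μ.re) * t)) := by ring
        _ = C * Real.exp (β * t) := by rw [← Real.exp_add]; congr 2; ring
    · have h0 : Module.End.maxGenEigenspace (Matrix.toLin' B) μ = ⊥ := by
        by_contra hne
        apply hμ
        rw [← Matrix.spectrum_toLin', ← Module.End.hasEigenvalue_iff_mem_spectrum]
        exact Module.End.HasUnifEigenvalue.lt zero_lt_one hne
      rw [h0, Submodule.mem_bot] at hx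
      rw [hx]; exact S.zero_mem
  have : v ∈ S := hS ▸ Submodule.mem_top
  exact this

/-- The spectrum is finite, so the real `sSup` is a genuine upper bound and not a default value. -/
theorem re_le_largestEigenvalue {k : ℕ} (A : Matrix (Fin k) (Fin k) ℝ) {z : ℂ}
    (hz : z ∈ spectrum ℂ (A.map (algebraMap ℝ ℂ))) : z.re ≤ largestEigenvalue A :=
  le_csSup ((Matrix.finite_spectrum _).image _).bddAbove ⟨z, hz, rfl⟩

theorem matrix_map_exp {n : Type*} [Fintype n] [DecidableEq n] (A : Matrix n n ℝ) :
    (NormedSpace.exp A).map (algebraMap ℝ ℂ) = NormedSpace.exp (A.map (algebraMap ℝ ℂ)) := by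
  have := NormedSpace.map_exp (RingHom.mapMatrix (m := n) (algebraMap ℝ ℂ)) 
    (by
      change Continuous fun M : Matrix n n ℝ => M.map (algebraMap ℝ ℂ)
      exact Continuous.matrix_map continuous_id Complex.continuous_ofReal) A
  exact this

theorem exists_abs_matrix_exp_apply_le {k : ℕ} (A : Matrix (Fin k) (Fin k) ℝ) {β : ℝ}
    (hβ : largestEigenvalue A < β) :
    ∃ C, 0 ≤ C ∧ ∀ t : ℝ, 0 ≤ t → ∀ i j,
      |NormedSpace.exp (t • A) i j| ≤ C * Real.exp (β * t) := by
  choose C hC using fun j : Fin k => exists_norm_matrix_exp_mulVec_le (A.map (algebraMap ℝ ℂ))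
    (fun z hz => (re_le_largestEigenvalue A hz).trans_lt hβ) (Pi.single j 1)
  have key : ∀ j, ∀ t : ℝ, 0 ≤ t → ∀ i, |NormedSpace.exp (t • A) i j| ≤ C j * Real.exp (β * t) := by
    intro j t ht i
    refine le_trans ?_ (hC j t ht)
    have h1 : (t : ℂ) • A.map (algebraMap ℝ ℂ) = (t • A).map (algebraMap ℝ ℂ) := by
      ext a b; simp
    rw [h1, ← matrix_map_exp]
    refine le_trans (le_of_eq ?_) (norm_le_pi_norm _ i)
    simp
  have hC0 : ∀ j, 0 ≤ C j := fun j => by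
    have := (abs_nonneg _).trans (key j 0 le_rfl j); simpa using this
  refine ⟨∑ j, C j, Finset.sum_nonneg fun j _ => hC0 j, fun t ht i j => (key j t ht i).trans ?_⟩
  gcongr
  exact Finset.single_le_sum (f := C) (fun j _ => hC0 j) (Finset.mem_univ j)

theorem isUnit_smul_one_sub {k : ℕ} (A : Matrix (Fin k) (Fin k) ℝ) {δ : ℝ}
    (hδ : largestEigenvalue A < δ) : IsUnit (δ • (1 : Matrix (Fin k) (Fin k) ℝ) - A) := by
  have h1 : (δ : ℂ) ∉ spectrum ℂ (A.map (algebraMap ℝ ℂ)) := fun h =>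
    absurd (re_le_largestEigenvalue A h) (by simpa using hδ)
  rw [spectrum.notMem_iff, Matrix.isUnit_iff_isUnit_det, isUnit_iff_ne_zero] at h1
  rw [Matrix.isUnit_iff_isUnit_det, isUnit_iff_ne_zero]
  intro h2
  apply h1
  have h3 : (algebraMap ℂ (Matrix (Fin k) (Fin k) ℂ) (δ : ℂ)) - A.map (algebraMap ℝ ℂ)
      = (algebraMap ℝ ℂ).mapMatrix (δ • (1 : Matrix (Fin k) (Fin k) ℝ) - A) := by
    ext a b
    by_cases h : a = b <;> simp [h, Matrix.algebraMap_matrix_apply]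
  rw [h3, ← RingHom.map_det, h2, map_zero]

theorem integrableOn_exp_mul_matrix_exp {k : ℕ} (A : Matrix (Fin k) (Fin k) ℝ) {δ : ℝ}
    (hδ : largestEigenvalue A < δ) (i j : Fin k) :
    IntegrableOn (fun y : ℝ => Real.exp (-(δ * y)) * NormedSpace.exp (y • A) i j) (Set.Ioi 0) := by
  obtain ⟨β, h1, h2⟩ := exists_between hδ
  obtain ⟨C, hC0, hC⟩ := exists_abs_matrix_exp_apply_le A h1
  have h3 : IntegrableOn (fun y : ℝ => C * Real.exp (-(δ - β) * y)) (Set.Ioi 0) :=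
    (exp_neg_integrableOn_Ioi 0 (sub_pos.2 h2)).const_mul C
  refine Integrable.mono' h3 ?_ ?_
  · have := continuous_matrix_exp_apply A i j
    exact Continuous.aestronglyMeasurable (by fun_prop)
  · refine (ae_restrict_iff' measurableSet_Ioi).2 (Eventually.of_forall fun y hy => ?_)
    rw [norm_mul, Real.norm_of_nonneg (Real.exp_pos _).le]
    calc _ ≤ Real.exp (-(δ * y)) * (C * Real.exp (β * y)) := by
          gcongr; exact hC y (le_of_lt hy) i j
      _ = C * (Real.exp (-(δ * y)) * Real.exp (β * y)) := by ring
      _ = _ := by rw [← Real.exp_add]; congr 2; ring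

/-- The derivative of -e^{-δy} e^{yA} is e^{-δy} e^{yA} (δI - A). Integrating over the half-line
leaves the identity matrix, so the integral is a left inverse of δI - A. -/
theorem integral_exp_mul_matrix_exp {k : ℕ} (A : Matrix (Fin k) (Fin k) ℝ) {δ : ℝ}
    (hδ : largestEigenvalue A < δ) (i j : Fin k) :
    ∫ y in Set.Ioi (0 : ℝ), Real.exp (-(δ * y)) * NormedSpace.exp (y • A) i j =
      (δ • (1 : Matrix (Fin k) (Fin k) ℝ) - A)⁻¹ i j := by
  set D : Matrix (Fin k) (Fin k) ℝ := δ • 1 - A with hD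
  set J : Matrix (Fin k) (Fin k) ℝ := Matrix.of fun i j =>
    ∫ y in Set.Ioi (0 : ℝ), Real.exp (-(δ * y)) * NormedSpace.exp (y • A) i j with hJ
  have hJD : J * D = 1 := by
    ext a b
    have hint := fun c => integrableOn_exp_mul_matrix_exp A hδ a c
    have h1 : (J * D) a b = ∫ y in Set.Ioi (0 : ℝ),
        ∑ c, Real.exp (-(δ * y)) * NormedSpace.exp (y • A) a c * D c b := by
      rw [Matrix.mul_apply, integral_finsetSum _ fun c _ => (hint c).mul_const _]
      exact Finset.sum_congr rfl fun c _ => (integral_mul_const _ _).symm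
    have h2 : ∀ y ∈ Set.Ici (0 : ℝ),
        HasDerivAt (fun y => -(Real.exp (-(δ * y)) * NormedSpace.exp (y • A) a b))
        (∑ c, Real.exp (-(δ * y)) * NormedSpace.exp (y • A) a c * D c b) y := by
      intro y _
      have e1 : HasDerivAt (fun y : ℝ => Real.exp (-(δ * y))) (Real.exp (-(δ * y)) * (-δ)) y := by
        have := ((hasDerivAt_id y).const_mul δ).neg.exp
        simpa using this
      convert! (e1.mul (hasDerivAt_matrix_exp_apply A a b y)).neg using 1
      have : ∑ c, NormedSpace.exp (y • A) a c * D c b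
          = δ * NormedSpace.exp (y • A) a b - (NormedSpace.exp (y • A) * A) a b := by
        rw [← Matrix.mul_apply, hD, Matrix.mul_sub, Matrix.sub_apply, Matrix.mul_smul,
          Matrix.mul_one, Matrix.smul_apply, smul_eq_mul]
      simp_rw [mul_assoc]
      rw [← Finset.mul_sum, this]
      ring
    have h3 : Tendsto (fun y : ℝ => -(Real.exp (-(δ * y)) * NormedSpace.exp (y • A) a b)) atTop
        (𝓝 0) := by
      obtain ⟨β, g1, g2⟩ := exists_between hδ
      obtain ⟨C, hC0, hC⟩ := exists_abs_matrix_exp_apply_le A g1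
      have h4 : Tendsto (fun y : ℝ => C * Real.exp (-((δ - β) * y))) atTop (𝓝 0) := by
        have : Tendsto (fun y : ℝ => (δ - β) * y) atTop atTop :=
          tendsto_id.const_mul_atTop (sub_pos.2 g2)
        simpa using (Real.tendsto_exp_neg_atTop_nhds_zero.comp this).const_mul C
      refine squeeze_zero_norm' ?_ h4
      filter_upwards [eventually_ge_atTop 0] with y hy
      rw [norm_neg, norm_mul, Real.norm_of_nonneg (Real.exp_pos _).le]
      calc _ ≤ Real.exp (-(δ * y)) * (C * Real.exp (β * y)) := by
            gcongr; exact hC y hy a b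
        _ = C * (Real.exp (-(δ * y)) * Real.exp (β * y)) := by ring
        _ = _ := by rw [← Real.exp_add]; congr 2; ring
    rw [h1, integral_Ioi_of_hasDerivAt_of_tendsto' h2
      (integrable_finsetSum _ fun c _ => (hint c).mul_const _) h3]
    simp
  have : D⁻¹ = J := Matrix.inv_eq_left_inv hJD
  rw [this, hJ]; rfl

end MatrixExponential

/-! ### Perron–Frobenius facts for a regular matrix with given positive eigenvectors -/

section PerronFrobenius

open scoped Matrix.Norms.Operator

/-- The function s ↦ e^{-ρs} v' e^{sA} has zero derivative. -/
theorem vecMul_matrix_exp {n : Type*} [Fintype n] [DecidableEq n] {A : Matrix n n ℝ}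
    {v : n → ℝ} {ρ : ℝ} (hv : v ᵥ* A = ρ • v) (t : ℝ) :
    v ᵥ* NormedSpace.exp (t • A) = Real.exp (ρ * t) • v := by
  ext j
  have hd : ∀ s, HasDerivAt (fun s : ℝ => Real.exp (-(ρ * s)) * (v ᵥ* NormedSpace.exp (s • A)) j)
      0 s := by
    intro s
    have e1 : HasDerivAt (fun y : ℝ => Real.exp (-(ρ * y))) (Real.exp (-(ρ * s)) * (-ρ)) s := by
      have := ((hasDerivAt_id s).const_mul ρ).neg.exp
      simpa using this
    have e2 : HasDerivAt (fun s : ℝ => (v ᵥ* NormedSpace.exp (s • A)) j)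
        ((v ᵥ* (A * NormedSpace.exp (s • A))) j) s := by
      simp only [Matrix.vecMul, dotProduct]
      exact HasDerivAt.fun_sum fun i _ => (hasDerivAt_matrix_exp_apply' A i j s).const_mul _
    convert! e1.mul e2 using 1
    rw [← Matrix.vecMul_vecMul, hv, Matrix.smul_vecMul, Pi.smul_apply, smul_eq_mul]
    ring
  have hc := is_const_of_deriv_eq_zero (fun s => (hd s).differentiableAt) (fun s => (hd s).deriv) t 0
  simp only [mul_zero, neg_zero, Real.exp_zero, zero_smul, NormedSpace.exp_zero,
    Matrix.vecMul_one, one_mul] at hc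
  rw [Pi.smul_apply, smul_eq_mul, ← hc, ← mul_assoc, ← Real.exp_add]
  simp

theorem matrix_exp_mulVec {n : Type*} [Fintype n] [DecidableEq n] {A : Matrix n n ℝ}
    {u : n → ℝ} {ρ : ℝ} (hu : A *ᵥ u = ρ • u) (t : ℝ) :
    NormedSpace.exp (t • A) *ᵥ u = Real.exp (ρ * t) • u := by
  rw [← Matrix.vecMul_transpose] at hu
  have h := vecMul_matrix_exp hu t
  rwa [← Matrix.transpose_smul, Matrix.exp_transpose, Matrix.vecMul_transpose] at h

/-- All terms of v' e^{tA} = e^{ρt} v' are nonnegative, so one of them is at most the sum. Unlike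
the spectral bound, this loses no ε in the rate, which the case ρ = δ requires. -/
theorem exists_matrix_exp_apply_le {n : Type*} [Fintype n] [DecidableEq n] {A : Matrix n n ℝ}
    (hA : ∀ i j, i ≠ j → 0 ≤ A i j) {v : n → ℝ} (hv0 : ∀ i, 0 < v i) {ρ : ℝ}
    (hv : v ᵥ* A = ρ • v) (i j : n) {t : ℝ} (ht : 0 ≤ t) :
    NormedSpace.exp (t • A) i j ≤ v j / v i * Real.exp (ρ * t) := by
  have h1 := congrFun (vecMul_matrix_exp hv t) j
  have h2 : v i * NormedSpace.exp (t • A) i j ≤ (v ᵥ* NormedSpace.exp (t • A)) j :=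
    Finset.single_le_sum (f := fun i => v i * NormedSpace.exp (t • A) i j)
      (fun a _ => mul_nonneg (hv0 a).le (matrix_exp_nonneg hA ht a j)) (Finset.mem_univ i)
  rw [h1, Pi.smul_apply, smul_eq_mul] at h2
  rw [div_mul_eq_mul_div, le_div_iff₀ (hv0 i)]
  linarith

/-- A positive right eigenvector of a regular matrix spans its eigenspace. -/
theorem eq_smul_of_mulVec_eq_smul {n : Type*} [Fintype n] [DecidableEq n] [Nonempty n]
    {A : Matrix n n ℝ} {t₀ : ℝ} (hA : ∀ i j, 0 < NormedSpace.exp (t₀ • A) i j)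
    {u z : n → ℝ} (hu0 : ∀ i, 0 < u i) {ρ : ℝ} (hu : A *ᵥ u = ρ • u) (hz : A *ᵥ z = ρ • z) :
    ∃ c : ℝ, z = c • u := by
  obtain ⟨i₀, -, hi₀⟩ := Finset.exists_max_image Finset.univ (fun i => z i / u i)
    Finset.univ_nonempty
  refine ⟨z i₀ / u i₀, ?_⟩
  set c := z i₀ / u i₀ with hc
  -- By maximality of the ratio, `w` is a nonnegative eigenvector with a zero coordinate. Row `i₀`
  -- of the positive matrix exp(t₀A) annihilates it, which forces `w = 0`.
  set w : n → ℝ := c • u - z with hw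
  have hw0 : ∀ i, 0 ≤ w i := fun i => by
    have := hi₀ i (Finset.mem_univ i)
    rw [div_le_iff₀ (hu0 i)] at this
    simpa [hw] using this
  have hwi : w i₀ = 0 := by simp [hw, hc, (hu0 i₀).ne']
  have hAw : A *ᵥ w = ρ • w := by
    rw [hw, Matrix.mulVec_sub, Matrix.mulVec_smul, hu, hz, smul_sub, smul_comm]
  have h1 := congrFun (matrix_exp_mulVec hAw t₀) i₀
  rw [Pi.smul_apply, hwi, smul_zero] at h1
  have h2 := (Finset.sum_eq_zero_iff_of_nonneg
    (fun j _ => mul_nonneg (hA i₀ j).le (hw0 j))).1 h1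
  ext j
  have h3 := h2 j (Finset.mem_univ j)
  have h4 : w j = 0 := (mul_eq_zero.1 h3).resolve_left (hA i₀ j).ne'
  simp only [hw, Pi.sub_apply] at h4
  linarith

/-- The range of A - ρ lies in the hyperplane orthogonal to `v`. Since the ρ-eigenspace is at most a
line, rank–nullity makes the two equal. -/
theorem exists_mulVec_eq_of_dotProduct_eq_zero {n : Type*} [Fintype n] [DecidableEq n] [Nonempty n]
    {A : Matrix n n ℝ} {t₀ : ℝ} (hA : ∀ i j, 0 < NormedSpace.exp (t₀ • A) i j)
    {u v : n → ℝ} (hu0 : ∀ i, 0 < u i) (hv0 : ∀ i, 0 < v i) {ρ : ℝ} (hu : A *ᵥ u = ρ • u)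
    (hv : v ᵥ* A = ρ • v) {w : n → ℝ} (hw : v ⬝ᵥ w = 0) :
    ∃ x, (A - ρ • 1) *ᵥ x = w := by
  set T := Matrix.toLin' (A - ρ • (1 : Matrix n n ℝ)) with hT
  have hTx : ∀ x, T x = A *ᵥ x - ρ • x := fun x => by
    rw [hT, Matrix.toLin'_apply, Matrix.sub_mulVec, Matrix.smul_mulVec, Matrix.one_mulVec]
  let φ : (n → ℝ) →ₗ[ℝ] ℝ := dotProductBilin ℝ ℝ v
  have hφx : ∀ x, φ x = v ⬝ᵥ x := fun x => rfl
  have hle : LinearMap.range T ≤ LinearMap.ker φ := by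
    rintro _ ⟨x, rfl⟩
    rw [LinearMap.mem_ker, hφx, hTx, dotProduct_sub, Matrix.dotProduct_mulVec, hv,
      dotProduct_smul, smul_dotProduct, sub_self]
  have hker : LinearMap.ker T ≤ Submodule.span ℝ {u} := by
    intro z hz
    rw [LinearMap.mem_ker, hTx, sub_eq_zero] at hz
    obtain ⟨c, rfl⟩ := eq_smul_of_mulVec_eq_smul hA hu0 hu hz
    exact Submodule.smul_mem _ _ (Submodule.mem_span_singleton_self u)
  have h1 : Module.finrank ℝ (LinearMap.ker T) ≤ 1 :=
    (Submodule.finrank_mono hker).trans (finrank_span_singleton (fun h0 =>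
      (hu0 (Classical.arbitrary n)).ne' (congrFun h0 _))).le
  have h2 := LinearMap.finrank_range_add_finrank_ker T
  have h3 := LinearMap.finrank_range_add_finrank_ker φ
  have h4 : Module.finrank ℝ (LinearMap.range φ) = 1 := by
    have : LinearMap.range φ = ⊤ := by
      rw [LinearMap.range_eq_top]
      refine LinearMap.surjective ?_
      intro h0
      have h5 : φ (Pi.single (Classical.arbitrary n) 1) = 0 := by rw [h0]; rfl
      rw [hφx, dotProduct_single_one] at h5
      exact (hv0 _).ne' h5
    rw [this, finrank_top, Module.finrank_self]
  have heq : LinearMap.range T = LinearMap.ker φ :=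
    Submodule.eq_of_le_of_finrank_le hle (by omega)
  have hw' : w ∈ LinearMap.range T := by
    rw [heq, LinearMap.mem_ker, hφx, hw]
  obtain ⟨x, hx⟩ := hw'
  exact ⟨x, hx⟩

/-- Averaged form of the Perron-Frobenius convergence `exp (-ρ y) exp (y A) → u v'`. -/
theorem tendsto_average_matrix_exp {n : Type*} [Fintype n] [DecidableEq n] [Nonempty n]
    {A : Matrix n n ℝ} (hA0 : ∀ i j, i ≠ j → 0 ≤ A i j) {t₀ : ℝ}
    (hA : ∀ i j, 0 < NormedSpace.exp (t₀ • A) i j)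
    {u v : n → ℝ} (hu0 : ∀ i, 0 < u i) (hv0 : ∀ i, 0 < v i) {ρ : ℝ} (hu : A *ᵥ u = ρ • u)
    (hv : v ᵥ* A = ρ • v) (huv : u ⬝ᵥ v = 1) (i j : n) :
    Tendsto (fun t : ℝ => t⁻¹ * ∫ y in (0 : ℝ)..t,
      Real.exp (-(ρ * y)) * NormedSpace.exp (y • A) i j) atTop (𝓝 (u i * v j)) := by
  -- With (A - ρ)x = e_j - v_j u, the function F(y) = e^{-ρy} (e^{yA} x)_i has the integrand minus
  -- u_i v_j as its derivative. As F is bounded, the difference of averages is O(1/t).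
  obtain ⟨x, hx⟩ := exists_mulVec_eq_of_dotProduct_eq_zero hA hu0 hv0 hu hv
    (w := Pi.single j 1 - v j • u) (by
      rw [dotProduct_sub, dotProduct_single_one, dotProduct_smul, dotProduct_comm, huv]; simp)
  have e1 : ∀ s : ℝ, HasDerivAt (fun y : ℝ => Real.exp (-(ρ * y)))
      (Real.exp (-(ρ * s)) * (-ρ)) s := by
    intro s
    have := ((hasDerivAt_id s).const_mul ρ).neg.exp
    simpa using this
  let F : ℝ → ℝ := fun y => Real.exp (-(ρ * y)) * (NormedSpace.exp (y • A) *ᵥ x) i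
  have hF : ∀ s, HasDerivAt F
      (Real.exp (-(ρ * s)) * NormedSpace.exp (s • A) i j - u i * v j) s := by
    intro s
    have e2 : HasDerivAt (fun s : ℝ => (NormedSpace.exp (s • A) *ᵥ x) i)
        (((NormedSpace.exp (s • A) * A) *ᵥ x) i) s := by
      simp only [Matrix.mulVec, dotProduct]
      exact HasDerivAt.fun_sum fun l _ => (hasDerivAt_matrix_exp_apply A i l s).mul_const _
    convert! (e1 s).mul e2 using 1
    have h1 : A *ᵥ x = ρ • x + (Pi.single j 1 - v j • u) := by
      rw [← hx, Matrix.sub_mulVec, Matrix.smul_mulVec, Matrix.one_mulVec]; abel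
    rw [← Matrix.mulVec_mulVec, h1, Matrix.mulVec_add, Matrix.mulVec_sub, Matrix.mulVec_smul,
      Matrix.mulVec_smul, matrix_exp_mulVec hu, Matrix.mulVec_single_one]
    simp only [Pi.add_apply, Pi.sub_apply, Pi.smul_apply, smul_eq_mul, Matrix.col_apply]
    have : Real.exp (-(ρ * s)) * Real.exp (ρ * s) = 1 := by rw [← Real.exp_add]; simp
    linear_combination (u i * v j) * this
  have hFb : ∀ y, 0 ≤ y → |F y| ≤ ∑ l, v l / v i * |x l| := by
    intro y hy
    simp only [F, Matrix.mulVec, dotProduct, Finset.mul_sum]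
    refine (Finset.abs_sum_le_sum_abs _ _).trans (Finset.sum_le_sum fun l _ => ?_)
    rw [abs_mul, abs_mul, abs_of_nonneg (Real.exp_pos _).le,
      abs_of_nonneg (matrix_exp_nonneg hA0 hy i l), ← mul_assoc]
    gcongr
    calc _ ≤ Real.exp (-(ρ * y)) * (v l / v i * Real.exp (ρ * y)) := by
          gcongr; exact exists_matrix_exp_apply_le hA0 hv0 hv i l hy
      _ = v l / v i * (Real.exp (-(ρ * y)) * Real.exp (ρ * y)) := by ring
      _ = v l / v i := by rw [← Real.exp_add]; simp
  have hcont : Continuous fun y : ℝ => Real.exp (-(ρ * y)) * NormedSpace.exp (y • A) i j := by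
    have := continuous_matrix_exp_apply A i j
    fun_prop
  have hlim : Tendsto (fun t : ℝ => u i * v j + t⁻¹ * (F t - F 0)) atTop (𝓝 (u i * v j + 0)) := by
    refine tendsto_const_nhds.add ?_
    have hb : Tendsto (fun t : ℝ => t⁻¹ * (2 * ∑ l, v l / v i * |x l|)) atTop (𝓝 0) := by
      simpa using tendsto_inv_atTop_zero.mul_const (2 * ∑ l, v l / v i * |x l|)
    refine squeeze_zero_norm' ?_ hb
    filter_upwards [eventually_ge_atTop 0] with t ht
    rw [norm_mul, Real.norm_of_nonneg (inv_nonneg.2 ht), Real.norm_eq_abs]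
    gcongr
    have := abs_sub (F t) (F 0)
    linarith [hFb t ht, hFb 0 le_rfl]
  rw [add_zero] at hlim
  refine hlim.congr' ?_
  filter_upwards [eventually_gt_atTop 0] with t ht
  have h2 := intervalIntegral.integral_eq_sub_of_hasDerivAt (fun s _ => hF s)
    ((hcont.sub continuous_const).intervalIntegrable 0 t)
  rw [intervalIntegral.integral_sub (hcont.intervalIntegrable 0 t) (by simp)] at h2
  rw [← h2]
  simp only [intervalIntegral.integral_const, sub_zero, smul_eq_mul]
  field_simp
  ring

end PerronFrobenius

/-! ### Nonhomogeneous Poisson processes -/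

section Counting

/-- The default values agree: an infinite set has `ncard` 0, and the sum is then ∞, with `toReal` 0.
-/
theorem natCast_ncard_eq_toReal_tsum {α : Type*} (s : Set α) :
    (s.ncard : ℝ) = (∑' a, s.indicator (fun _ => (1 : ℝ≥0∞)) a).toReal := by
  rw [← tsum_subtype s (fun _ => (1 : ℝ≥0∞)), ENNReal.tsum_set_one, Set.ncard]
  cases s.encard <;> simp

theorem measurable_ncard_of_measurableSet {Ω α : Type*} [MeasurableSpace Ω] [Countable α]
    {s : Ω → Set α} (hs : ∀ a, MeasurableSet {ω | a ∈ s ω}) : Measurable fun ω => (s ω).ncard :=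
  measurable_ncard.comp (measurable_set_iff.2 fun a => measurableSet_setOfPred.1 (hs a))

theorem measurable_arrivalCount (t : ℝ) : Measurable fun τ : ℕ → ℝ => arrivalCount τ t :=
  measurable_ncard_of_measurableSet fun n => measurableSet_le (measurable_pi_apply n) measurable_const

/-- A nondecreasing divergent sequence meets a half-line in a finite initial segment of indices.
Numbering starts at 0, hence the strict inequality. -/
theorem lt_arrivalCount_iff {τ : ℕ → ℝ} (hm : Monotone τ) (ht : Tendsto τ atTop atTop) {t : ℝ}
    {n : ℕ} : n < arrivalCount τ t ↔ τ n ≤ t := by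
  classical
  have hex : ∃ n, t < τ n := (ht.eventually_gt_atTop t).exists
  have hs : {n : ℕ | τ n ≤ t} = Set.Iio (Nat.find hex) := by
    ext m
    simp only [Set.mem_ofPred_eq, Set.mem_Iio]
    constructor
    · intro h
      by_contra hlt
      exact absurd (Nat.find_spec hex) (not_lt.2 ((hm (not_lt.1 hlt)).trans h))
    · intro h
      exact not_lt.1 (Nat.find_min hex h)
  have : arrivalCount τ t = Nat.find hex := by
    rw [arrivalCount, hs, ← Finset.coe_Iio, Set.ncard_coe_finset, Nat.card_Iio]
  rw [this]
  exact ((Set.ext_iff.1 hs) n).symm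

theorem arrivalCount_mono {τ : ℕ → ℝ} (hm : Monotone τ) (ht : Tendsto τ atTop atTop) :
    Monotone (arrivalCount τ) := by
  intro s t hst
  by_contra! h
  have := (lt_arrivalCount_iff hm ht).1 h
  exact absurd ((lt_arrivalCount_iff hm ht).2 (this.trans hst)) (lt_irrefl _)

theorem arrivalCount_zero {τ : ℕ → ℝ} (hm : Monotone τ) (ht : Tendsto τ atTop atTop)
    (hpos : ∀ n, 0 < τ n) : arrivalCount τ 0 = 0 := by
  by_contra! h
  exact absurd ((lt_arrivalCount_iff hm ht).1 (Nat.pos_of_ne_zero h)) (not_le.2 (hpos 0))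

/-- The cells are left-open, so the arrivals in cell `i` are exactly those whose indices lie between
the counts at `s i` and `s (i + 1)`, and each contributes the factor `c i`. -/
theorem prod_range_arrivalCount_eq {τ : ℕ → ℝ} (hm : Monotone τ) (ht : Tendsto τ atTop atTop)
    (hpos : ∀ n, 0 < τ n) {s : ℕ → ℝ} (hs : Monotone s) (hs0 : s 0 = 0) {G : ℝ → ℂ} {c : ℕ → ℂ}
    (hG : ∀ i, ∀ x ∈ Set.Ioc (s i) (s (i + 1)), G x = c i) (m : ℕ) :
    ∏ n ∈ Finset.range (arrivalCount τ (s m)), G (τ n) =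
      ∏ i ∈ Finset.range m, c i ^ (arrivalCount τ (s (i + 1)) - arrivalCount τ (s i)) := by
  induction m with
  | zero => simp [hs0, arrivalCount_zero hm ht hpos]
  | succ m ih =>
    obtain ⟨d, hd⟩ := Nat.exists_eq_add_of_le (arrivalCount_mono hm ht (hs m.le_succ))
    rw [Finset.prod_range_succ, ← ih, hd, Nat.add_sub_cancel_left, Finset.prod_range_add]
    congr 1
    rw [Finset.prod_congr rfl (g := fun _ => c m), Finset.prod_const, Finset.card_range]
    intro x hx
    rw [Finset.mem_range] at hx
    refine hG m _ ⟨?_, ?_⟩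
    · by_contra! h
      have := (lt_arrivalCount_iff hm ht).2 h
      omega
    · rw [← lt_arrivalCount_iff hm ht, hd]
      omega

theorem norm_prod_sub_prod_le_sum {ι : Type*} (s : Finset ι) {f g : ι → ℂ} (hf : ∀ i ∈ s, ‖f i‖ ≤ 1)
    (hg : ∀ i ∈ s, ‖g i‖ ≤ 1) : ‖∏ i ∈ s, f i - ∏ i ∈ s, g i‖ ≤ ∑ i ∈ s, ‖f i - g i‖ := by
  classical
  induction s using Finset.induction_on with
  | empty => simp
  | insert a s ha ih =>
    rw [Finset.prod_insert ha, Finset.prod_insert ha, Finset.sum_insert ha]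
    have h1 := ih (fun i hi => hf i (Finset.mem_insert_of_mem hi))
      (fun i hi => hg i (Finset.mem_insert_of_mem hi))
    have h2 : ‖∏ i ∈ s, f i‖ ≤ 1 := by
      rw [norm_prod]
      exact Finset.prod_le_one (fun _ _ => norm_nonneg _)
        fun i hi => hf i (Finset.mem_insert_of_mem hi)
    have h3 := hg a (Finset.mem_insert_self a s)
    calc ‖f a * ∏ i ∈ s, f i - g a * ∏ i ∈ s, g i‖
        = ‖(f a - g a) * ∏ i ∈ s, f i + g a * (∏ i ∈ s, f i - ∏ i ∈ s, g i)‖ := by congr 1; ring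
      _ ≤ ‖f a - g a‖ * ‖∏ i ∈ s, f i‖ + ‖g a‖ * ‖∏ i ∈ s, f i - ∏ i ∈ s, g i‖ := by
          refine (norm_add_le _ _).trans ?_
          rw [norm_mul, norm_mul]
      _ ≤ ‖f a - g a‖ * 1 + 1 * ∑ i ∈ s, ‖f i - g i‖ := by gcongr
      _ = _ := by ring

end Counting

/-! ### The Poisson distribution and the intensity measure -/

section Poisson

theorem integral_pow_poissonMeasure (r : ℝ≥0) (z : ℂ) :
    ∫ n, z ^ n ∂(poissonMeasure r) = Complex.exp (r * (z - 1)) := by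
  rw [integral_poissonMeasure]
  have h : ∀ n : ℕ, (Real.exp (-r) * r ^ n / (n.factorial : ℝ)) • z ^ n =
      Complex.exp (-r) * (((r : ℂ) * z) ^ n / n.factorial) := by
    intro n
    rw [Complex.real_smul, mul_pow]
    push_cast
    ring
  simp_rw [h]
  rw [tsum_mul_left, (NormedSpace.expSeries_div_hasSum_exp ((r : ℂ) * z)).tsum_eq,
    ← Complex.exp_eq_exp_ℂ, ← Complex.exp_add]
  congr 1
  ring

theorem lintegral_natCast_poissonMeasure (r : ℝ≥0) :
    ∫⁻ n, (n : ℝ≥0∞) ∂(poissonMeasure r) = r := by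
  rw [poissonMeasure, lintegral_sum_measure]
  simp only [lintegral_smul_measure, lintegral_dirac, smul_eq_mul]
  rw [tsum_eq_zero_add' ENNReal.summable]
  have h : ∀ n : ℕ, ENNReal.ofReal (Real.exp (-r) * r ^ (n + 1) / ((n + 1).factorial : ℝ)) *
      ((n + 1 : ℕ) : ℝ≥0∞) = ENNReal.ofReal (Real.exp (-r) * r ^ n / (n.factorial : ℝ)) * r := by
    intro n
    rw [← ENNReal.ofReal_natCast, ← ENNReal.ofReal_mul (by positivity),
      ← ENNReal.ofReal_coe_nnreal, ← ENNReal.ofReal_mul (by positivity)]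
    congr 1
    rw [Nat.factorial_succ]
    push_cast
    field_simp
    ring
  simp_rw [h]
  rw [ENNReal.tsum_mul_right, ← ENNReal.ofReal_tsum_of_nonneg (fun n => by positivity)
    (hasSum_one_poissonMeasure r).summable, (hasSum_one_poissonMeasure r).tsum_eq]
  simp

/-- The intensity measure on `(0, t]`. -/
noncomputable def intensityMeasure (lam : ℝ → ℝ) (t : ℝ) : Measure ℝ :=
  (volume.restrict (Set.Ioc 0 t)).withDensity fun x => ENNReal.ofReal (lam x)

variable {lam : ℝ → ℝ}

theorem integrableOn_Ioc_of_locallyIntegrableOn_Ici (hint : LocallyIntegrableOn lam (Set.Ici 0))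
    (t : ℝ) : IntegrableOn lam (Set.Ioc 0 t) :=
  (hint.integrableOn_compact_subset (Set.Icc_subset_Ici_self) isCompact_Icc).mono_set
    Set.Ioc_subset_Icc_self

theorem intervalIntegrable_of_locallyIntegrableOn_Ici (hint : LocallyIntegrableOn lam (Set.Ici 0))
    {s t : ℝ} (hs : 0 ≤ s) (hst : s ≤ t) : IntervalIntegrable lam volume s t := by
  rw [intervalIntegrable_iff_integrableOn_Ioc_of_le hst]
  exact (integrableOn_Ioc_of_locallyIntegrableOn_Ici hint t).mono_set
    (Set.Ioc_subset_Ioc_left hs)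

theorem integral_intensityMeasure (hpos : ∀ t, 0 ≤ t → 0 < lam t)
    (hint : LocallyIntegrableOn lam (Set.Ici 0)) {t : ℝ} (ht : 0 ≤ t) (f : ℝ → ℂ) :
    ∫ x, f x ∂(intensityMeasure lam t) = ∫ x in (0 : ℝ)..t, (lam x : ℂ) * f x := by
  rw [intensityMeasure, integral_withDensity_eq_integral_toReal_smul₀
    (integrableOn_Ioc_of_locallyIntegrableOn_Ici hint t).aestronglyMeasurable.aemeasurable.ennreal_ofReal
    (by simp), intervalIntegral.integral_of_le ht]
  refine setIntegral_congr_fun measurableSet_Ioc fun x hx => ?_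
  simp only [ENNReal.toReal_ofReal (hpos x hx.1.le).le, Complex.real_smul]

theorem intensityMeasure_Iic (hpos : ∀ t, 0 ≤ t → 0 < lam t)
    (hint : LocallyIntegrableOn lam (Set.Ici 0)) {t a : ℝ} (h0 : 0 ≤ min a t) :
    intensityMeasure lam t (Set.Iic a) = ENNReal.ofReal (∫ x in (0 : ℝ)..(min a t), lam x) := by
  rw [intensityMeasure, withDensity_apply _ measurableSet_Iic, Measure.restrict_restrict
    measurableSet_Iic, intervalIntegral.integral_of_le h0]
  have : Set.Iic a ∩ Set.Ioc 0 t = Set.Ioc 0 (min a t) := by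
    ext x; simp only [Set.mem_inter_iff, Set.mem_Iic, Set.mem_Ioc, le_min_iff]; tauto
  rw [this, ofReal_integral_eq_lintegral_ofReal
    (integrableOn_Ioc_of_locallyIntegrableOn_Ici hint _)]
  exact (ae_restrict_iff' measurableSet_Ioc).2 (Eventually.of_forall fun x hx => (hpos x hx.1.le).le)

theorem isFiniteMeasure_intensityMeasure (hint : LocallyIntegrableOn lam (Set.Ici 0)) (t : ℝ) :
    IsFiniteMeasure (intensityMeasure lam t) :=
  isFiniteMeasure_withDensity_ofReal
    (integrableOn_Ioc_of_locallyIntegrableOn_Ici hint t).2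

end Poisson

/-! ### Generating functional and Campbell formula of the arrival process -/

namespace IsNHPP

variable {Ω : Type*} [MeasurableSpace Ω] {P : Measure Ω} {lam : ℝ → ℝ} {T : ℕ → Ω → ℝ}

theorem measurable_arrivalCount_comp (h : IsNHPP P lam T) (t : ℝ) :
    Measurable fun ω => arrivalCount (fun n => T n ω) t :=
  (measurable_arrivalCount t).comp (measurable_pi_lambda _ h.measurable)

/-- For a step function the product splits over the cells. Increments are independent, and each
factor is a Poisson probability generating function evaluated at `c i`. -/
theorem integral_prod_of_step [IsProbabilityMeasure P] (h : IsNHPP P lam T)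
    (hpos : ∀ t, 0 ≤ t → 0 < lam t)
    (hint : LocallyIntegrableOn lam (Set.Ici 0)) {s : ℕ → ℝ} (hs : Monotone s) (hs0 : s 0 = 0)
    {G : ℝ → ℂ} {c : ℕ → ℂ} (hG : ∀ i, ∀ x ∈ Set.Ioc (s i) (s (i + 1)), G x = c i) (m : ℕ) :
    ∫ ω, ∏ n ∈ Finset.range (arrivalCount (fun n => T n ω) (s m)), G (T n ω) ∂P =
      Complex.exp (∫ x, (G x - 1) ∂(intensityMeasure lam (s m))) := by
  have hsn : ∀ i, 0 ≤ s i := fun i => hs0 ▸ hs (Nat.zero_le i)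
  have h1 : (fun ω => ∏ n ∈ Finset.range (arrivalCount (fun n => T n ω) (s m)), G (T n ω)) =ᵐ[P]
      fun ω => ∏ i : Fin m, c i ^ (arrivalCount (fun n => T n ω) (s (i + 1)) -
        arrivalCount (fun n => T n ω) (s i)) := by
    filter_upwards [h.pos, h.monotone, h.tendsto] with ω h1 h2 h3
    rw [prod_range_arrivalCount_eq h2 h3 h1 hs hs0 hG m, Finset.prod_range]
  have hI := h.indep_increments m (fun i => ⟨s i, hsn i⟩) (fun i j hij => hs hij)
  have hmeas : ∀ i : Fin m, Measurable fun ω => arrivalCount (fun n => T n ω) (s (i + 1)) -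
        arrivalCount (fun n => T n ω) (s i) := fun i =>
    (h.measurable_arrivalCount_comp _).sub (h.measurable_arrivalCount_comp _)
  rw [integral_congr_ae h1]
  have h2 := hI.integral_fun_prod_comp (f := fun (i : Fin m) (n : ℕ) => c i ^ n)
    (fun i => (hmeas i).aemeasurable) (fun i => (Measurable.of_discrete).aestronglyMeasurable)
  refine (Eq.trans ?_ h2).trans ?_
  · rfl
  have hstep : ∀ i : ℕ, ∫ x in s i..s (i + 1), (lam x : ℂ) * (G x - 1) =
      ((∫ x in s i..s (i + 1), lam x : ℝ) : ℂ) * (c i - 1) := by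
    intro i
    rw [intervalIntegral.integral_of_le (hs i.le_succ), intervalIntegral.integral_of_le
      (hs i.le_succ), ← integral_complex_ofReal, ← integral_mul_const]
    exact setIntegral_congr_fun measurableSet_Ioc fun x hx => by simp only [hG i x hx]
  have hii : ∀ i < m, IntervalIntegrable (fun x => (lam x : ℂ) * (G x - 1)) volume (s i)
      (s (i + 1)) := by
    intro i _
    rw [intervalIntegrable_iff_integrableOn_Ioc_of_le (hs i.le_succ)]
    have h3 : IntegrableOn (fun x => (lam x : ℂ) * (c i - 1)) (Set.Ioc (s i) (s (i + 1))) :=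
      (((intervalIntegrable_of_locallyIntegrableOn_Ici hint (hsn i) (hs i.le_succ)).1).ofReal).mul_const _
    exact h3.congr_fun (fun x hx => by simp only [hG i x hx]) measurableSet_Ioc
  have hsum := intervalIntegral.sum_integral_adjacent_intervals hii
  rw [hs0] at hsum
  rw [integral_intensityMeasure hpos hint (hsn m), ← hsum, Complex.exp_sum, Finset.prod_range]
  refine Finset.prod_congr rfl fun i _ => ?_
  have hl := h.law_increments (s i) (s (i + 1)) (hsn i) (hs (Nat.le_succ i))
  have h4 := hl.integral_comp (f := fun n : ℕ => c i ^ n)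
    (Measurable.of_discrete).aestronglyMeasurable
  refine (Eq.trans ?_ h4).trans ?_
  · rfl
  rw [integral_pow_poissonMeasure, hstep, Real.coe_toNNReal]
  exact intervalIntegral.integral_nonneg (hs (Nat.le_succ i))
    fun x hx => (hpos x ((hsn i).trans hx.1)).le

theorem _root_.norm_prod_le_one {G : ℝ → ℂ} (hG : ∀ x, ‖G x‖ ≤ 1) (s : Finset ℕ) (τ : ℕ → ℝ) :
    ‖∏ n ∈ s, G (τ n)‖ ≤ 1 := by
  rw [norm_prod]
  exact Finset.prod_le_one (fun _ _ => norm_nonneg _) fun i _ => hG _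

theorem _root_.measurable_prod_range {Ω : Type*} [MeasurableSpace Ω] {N : Ω → ℕ} (hN : Measurable N)
    {f : ℕ → Ω → ℂ} (hf : ∀ n, Measurable (f n)) :
    Measurable fun ω => ∏ n ∈ Finset.range (N ω), f n ω := by
  have : (fun ω => ∏ n ∈ Finset.range (N ω), f n ω) =
      (fun q : Ω × ℕ => ∏ n ∈ Finset.range q.2, f n q.1) ∘ fun ω => (ω, N ω) := rfl
  rw [this]
  refine Measurable.comp ?_ (measurable_id.prodMk hN)
  exact measurable_from_prod_countable_left fun n =>
    Finset.measurable_fun_prod (Finset.range n) fun i _ => hf i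

theorem integral_prod_of_continuous [IsProbabilityMeasure P] (h : IsNHPP P lam T)
    (hpos : ∀ t, 0 ≤ t → 0 < lam t)
    (hint : LocallyIntegrableOn lam (Set.Ici 0)) {G : ℝ → ℂ} (hGc : Continuous G)
    (hG : ∀ x, ‖G x‖ ≤ 1) {t : ℝ} (ht : 0 < t) :
    ∫ ω, ∏ n ∈ Finset.range (arrivalCount (fun n => T n ω) t), G (T n ω) ∂P =
      Complex.exp (∫ x, (G x - 1) ∂(intensityMeasure lam t)) := by
  have := isFiniteMeasure_intensityMeasure hint t
  -- With mesh t/(m+1), "ceiling minus one" sends `x` to the left endpoint of its left-open cell.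
  -- Thus `G ∘ a m` is a step function, and it converges pointwise to `G`.
  let a : ℕ → ℝ → ℝ := fun m x => t * ((⌈((m : ℝ) + 1) * x / t⌉ : ℝ) - 1) / ((m : ℝ) + 1)
  have ha : ∀ x, Tendsto (fun m => a m x) atTop (𝓝 x) := by
    intro x
    have h0 : Tendsto (fun m : ℕ => t * (1 / ((m : ℝ) + 1))) atTop (𝓝 0) := by
      simpa using (tendsto_one_div_add_atTop_nhds_zero_nat (𝕜 := ℝ)).const_mul t
    rw [tendsto_iff_norm_sub_tendsto_zero]
    refine squeeze_zero (fun _ => norm_nonneg _) (fun m => ?_) h0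
    have hm : (0 : ℝ) < (m : ℝ) + 1 := by positivity
    have h1 := Int.le_ceil (((m : ℝ) + 1) * x / t)
    have h2 := Int.ceil_lt_add_one (((m : ℝ) + 1) * x / t)
    set C : ℝ := (⌈((m : ℝ) + 1) * x / t⌉ : ℝ) with hC
    have h3 : a m x - x = t * (1 / ((m : ℝ) + 1)) * (C - 1 - ((m : ℝ) + 1) * x / t) := by
      simp only [a]; rw [← hC]; field_simp
    rw [h3, norm_mul, Real.norm_of_nonneg (by positivity)]
    refine mul_le_of_le_one_right (by positivity) ?_
    rw [Real.norm_eq_abs, abs_le]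
    constructor <;> linarith
  have ham : ∀ m, Measurable (a m) := fun m => by
    have : Measurable fun x : ℝ => ⌈((m : ℝ) + 1) * x / t⌉ := Int.measurable_ceil.comp (by fun_prop)
    have h2 : Measurable fun x : ℝ => ((⌈((m : ℝ) + 1) * x / t⌉ : ℤ) : ℝ) :=
      (Measurable.of_discrete (f := fun z : ℤ => (z : ℝ))).comp this
    simp only [a]
    fun_prop
  have hstep : ∀ m : ℕ,
      ∫ ω, ∏ n ∈ Finset.range (arrivalCount (fun n => T n ω) t), G (a m (T n ω)) ∂P =
      Complex.exp (∫ x, (G (a m x) - 1) ∂(intensityMeasure lam t)) := by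
    intro m
    have hm : (0 : ℝ) < (m : ℝ) + 1 := by positivity
    have := h.integral_prod_of_step hpos hint (s := fun i : ℕ => t * i / ((m : ℝ) + 1))
      (G := fun x => G (a m x)) (c := fun i => G (t * i / ((m : ℝ) + 1)))
      (fun i j hij => by dsimp only; gcongr) (by simp) (fun i x hx => by
        have hceil : ⌈((m : ℝ) + 1) * x / t⌉ = (i : ℤ) + 1 := by
          rw [Int.ceil_eq_iff]
          have h1 := hx.1
          have h2 := hx.2
          rw [div_lt_iff₀ hm] at h1
          rw [le_div_iff₀ hm] at h2
          rw [lt_div_iff₀ ht, div_le_iff₀ ht]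
          push_cast at h2 ⊢
          constructor <;> linarith
        simp only [a, hceil]
        push_cast
        congr 1
        ring) (m + 1)
    have h1 : t * ((m + 1 : ℕ) : ℝ) / ((m : ℝ) + 1) = t := by push_cast; field_simp
    rw [h1] at this
    exact this
  have hGa : ∀ x, Tendsto (fun m => G (a m x)) atTop (𝓝 (G x)) := fun x =>
    (hGc.tendsto x).comp (ha x)
  have hL : Tendsto (fun m : ℕ =>
      ∫ ω, ∏ n ∈ Finset.range (arrivalCount (fun n => T n ω) t), G (a m (T n ω)) ∂P) atTop
      (𝓝 (∫ ω, ∏ n ∈ Finset.range (arrivalCount (fun n => T n ω) t), G (T n ω) ∂P)) := by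
    refine tendsto_integral_of_dominated_convergence (fun _ => 1) (fun m => ?_)
      (integrable_const _) (fun m => ?_) ?_
    · exact (measurable_prod_range (h.measurable_arrivalCount_comp t) fun n =>
        hGc.measurable.comp ((ham m).comp (h.measurable n))).aestronglyMeasurable
    · exact Eventually.of_forall fun ω => norm_prod_le_one (fun x => hG (a m x)) _ _
    · exact Eventually.of_forall fun ω => tendsto_finsetProd _ fun n _ => hGa _
  have hR : Tendsto (fun m : ℕ => Complex.exp (∫ x, (G (a m x) - 1) ∂(intensityMeasure lam t)))
      atTop (𝓝 (Complex.exp (∫ x, (G x - 1) ∂(intensityMeasure lam t)))) := by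
    refine (Complex.continuous_exp.tendsto _).comp ?_
    refine tendsto_integral_of_dominated_convergence (fun _ => 2) (fun m => ?_)
      (integrable_const _) (fun m => ?_) ?_
    · exact ((hGc.measurable.comp (ham m)).sub_const 1).aestronglyMeasurable
    · refine Eventually.of_forall fun x => (norm_sub_le _ _).trans ?_
      rw [norm_one]; linarith [hG (a m x)]
    · exact Eventually.of_forall fun x => (hGa x).sub_const 1
  simp_rw [hstep] at hL
  exact tendsto_nhds_unique hL hR

/-- Campbell's formula. It amounts to saying that the intensity on (0, t] is the sum of the
restricted laws of the arrival times. On a half-line both sides are the expected number of arrivals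
up to `min a t`, which determines the finite measure. -/
theorem lintegral_sum_arrivals (h : IsNHPP P lam T)
    (hpos : ∀ t, 0 ≤ t → 0 < lam t) (hint : LocallyIntegrableOn lam (Set.Ici 0)) {t : ℝ}
    (ht : 0 ≤ t) {f : ℝ → ℝ≥0∞} (hf : Measurable f) :
    ∫⁻ ω, ∑ n ∈ Finset.range (arrivalCount (fun n => T n ω) t), f (T n ω) ∂P =
      ∫⁻ x, f x ∂(intensityMeasure lam t) := by
  have hμ : intensityMeasure lam t = Measure.sum fun n => (P.map (T n)).restrict (Set.Ioc 0 t) := by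
    have := isFiniteMeasure_intensityMeasure hint t
    refine Measure.ext_of_Iic _ _ fun a => ?_
    rw [Measure.sum_apply _ measurableSet_Iic]
    have h1 : ∀ n, (P.map (T n)).restrict (Set.Ioc 0 t) (Set.Iic a) =
        ∫⁻ ω, (T n ⁻¹' Set.Ioc 0 (min a t)).indicator (fun _ => 1) ω ∂P := by
      intro n
      rw [Measure.restrict_apply measurableSet_Iic, Measure.map_apply (h.measurable n)
        (measurableSet_Iic.inter measurableSet_Ioc)]
      have : Set.Iic a ∩ Set.Ioc 0 t = Set.Ioc 0 (min a t) := by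
        ext x; simp only [Set.mem_inter_iff, Set.mem_Iic, Set.mem_Ioc, le_min_iff]; tauto
      rw [this, lintegral_indicator_const (h.measurable n measurableSet_Ioc), one_mul]
    simp_rw [h1]
    rw [← lintegral_tsum fun n =>
      (measurable_const.indicator (h.measurable n measurableSet_Ioc)).aemeasurable]
    rcases lt_or_ge (min a t) 0 with hneg | h0
    · have : ∀ n, T n ⁻¹' Set.Ioc 0 (min a t) = ∅ := fun n => by
        ext ω
        simp only [Set.mem_preimage, Set.mem_Ioc, Set.mem_empty_iff_false, iff_false]
        intro h2
        linarith [h2.1, h2.2]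
      simp_rw [this]
      have ha : a < 0 := by
        rcases min_lt_iff.1 hneg with h2 | h2
        · exact h2
        · linarith
      rw [intensityMeasure, withDensity_apply _ measurableSet_Iic, Measure.restrict_restrict
        measurableSet_Iic]
      have : Set.Iic a ∩ Set.Ioc 0 t = ∅ := by
        ext x
        simp only [Set.mem_inter_iff, Set.mem_Iic, Set.mem_Ioc, Set.mem_empty_iff_false, iff_false]
        intro h2
        linarith [h2.1, h2.2.1]
      simp [this]
    · rw [intensityMeasure_Iic hpos hint h0]
      have hl := h.law_increments 0 (min a t) le_rfl h0
      have h2 := hl.lintegral_comp (f := fun n : ℕ => (n : ℝ≥0∞)) Measurable.of_discrete.aemeasurable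
      rw [lintegral_natCast_poissonMeasure] at h2
      refine Eq.trans ?_ (h2.symm.trans ?_)
      · rfl
      refine lintegral_congr_ae ?_
      filter_upwards [h.pos, h.monotone, h.tendsto] with ω g1 g2 g3
      simp only [arrivalCount_zero g2 g3 g1, Nat.sub_zero]
      have h4 : ∀ n, (T n ⁻¹' Set.Ioc 0 (min a t)).indicator (fun _ => (1 : ℝ≥0∞)) ω =
          if n ∈ Finset.range (arrivalCount (fun n => T n ω) (min a t)) then 1 else 0 := by
        intro n
        have hiff : ω ∈ T n ⁻¹' Set.Ioc 0 (min a t) ↔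
            n ∈ Finset.range (arrivalCount (fun n => T n ω) (min a t)) := by
          simp only [Set.mem_preimage, Set.mem_Ioc, g1 n, true_and, Finset.mem_range,
            lt_arrivalCount_iff g2 g3]
        by_cases hn : n ∈ Finset.range (arrivalCount (fun n => T n ω) (min a t))
        · rw [if_pos hn, Set.indicator_of_mem (hiff.2 hn)]
        · rw [if_neg hn, Set.indicator_of_notMem fun hc => hn (hiff.1 hc)]
      simp_rw [h4]
      rw [tsum_eq_sum (s := Finset.range (arrivalCount (fun n => T n ω) (min a t)))
        (fun b hb => by simp only [hb, if_false])]
      rw [Finset.sum_ite_mem, Finset.inter_self]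
      simp
  rw [hμ, lintegral_sum_measure]
  have h1 : ∀ n, ∫⁻ x, f x ∂((P.map (T n)).restrict (Set.Ioc 0 t)) =
      ∫⁻ ω, (T n ⁻¹' Set.Ioc 0 t).indicator (fun ω => f (T n ω)) ω ∂P := by
    intro n
    rw [← lintegral_indicator measurableSet_Ioc, lintegral_map (hf.indicator measurableSet_Ioc)
      (h.measurable n)]
    rfl
  simp_rw [h1]
  rw [← lintegral_tsum (f := fun n ω => (T n ⁻¹' Set.Ioc 0 t).indicator (fun ω => f (T n ω)) ω)
    fun n => ((hf.comp (h.measurable n)).indicator (h.measurable n measurableSet_Ioc)).aemeasurable]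
  refine lintegral_congr_ae ?_
  filter_upwards [h.pos, h.monotone, h.tendsto] with ω g1 g2 g3
  have h4 : ∀ n, (T n ⁻¹' Set.Ioc 0 t).indicator (fun ω => f (T n ω)) ω =
      if n ∈ Finset.range (arrivalCount (fun n => T n ω) t) then f (T n ω) else 0 := by
    intro n
    have hiff : ω ∈ T n ⁻¹' Set.Ioc 0 t ↔
        n ∈ Finset.range (arrivalCount (fun n => T n ω) t) := by
      simp only [Set.mem_preimage, Set.mem_Ioc, g1 n, true_and, Finset.mem_range,
        lt_arrivalCount_iff g2 g3]
    by_cases hn : n ∈ Finset.range (arrivalCount (fun n => T n ω) t)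
    · rw [if_pos hn, Set.indicator_of_mem (hiff.2 hn)]
    · rw [if_neg hn, Set.indicator_of_notMem fun hc => hn (hiff.1 hc)]
  simp_rw [h4]
  rw [tsum_eq_sum (s := Finset.range (arrivalCount (fun n => T n ω) t))
    (fun b hb => by simp only [hb, if_false])]
  rw [Finset.sum_ite_mem, Finset.inter_self]

end IsNHPP

/-- Take a bounded continuous L¹-approximation `F` and retract it radially to the unit disc. Since
‖G‖ ≤ 1, the retraction moves `F x` by at most ‖G x - F x‖, so the error at most doubles; hence ε/2.
-/
theorem exists_continuous_norm_le_one_integral_sub_le {μ : Measure ℝ} [IsFiniteMeasure μ]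
    {G : ℝ → ℂ} (hGm : Measurable G) (hG : ∀ x, ‖G x‖ ≤ 1) {ε : ℝ} (hε : 0 < ε) :
    ∃ H : ℝ → ℂ, Continuous H ∧ (∀ x, ‖H x‖ ≤ 1) ∧ ∫ x, ‖G x - H x‖ ∂μ ≤ ε := by
  have hGi : Integrable G μ := Integrable.of_bound hGm.aestronglyMeasurable 1
    (Eventually.of_forall hG)
  obtain ⟨F, hF, hFi⟩ := hGi.exists_boundedContinuous_integral_sub_le (half_pos hε)
  have hpos : ∀ x, 0 < max 1 ‖F x‖ := fun x => lt_max_of_lt_left one_pos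
  refine ⟨fun x => ((max 1 ‖F x‖ : ℝ)⁻¹ : ℂ) * F x, ?_, fun x => ?_, ?_⟩
  · have h1 : Continuous fun x => (max 1 ‖F x‖ : ℝ)⁻¹ :=
      (continuous_const.max F.continuous.norm).inv₀ fun x => (hpos x).ne'
    have h2 : Continuous fun x => (((max 1 ‖F x‖ : ℝ)⁻¹ : ℝ) : ℂ) :=
      Complex.continuous_ofReal.comp h1
    convert! h2.mul F.continuous using 1
    ext x
    simp
  · rw [norm_mul, norm_inv, Complex.norm_real, Real.norm_of_nonneg (hpos x).le,
      inv_mul_le_iff₀ (hpos x), mul_one]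
    exact le_max_right _ _
  · have hpt : ∀ x, ‖G x - ((max 1 ‖F x‖ : ℝ)⁻¹ : ℂ) * F x‖ ≤ 2 * ‖G x - F x‖ := by
      intro x
      have h1 : ‖F x - ((max 1 ‖F x‖ : ℝ)⁻¹ : ℂ) * F x‖ ≤ ‖G x - F x‖ := by
        rcases le_total ‖F x‖ 1 with h | h
        · rw [max_eq_left h]; simp
        · rw [max_eq_right h]
          have h0 : (0 : ℝ) < ‖F x‖ := by linarith
          have h2 : F x - ((‖F x‖ : ℂ))⁻¹ * F x = (((1 - ‖F x‖⁻¹ : ℝ)) : ℂ) * F x := by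
            push_cast; ring
          have h3 : ‖F x‖⁻¹ ≤ 1 := inv_le_one_of_one_le₀ h
          rw [h2, norm_mul, Complex.norm_real, Real.norm_of_nonneg (by linarith), sub_mul,
            inv_mul_cancel₀ h0.ne', one_mul]
          have h4 := norm_sub_norm_le (F x) (G x)
          rw [norm_sub_rev] at h4
          linarith [hG x]
      calc _ = ‖(G x - F x) + (F x - ((max 1 ‖F x‖ : ℝ)⁻¹ : ℂ) * F x)‖ := by congr 1; ring
        _ ≤ _ := (norm_add_le _ _).trans (by linarith)
    calc _ ≤ ∫ x, 2 * ‖G x - F x‖ ∂μ :=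
          integral_mono_of_nonneg (Eventually.of_forall fun _ => norm_nonneg _)
            ((hGi.sub hFi).norm.const_mul 2) (Eventually.of_forall hpt)
      _ = 2 * ∫ x, ‖G x - F x‖ ∂μ := integral_const_mul _ _
      _ ≤ ε := by linarith

/-- The generating functional of a nonhomogeneous Poisson process. -/
theorem IsNHPP.integral_prod {Ω : Type*} [MeasurableSpace Ω] {P : Measure Ω} {lam : ℝ → ℝ}
    {T : ℕ → Ω → ℝ} [IsProbabilityMeasure P] (h : IsNHPP P lam T) (hpos : ∀ t, 0 ≤ t → 0 < lam t)
    (hint : LocallyIntegrableOn lam (Set.Ici 0)) {G : ℝ → ℂ} (hGm : Measurable G)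
    (hG : ∀ x, ‖G x‖ ≤ 1) {t : ℝ} (ht : 0 < t) :
    ∫ ω, ∏ n ∈ Finset.range (arrivalCount (fun n => T n ω) t), G (T n ω) ∂P =
      Complex.exp (∫ x, (G x - 1) ∂(intensityMeasure lam t)) := by
  have := isFiniteMeasure_intensityMeasure hint t
  choose H hHc hH hGH using fun m : ℕ =>
    exists_continuous_norm_le_one_integral_sub_le (μ := intensityMeasure lam t) hGm hG
      (ε := 1 / ((m : ℝ) + 1)) (by positivity)
  have hsm := measurable_prod_range (h.measurable_arrivalCount_comp t) (f := fun n ω => G (T n ω))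
    fun n => hGm.comp (h.measurable n)
  have hsmH := fun m => measurable_prod_range (h.measurable_arrivalCount_comp t)
    (f := fun n ω => H m (T n ω)) fun n => (hHc m).measurable.comp (h.measurable n)
  have hb : ∀ F : ℝ → ℂ, Measurable F → (∀ x, ‖F x‖ ≤ 1) → Integrable F (intensityMeasure lam t) :=
    fun F hF hF1 => Integrable.of_bound hF.aestronglyMeasurable 1 (Eventually.of_forall hF1)
  have hbP : ∀ F : ℝ → ℂ, (∀ x, ‖F x‖ ≤ 1) → Measurable (fun ω =>
      ∏ n ∈ Finset.range (arrivalCount (fun n => T n ω) t), F (T n ω)) → Integrable (fun ω =>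
      ∏ n ∈ Finset.range (arrivalCount (fun n => T n ω) t), F (T n ω)) P :=
    fun F hF1 hF => Integrable.of_bound hF.aestronglyMeasurable 1
      (Eventually.of_forall fun ω => norm_prod_le_one hF1 _ _)
  have h0 : Tendsto (fun m : ℕ => 1 / ((m : ℝ) + 1)) atTop (𝓝 0) :=
    tendsto_one_div_add_atTop_nhds_zero_nat
  -- The approximants are close to `G` only in L¹ of the intensity. The telescoping bound for
  -- products and Campbell's formula turn this into closeness of the products in mean.
  have hL : Tendsto (fun m : ℕ =>
      ∫ ω, ∏ n ∈ Finset.range (arrivalCount (fun n => T n ω) t), H m (T n ω) ∂P) atTop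
      (𝓝 (∫ ω, ∏ n ∈ Finset.range (arrivalCount (fun n => T n ω) t), G (T n ω) ∂P)) := by
    rw [tendsto_iff_norm_sub_tendsto_zero]
    refine squeeze_zero (fun _ => norm_nonneg _) (fun m => ?_) h0
    rw [norm_sub_rev, ← integral_sub (hbP G hG hsm) (hbP (H m) (hH m) (hsmH m))]
    have hGHm : Measurable fun x => ‖G x - H m x‖ := (hGm.sub (hHc m).measurable).norm
    have h1 := h.lintegral_sum_arrivals hpos hint ht.le hGHm.ennreal_ofReal
    refine (norm_integral_le_lintegral_norm _).trans ?_
    refine ENNReal.toReal_le_of_le_ofReal (by positivity) ?_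
    refine (lintegral_mono fun ω => ?_).trans (h1.le.trans ?_)
    · rw [← ENNReal.ofReal_sum_of_nonneg fun _ _ => norm_nonneg _]
      exact ENNReal.ofReal_le_ofReal (norm_prod_sub_prod_le_sum _ (fun _ _ => hG _)
        fun _ _ => hH m _)
    · have hsub : Integrable (fun x => ‖G x - H m x‖) (intensityMeasure lam t) :=
        ((hb G hGm hG).sub (hb (H m) (hHc m).measurable (hH m))).norm
      rw [← ofReal_integral_eq_lintegral_ofReal hsub (Eventually.of_forall fun _ => norm_nonneg _)]
      exact ENNReal.ofReal_le_ofReal (hGH m)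
  have hR : Tendsto (fun m : ℕ => Complex.exp (∫ x, (H m x - 1) ∂(intensityMeasure lam t)))
      atTop (𝓝 (Complex.exp (∫ x, (G x - 1) ∂(intensityMeasure lam t)))) := by
    refine (Complex.continuous_exp.tendsto _).comp ?_
    rw [tendsto_iff_norm_sub_tendsto_zero]
    refine squeeze_zero (fun _ => norm_nonneg _) (fun m => ?_) h0
    rw [norm_sub_rev, integral_sub (hb G hGm hG) (integrable_const _),
      integral_sub (hb (H m) (hHc m).measurable (hH m)) (integrable_const _), sub_sub_sub_cancel_right,
      ← integral_sub (hb G hGm hG) (hb (H m) (hHc m).measurable (hH m))]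
    exact (norm_integral_le_integral_norm _).trans (hGH m)
  simp_rw [fun m => h.integral_prod_of_continuous hpos hint (hHc m) (hH m) ht] at hL
  exact tendsto_nhds_unique hL hR

/-! ### The family tree -/

section FamilyTree

variable {k : ℕ}

/-- A family tree: lifetimes and offspring vectors of all potential particles. -/
abbrev FamilyTree (k : ℕ) : Type := ParticleLabel k → ℝ × (Fin k → ℕ)

/-- The law of lifetime and offspring vector of a particle of type `i`. -/
noncomputable def particleLaw (r : Fin k → ℝ) (p : Fin k → PMF (Fin k → ℕ)) (i : Fin k) :
    Measure (ℝ × (Fin k → ℕ)) :=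
  (expMeasure (r i)).prod (p i).toMeasure

/-- The law of the family tree of a particle of type `i`. -/
noncomputable def treeLaw (r : Fin k → ℝ) (p : Fin k → PMF (Fin k → ℕ)) (i : Fin k) :
    Measure (FamilyTree k) :=
  Measure.infinitePi fun w => particleLaw r p (particleType i w)

theorem isProbabilityMeasure_particleLaw {r : Fin k → ℝ} (hr : ∀ i, 0 < r i)
    (p : Fin k → PMF (Fin k → ℕ)) (i : Fin k) : IsProbabilityMeasure (particleLaw r p i) := by
  have := isProbabilityMeasure_expMeasure (hr i)
  unfold particleLaw
  infer_instance

theorem isProbabilityMeasure_treeLaw {r : Fin k → ℝ} (hr : ∀ i, 0 < r i)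
    (p : Fin k → PMF (Fin k → ℕ)) (i : Fin k) : IsProbabilityMeasure (treeLaw r p i) := by
  have := fun i => isProbabilityMeasure_particleLaw hr p i
  unfold treeLaw
  infer_instance

/-- The family tree with a given root and given family trees of the children of the root. -/
def joinTree (q : (ℝ × (Fin k → ℕ)) × (Fin k × ℕ → FamilyTree k)) : FamilyTree k
  | [] => q.1
  | a :: w => q.2 a w

theorem measurable_joinTree : Measurable (joinTree (k := k)) := by
  refine measurable_pi_lambda _ fun w => ?_
  cases w with
  | nil => exact measurable_fst
  | cons a w =>
    exact (measurable_pi_apply w).comp ((measurable_pi_apply a).comp measurable_snd)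

theorem prod_finset_list {α M : Type*} [CommMonoid M] [DecidableEq α] (s : Finset (List α))
    (f : List α → M) (hs : Set.InjOn (fun q : α × List α => q.1 :: q.2)
      ((fun q : α × List α => q.1 :: q.2) ⁻¹' s)) :
    ∏ w ∈ s, f w = (if [] ∈ s then f [] else 1) *
      ∏ q ∈ s.preimage (fun q : α × List α => q.1 :: q.2) hs, f (q.1 :: q.2) := by
  classical
  rw [Finset.prod_preimage' (fun q : α × List α => q.1 :: q.2) s hs f,
    ← Finset.prod_filter_mul_prod_filter_not s (fun w => w = [])]
  congr 1
  · rw [Finset.prod_filter, Finset.prod_ite_eq']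
  · refine Finset.prod_congr ?_ fun _ _ => rfl
    ext w
    cases w <;> simp

/-- The root of a family tree and the family trees of its children are independent. -/
theorem map_joinTree {r : Fin k → ℝ} (hr : ∀ i, 0 < r i) (p : Fin k → PMF (Fin k → ℕ))
    (i : Fin k) :
    ((particleLaw r p i).prod
      (Measure.infinitePi fun a : Fin k × ℕ => treeLaw r p a.1)).map joinTree = treeLaw r p i := by
  have hp := fun i => isProbabilityMeasure_particleLaw hr p i
  have ht := fun i => isProbabilityMeasure_treeLaw hr p i
  refine Measure.eq_infinitePi _ fun s t hmt => ?_
  classical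
  have hinj : Set.InjOn (fun q : (Fin k × ℕ) × ParticleLabel k => q.1 :: q.2)
      ((fun q : (Fin k × ℕ) × ParticleLabel k => q.1 :: q.2) ⁻¹' s) :=
    fun a _ b _ h => by simpa [Prod.ext_iff] using h
  set S : Finset ((Fin k × ℕ) × ParticleLabel k) :=
    s.preimage (fun q : (Fin k × ℕ) × ParticleLabel k => q.1 :: q.2) hinj with hS
  -- A finite cylinder of trees pulls back to a rectangle: a condition on the root, void if the root
  -- is not in `s`, times a cylinder indexed by pairs of a child and a label below it.
  have hpre : joinTree ⁻¹' (Set.pi s t) = (if [] ∈ s then t [] else Set.univ) ×ˢ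
      ((MeasurableEquiv.curry (Fin k × ℕ) (ParticleLabel k) (ℝ × (Fin k → ℕ))).symm ⁻¹'
        (Set.pi S fun q => t (q.1 :: q.2))) := by
    ext q
    simp only [Set.mem_preimage, Set.mem_pi, Finset.mem_coe, Set.mem_prod]
    constructor
    · intro h
      refine ⟨?_, fun b hb => ?_⟩
      · split_ifs with h0
        · exact h [] h0
        · trivial
      · exact h (b.1 :: b.2) (by simpa [hS] using hb)
    · rintro ⟨h1, h2⟩ w hw
      cases w with
      | nil => rw [if_pos hw] at h1; exact h1
      | cons a w => exact h2 (a, w) (by simpa [hS] using hw)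
  rw [Measure.map_apply measurable_joinTree (.pi s.countable_toSet fun _ _ => hmt _), hpre,
    Measure.prod_prod, ← MeasurableEquiv.map_apply]
  have hc : (Measure.infinitePi fun a : Fin k × ℕ => treeLaw r p a.1).map
      (MeasurableEquiv.curry (Fin k × ℕ) (ParticleLabel k) (ℝ × (Fin k → ℕ))).symm =
      Measure.infinitePi fun q : (Fin k × ℕ) × ParticleLabel k =>
        particleLaw r p (particleType q.1.1 q.2) :=
    Measure.infinitePi_map_curry_symm (fun (a : Fin k × ℕ) (w : ParticleLabel k) =>
        particleLaw r p (particleType a.1 w))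
  rw [hc, Measure.infinitePi_pi _ fun q _ => hmt _, prod_finset_list s _ hinj]
  congr 1
  split_ifs
  · rfl
  · simp

theorem lintegral_treeLaw {r : Fin k → ℝ} (hr : ∀ i, 0 < r i) (p : Fin k → PMF (Fin k → ℕ))
    (i : Fin k) {f : FamilyTree k → ℝ≥0∞} (hf : Measurable f) :
    ∫⁻ x, f x ∂(treeLaw r p i) = ∫⁻ l, ∫⁻ y, ∫⁻ X, f (joinTree ((l, y), X))
      ∂(Measure.infinitePi fun a : Fin k × ℕ => treeLaw r p a.1) ∂(p i).toMeasure
      ∂(expMeasure (r i)) := by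
  have hp := fun i => isProbabilityMeasure_particleLaw hr p i
  have ht := fun i => isProbabilityMeasure_treeLaw hr p i
  have := isProbabilityMeasure_expMeasure (hr i)
  have hm : Measurable fun q => f (joinTree q) := hf.comp measurable_joinTree
  rw [← map_joinTree hr p i, lintegral_map hf measurable_joinTree, lintegral_prod _ hm.aemeasurable,
    particleLaw, lintegral_prod _ hm.lintegral_prod_right'.aemeasurable]

/-- Particle `w` is alive at time `t`. -/
def IsAlive (t : ℝ) (x : FamilyTree k) (w : ParticleLabel k) : Prop :=
  IsBorn (fun w => (x w).2) w ∧ birthTime (fun w => (x w).1) w ≤ t ∧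
    t < birthTime (fun w => (x w).1) w + (x w).1

theorem isAlive_nil (t : ℝ) (x : FamilyTree k) : IsAlive t x [] ↔ 0 ≤ t ∧ t < (x []).1 := by
  simp [IsAlive, IsBorn, birthTime]

/-- The branching property: seen from a child of the root, the clock starts when the root dies, at
`l`. -/
theorem isAlive_joinTree_cons (t : ℝ) (l : ℝ) (y : Fin k → ℕ) (X : Fin k × ℕ → FamilyTree k)
    (a : Fin k × ℕ) (w : ParticleLabel k) :
    IsAlive t (joinTree ((l, y), X)) (a :: w) ↔ a.2 < y a.1 ∧ IsAlive (t - l) (X a) w := by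
  simp only [IsAlive, IsBorn, birthTime, joinTree, and_assoc]
  refine and_congr_right fun _ => and_congr_right fun _ => and_congr ?_ ?_ <;>
  constructor <;> intro h <;> linarith

theorem measurable_birthTime (w : ParticleLabel k) :
    Measurable fun l : ParticleLabel k → ℝ => birthTime l w := by
  induction w with
  | nil => exact measurable_const
  | cons a w ih =>
    exact (measurable_pi_apply []).add
      (ih.comp (measurable_pi_lambda _ fun w' => measurable_pi_apply (a :: w')))

theorem measurableSet_isBorn (w : ParticleLabel k) :
    MeasurableSet {y : ParticleLabel k → Fin k → ℕ | IsBorn y w} := by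
  induction w with
  | nil => exact MeasurableSet.univ
  | cons a w ih =>
    have h1 : MeasurableSet {y : ParticleLabel k → Fin k → ℕ | a.2 < y [] a.1} :=
      measurableSet_lt measurable_const ((measurable_pi_apply a.1).comp (measurable_pi_apply []))
    have h2 : Measurable fun (y : ParticleLabel k → Fin k → ℕ) w' => y (a :: w') :=
      measurable_pi_lambda _ fun w' => measurable_pi_apply (a :: w')
    exact h1.inter (h2 ih)

theorem measurableSet_isAlive (w : ParticleLabel k) :
    MeasurableSet {q : ℝ × FamilyTree k | IsAlive q.1 q.2 w} := by
  have h1 : Measurable fun (q : ℝ × FamilyTree k) w => (q.2 w).2 := by fun_prop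
  have h2 : Measurable fun q : ℝ × FamilyTree k => birthTime (fun w => (q.2 w).1) w :=
    (measurable_birthTime w).comp (by fun_prop)
  have h3 : Measurable fun q : ℝ × FamilyTree k => (q.2 w).1 := by fun_prop
  exact (h1 (measurableSet_isBorn w)).inter
    ((measurableSet_le h2 measurable_fst).inter (measurableSet_lt measurable_fst (h2.add h3)))

open Classical in
/-- The total weight of the particles of the first `n` generations alive at time `t`, where a
particle of type `j` has weight `c j`. -/
noncomputable def aliveMassTrunc (c : Fin k → ℝ≥0∞) (n : ℕ) (i : Fin k) (t : ℝ)
    (x : FamilyTree k) : ℝ≥0∞ :=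
  ∑' w : ParticleLabel k, if w.length < n ∧ IsAlive t x w then c (particleType i w) else 0

open Classical in
/-- The total weight of the particles alive at time `t`. -/
noncomputable def aliveMass (c : Fin k → ℝ≥0∞) (i : Fin k) (t : ℝ)
    (x : FamilyTree k) : ℝ≥0∞ :=
  ∑' w : ParticleLabel k, if IsAlive t x w then c (particleType i w) else 0

theorem measurable_aliveMassTrunc (c : Fin k → ℝ≥0∞) (n : ℕ) (i : Fin k) :
    Measurable fun q : ℝ × FamilyTree k => aliveMassTrunc c n i q.1 q.2 := by
  classical
  refine Measurable.tsum fun w => ?_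
  refine Measurable.ite ?_ measurable_const measurable_const
  exact (MeasurableSet.const _).inter (measurableSet_isAlive w)

theorem measurable_aliveMassTrunc_right (c : Fin k → ℝ≥0∞) (n : ℕ) (i : Fin k) (t : ℝ) :
    Measurable (aliveMassTrunc c n i t) :=
  (measurable_aliveMassTrunc c n i).comp (measurable_const.prodMk measurable_id)

theorem aliveMassTrunc_mono (c : Fin k → ℝ≥0∞) (i : Fin k) (t : ℝ) :
    Monotone fun n x => aliveMassTrunc c n i t x := by
  intro m n hmn x
  refine ENNReal.tsum_le_tsum fun w => ?_
  split_ifs with h1 h2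
  · exact le_rfl
  · exact absurd ⟨h1.1.trans_le hmn, h1.2⟩ h2
  · exact zero_le
  · exact le_rfl

/-- A finite set of labels has bounded length. This lets inductions on the number of generations
reach the full population by monotone convergence. -/
theorem aliveMass_eq_iSup (c : Fin k → ℝ≥0∞) (i : Fin k) (t : ℝ) (x : FamilyTree k) :
    aliveMass c i t x = ⨆ n, aliveMassTrunc c n i t x := by
  classical
  apply le_antisymm
  · rw [aliveMass, ENNReal.tsum_eq_iSup_sum]
    refine iSup_le fun s => ?_
    refine le_trans ?_ (le_iSup _ (s.sup List.length + 1))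
    refine le_trans (Finset.sum_le_sum fun w hw => ?_) (ENNReal.sum_le_tsum s)
    have := Finset.le_sup (f := List.length) hw
    split_ifs with h1 h2
    · exact le_rfl
    · exact absurd ⟨Nat.lt_succ_of_le this, h1⟩ h2
    · exact zero_le
    · exact le_rfl
  · refine iSup_le fun n => ENNReal.tsum_le_tsum fun w => ?_
    split_ifs with h1 h2
    · exact le_rfl
    · exact absurd h1.2 h2
    · exact zero_le
    · exact le_rfl

theorem measurable_aliveMass (c : Fin k → ℝ≥0∞) (i : Fin k) :
    Measurable fun q : ℝ × FamilyTree k => aliveMass c i q.1 q.2 := by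
  simp_rw [aliveMass_eq_iSup]
  exact Measurable.iSup fun n => measurable_aliveMassTrunc c n i

theorem aliveMassTrunc_zero (c : Fin k → ℝ≥0∞) (i : Fin k) (t : ℝ) (x : FamilyTree k) :
    aliveMassTrunc c 0 i t x = 0 := by
  simp [aliveMassTrunc]

theorem tsum_list {α : Type*} (f : List α → ℝ≥0∞) :
    ∑' w, f w = f [] + ∑' a, ∑' w, f (a :: w) := by
  let e : Unit ⊕ (α × List α) ≃ List α :=
    { toFun := fun o => o.elim (fun _ => []) fun q => q.1 :: q.2
      invFun := fun w => match w with
        | [] => Sum.inl ()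
        | a :: w => Sum.inr (a, w)
      left_inv := fun o => by rcases o with _ | _ <;> rfl
      right_inv := fun w => by cases w <;> rfl }
  rw [← e.tsum_eq, Summable.tsum_sum ENNReal.summable ENNReal.summable, ← ENNReal.tsum_prod]
  congr 1
  exact (tsum_fintype fun b : Unit => f (e (Sum.inl b))).trans (by simp [e])

-- Labels split into the root and the labels through a child. Passing to a child uses up one
-- generation and shifts time by the lifetime of the root; this is the source of all renewal
-- equations below.
open Classical in
theorem aliveMassTrunc_succ_joinTree (c : Fin k → ℝ≥0∞) (n : ℕ) (i : Fin k) (t : ℝ) (l : ℝ)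
    (y : Fin k → ℕ) (X : Fin k × ℕ → FamilyTree k) :
    aliveMassTrunc c (n + 1) i t (joinTree ((l, y), X)) =
      (if 0 ≤ t ∧ t < l then c i else 0) +
        ∑' a : Fin k × ℕ, if a.2 < y a.1 then aliveMassTrunc c n a.1 (t - l) (X a) else 0 := by
  rw [aliveMassTrunc, tsum_list]
  congr 1
  · simp only [isAlive_nil, List.length_nil, Nat.succ_pos, true_and, joinTree, particleType]
  · refine tsum_congr fun a => ?_
    simp only [isAlive_joinTree_cons, List.length_cons, Nat.add_lt_add_iff_right]
    split_ifs with h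
    · simp only [h, true_and]; rfl
    · simp [h]

end FamilyTree

/-! ### Renewal inequalities and moments of the population of one family -/

section Renewal

theorem lintegral_expMeasure {r : ℝ} {f : ℝ → ℝ≥0∞} (hf : Measurable f) :
    ∫⁻ l, f l ∂(expMeasure r) =
      ∫⁻ l in Set.Ioi 0, ENNReal.ofReal (r * Real.exp (-(r * l))) * f l := by
  have hd : Measurable (exponentialPDF r) := (measurable_exponentialPDFReal r).ennreal_ofReal
  have h1 : expMeasure r = volume.withDensity (exponentialPDF r) := rfl
  rw [h1, lintegral_withDensity_eq_lintegral_mul _ hd hf, ← lintegral_indicator measurableSet_Ioi]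
  refine lintegral_congr_ae ?_
  have h0 : ∀ᵐ l : ℝ, l ≠ 0 := by simp [ae_iff]
  filter_upwards [h0] with l hl
  rcases lt_or_gt_of_ne hl with h | h
  · rw [Set.indicator_of_notMem (by simpa using h.le)]
    simp [exponentialPDF_of_neg h]
  · rw [Set.indicator_of_mem (by simpa using h)]
    simp [exponentialPDF_of_nonneg h.le]

theorem ae_expMeasure_nonneg (r : ℝ) : ∀ᵐ l ∂(expMeasure r), 0 ≤ l := by
  have h1 : expMeasure r (Set.Iio 0) = 0 := by
    rw [← lintegral_indicator_one measurableSet_Iio, lintegral_expMeasure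
      (measurable_one.indicator measurableSet_Iio)]
    refine setLIntegral_eq_zero measurableSet_Ioi fun l hl => ?_
    rw [Set.indicator_of_notMem (by simpa using (le_of_lt hl)), mul_zero]; rfl
  filter_upwards [measure_eq_zero_iff_ae_notMem.1 h1] with l hl
  simpa using hl

/-- Variation of constants for an exponential lifetime. -/
theorem ofReal_eq_add_lintegral_expMeasure {r : ℝ} (hr : 0 < r) {g g' : ℝ → ℝ}
    (hg : ∀ x, HasDerivAt g (g' x) x) (hg' : Continuous g') (h0 : 0 ≤ g 0)
    (hnn : ∀ x, 0 ≤ x → 0 ≤ g x + g' x / r) {t : ℝ} (ht : 0 ≤ t) :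
    ENNReal.ofReal (Real.exp (-(r * t)) * g 0) +
      ∫⁻ l, (if l ≤ t then ENNReal.ofReal (g (t - l) + g' (t - l) / r) else 0) ∂(expMeasure r) =
      ENNReal.ofReal (g t) := by
  have hgc : Continuous g := continuous_iff_continuousAt.2 fun x => (hg x).continuousAt
  have hm : Measurable fun l => if l ≤ t then ENNReal.ofReal (g (t - l) + g' (t - l) / r) else 0 :=
    Measurable.ite (measurableSet_le measurable_id measurable_const)
      (Continuous.measurable (by fun_prop)).ennreal_ofReal measurable_const
  set w : ℝ → ℝ := fun l => r * Real.exp (-(r * l)) * (g (t - l) + g' (t - l) / r) with hw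
  have hwc : Continuous w := by fun_prop
  have hwn : ∀ l ∈ Set.Ioc 0 t, 0 ≤ w l := fun l hl =>
    mul_nonneg (mul_nonneg hr.le (Real.exp_pos _).le) (hnn _ (by linarith [hl.2]))
  have h1 : ∫⁻ l, (if l ≤ t then ENNReal.ofReal (g (t - l) + g' (t - l) / r) else 0)
      ∂(expMeasure r) = ENNReal.ofReal (∫ l in (0 : ℝ)..t, w l) := by
    rw [lintegral_expMeasure hm, intervalIntegral.integral_of_le ht,
      ofReal_integral_eq_lintegral_ofReal (hwc.integrableOn_Ioc)
        ((ae_restrict_iff' measurableSet_Ioc).2 (Eventually.of_forall hwn)),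
      ← lintegral_indicator measurableSet_Ioi, ← lintegral_indicator measurableSet_Ioc]
    refine lintegral_congr fun l => ?_
    by_cases h2 : 0 < l
    · by_cases h3 : l ≤ t
      · rw [Set.indicator_of_mem (show l ∈ Set.Ioi 0 from h2),
          Set.indicator_of_mem (show l ∈ Set.Ioc 0 t from ⟨h2, h3⟩), if_pos h3,
          ← ENNReal.ofReal_mul (mul_nonneg hr.le (Real.exp_pos _).le)]
      · rw [Set.indicator_of_mem (show l ∈ Set.Ioi 0 from h2),
          Set.indicator_of_notMem (fun h => h3 h.2), if_neg h3, mul_zero]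
    · rw [Set.indicator_of_notMem (show l ∉ Set.Ioi 0 from h2),
        Set.indicator_of_notMem (fun h => h2 h.1)]
  have h2 : ∫ l in (0 : ℝ)..t, w l = g t - Real.exp (-(r * t)) * g 0 := by
    have hd : ∀ l ∈ Set.uIcc 0 t,
        HasDerivAt (fun l => -(Real.exp (-(r * l)) * g (t - l))) (w l) l := by
      intro l _
      have e1 : HasDerivAt (fun y : ℝ => Real.exp (-(r * y))) (Real.exp (-(r * l)) * (-r)) l := by
        have := ((hasDerivAt_id l).const_mul r).neg.exp
        simpa using this
      have e2 : HasDerivAt (fun l => g (t - l)) (-(g' (t - l))) l := by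
        have := (hg (t - l)).comp l ((hasDerivAt_id l).const_sub t)
        simpa [Function.comp_def] using this
      convert! (e1.mul e2).neg using 1
      simp only [hw]
      field_simp
      ring
    rw [intervalIntegral.integral_eq_sub_of_hasDerivAt hd (hwc.intervalIntegrable 0 t)]
    simp
    ring
  have h3 : 0 ≤ ∫ l in (0 : ℝ)..t, w l := by
    rw [intervalIntegral.integral_of_le ht]
    exact setIntegral_nonneg measurableSet_Ioc hwn
  rw [h1, ← ENNReal.ofReal_add (mul_nonneg (Real.exp_pos _).le h0) h3, h2]
  congr 1
  ring

/-- The exponential tail is the variation of constants formula for the constant function 1. -/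
theorem lintegral_expMeasure_ite_lt {r : ℝ} (hr : 0 < r) {t : ℝ} (ht : 0 ≤ t) (c : ℝ≥0∞) :
    ∫⁻ l, (if t < l then c else 0) ∂(expMeasure r) = c * ENNReal.ofReal (Real.exp (-(r * t))) := by
  have := isProbabilityMeasure_expMeasure hr
  have h1 := ofReal_eq_add_lintegral_expMeasure hr (g := fun _ => 1) (g' := fun _ => 0)
    (fun x => hasDerivAt_const x 1) continuous_const zero_le_one (by simp) ht
  have h2 : ∫⁻ l, (if l ≤ t then ENNReal.ofReal (1 + 0 / r) else 0) ∂(expMeasure r) =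
      expMeasure r (Set.Iic t) := by
    rw [← lintegral_indicator_one measurableSet_Iic]
    refine lintegral_congr fun l => ?_
    simp [Set.indicator_apply]
  rw [h2, mul_one, ENNReal.ofReal_one] at h1
  have h3 : expMeasure r (Set.Ioi t) = ENNReal.ofReal (Real.exp (-(r * t))) := by
    rw [← Set.compl_Iic, prob_compl_eq_one_sub measurableSet_Iic, ← h1,
      ENNReal.add_sub_cancel_right (measure_ne_top _ _)]
  rw [← h3, ← lintegral_indicator_const measurableSet_Ioi]
  refine lintegral_congr fun l => ?_
  simp [Set.indicator_apply]

/-- Comparison principle: the differential inequality φ ≤ g + g'/r and the initial bound c ≤ g(0)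
make `g` dominate one step of the renewal equation. The indicator is the root being still alive at
`t`, and φ(t - l) is the progeny after its death. -/
theorem lintegral_renewal_le {r : ℝ} (hr : 0 < r) {c : ℝ} {g g' : ℝ → ℝ}
    (hg : ∀ x, HasDerivAt g (g' x) x) (hg' : Continuous g') (hc : 0 ≤ c) (h0 : c ≤ g 0)
    {φ : ℝ → ℝ≥0∞} (hφ : ∀ x, 0 ≤ x → φ x ≤ ENNReal.ofReal (g x + g' x / r))
    (hnn : ∀ x, 0 ≤ x → 0 ≤ g x + g' x / r)
    (hφ0 : ∀ x, x < 0 → φ x = 0) {t : ℝ} (ht : 0 ≤ t) :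
    ∫⁻ l, (if t < l then ENNReal.ofReal c else 0) + φ (t - l) ∂(expMeasure r) ≤
      ENNReal.ofReal (g t) := by
  rw [← ofReal_eq_add_lintegral_expMeasure hr hg hg' (hc.trans h0) hnn ht,
    lintegral_add_left (Measurable.ite measurableSet_Ioi measurable_const measurable_const),
    lintegral_expMeasure_ite_lt hr ht, ← ENNReal.ofReal_mul hc]
  refine add_le_add (ENNReal.ofReal_le_ofReal ?_) (lintegral_mono fun l => ?_)
  · rw [mul_comm]; gcongr
  · split_ifs with h
    · exact hφ _ (sub_nonneg.2 h)
    · rw [hφ0 _ (by linarith)]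

theorem tsum_ite_snd_lt {k : ℕ} (y : Fin k → ℕ) (φ : Fin k → ℝ≥0∞) :
    ∑' a : Fin k × ℕ, (if a.2 < y a.1 then φ a.1 else 0) = ∑ j, (y j : ℝ≥0∞) * φ j := by
  rw [ENNReal.tsum_prod (f := fun j m => if m < y j then φ j else 0), tsum_fintype]
  refine Finset.sum_congr rfl fun j _ => ?_
  rw [tsum_eq_sum (s := Finset.range (y j)) (fun b hb => if_neg (by simpa using hb)),
    Finset.sum_congr rfl (g := fun _ => φ j) (fun b hb => if_pos (by simpa using hb))]
  simp

end Renewal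

/-! ### First moments of the truncated population -/

section Moments

variable {k : ℕ} {r : Fin k → ℝ} {p : Fin k → PMF (Fin k → ℕ)}

/-- Expected weight of the particles of the first `n` generations alive at time `t`. -/
noncomputable def meanTrunc (r : Fin k → ℝ) (p : Fin k → PMF (Fin k → ℕ)) (c : Fin k → ℝ≥0∞)
    (n : ℕ) (i : Fin k) (t : ℝ) : ℝ≥0∞ :=
  ∫⁻ x, aliveMassTrunc c n i t x ∂(treeLaw r p i)

/-- Second moment of the weight of the particles of the first `n` generations alive at time `t`. -/
noncomputable def sqMeanTrunc (r : Fin k → ℝ) (p : Fin k → PMF (Fin k → ℕ)) (c : Fin k → ℝ≥0∞)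
    (n : ℕ) (i : Fin k) (t : ℝ) : ℝ≥0∞ :=
  ∫⁻ x, aliveMassTrunc c n i t x ^ 2 ∂(treeLaw r p i)

theorem measurable_meanTrunc (hr : ∀ i, 0 < r i) (c : Fin k → ℝ≥0∞) (n : ℕ) (i : Fin k) :
    Measurable (meanTrunc r p c n i) := by
  have := isProbabilityMeasure_treeLaw hr p i
  exact (measurable_aliveMassTrunc c n i).lintegral_prod_right'

theorem lintegral_infinitePi_treeLaw_eval (hr : ∀ i, 0 < r i) (a : Fin k × ℕ)
    {f : FamilyTree k → ℝ≥0∞} (hf : Measurable f) :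
    ∫⁻ X, f (X a) ∂(Measure.infinitePi fun a : Fin k × ℕ => treeLaw r p a.1) =
      ∫⁻ x, f x ∂(treeLaw r p a.1) := by
  have := fun i => isProbabilityMeasure_treeLaw hr p i
  exact (measurePreserving_eval_infinitePi (fun a : Fin k × ℕ => treeLaw r p a.1) a).lintegral_comp hf

theorem lintegral_natCast_offspring
    (hmean : ∀ i j, Integrable (fun n : Fin k → ℕ => (n j : ℝ)) (p i).toMeasure) (i j : Fin k) :
    ∫⁻ y, (y j : ℝ≥0∞) ∂(p i).toMeasure = ENNReal.ofReal (meanOffspring p i j) := by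
  rw [meanOffspring, ofReal_integral_eq_lintegral_ofReal (hmean i j)
    (Eventually.of_forall fun y => Nat.cast_nonneg _)]
  simp

theorem meanOffspring_nonneg (i j : Fin k) : 0 ≤ meanOffspring p i j :=
  integral_nonneg fun _ => Nat.cast_nonneg _

/-- Integrate over the trees of the children first: each child of type `j` contributes the same
mean, so the offspring law enters only through the expected numbers of children. -/
theorem meanTrunc_succ (hr : ∀ i, 0 < r i)
    (hmean : ∀ i j, Integrable (fun n : Fin k → ℕ => (n j : ℝ)) (p i).toMeasure)
    (c : Fin k → ℝ≥0∞) (n : ℕ) (i : Fin k) (t : ℝ) :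
    meanTrunc r p c (n + 1) i t = ∫⁻ l, (if 0 ≤ t ∧ t < l then c i else 0) +
      ∑ j, ENNReal.ofReal (meanOffspring p i j) * meanTrunc r p c n j (t - l)
        ∂(expMeasure (r i)) := by
  classical
  have := fun i => isProbabilityMeasure_treeLaw hr p i
  rw [meanTrunc, lintegral_treeLaw hr p i (measurable_aliveMassTrunc_right c _ i t)]
  refine lintegral_congr fun l => ?_
  have hm : ∀ a : Fin k × ℕ, Measurable fun X : Fin k × ℕ → FamilyTree k =>
      aliveMassTrunc c n a.1 (t - l) (X a) := fun a =>
    (measurable_aliveMassTrunc_right c n a.1 (t - l)).comp (measurable_pi_apply a)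
  have h1 : ∀ y : Fin k → ℕ, ∫⁻ X, aliveMassTrunc c (n + 1) i t (joinTree ((l, y), X))
      ∂(Measure.infinitePi fun a : Fin k × ℕ => treeLaw r p a.1) =
      (if 0 ≤ t ∧ t < l then c i else 0) + ∑ j, (y j : ℝ≥0∞) * meanTrunc r p c n j (t - l) := by
    intro y
    simp_rw [aliveMassTrunc_succ_joinTree]
    rw [lintegral_add_left measurable_const, lintegral_const, measure_univ, mul_one,
      lintegral_tsum fun a => (by
        split_ifs
        · exact (hm a).aemeasurable
        · exact aemeasurable_const), ← tsum_ite_snd_lt]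
    congr 1
    refine tsum_congr fun a => ?_
    split_ifs
    · exact lintegral_infinitePi_treeLaw_eval hr a (measurable_aliveMassTrunc_right c n a.1 (t - l))
    · exact lintegral_zero
  simp_rw [h1]
  rw [lintegral_add_left measurable_const, lintegral_const, measure_univ, mul_one,
    lintegral_finsetSum _ fun j _ => Measurable.of_discrete]
  congr 1
  refine Finset.sum_congr rfl fun j _ => ?_
  rw [lintegral_mul_const _ Measurable.of_discrete, lintegral_natCast_offspring hmean]

/-- The lifetime in the renewal integral may exceed `t`, and the progeny term is then evaluated at a
negative time. Lifetimes are almost surely nonnegative, so nobody is alive there. -/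
theorem meanTrunc_of_neg (hr : ∀ i, 0 < r i)
    (hmean : ∀ i j, Integrable (fun n : Fin k → ℕ => (n j : ℝ)) (p i).toMeasure)
    (c : Fin k → ℝ≥0∞) (n : ℕ) (i : Fin k) {t : ℝ} (ht : t < 0) : meanTrunc r p c n i t = 0 := by
  induction n generalizing i t with
  | zero => simp [meanTrunc, aliveMassTrunc_zero]
  | succ n ih =>
    rw [meanTrunc_succ hr hmean]
    refine (lintegral_congr_ae ?_).trans lintegral_zero
    filter_upwards [ae_expMeasure_nonneg (r i)] with l hl
    rw [if_neg (fun h => absurd h.1 (not_le.2 ht)), zero_add]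
    exact Finset.sum_eq_zero fun j _ => by rw [ih j (by linarith), mul_zero]

/-- Induction on generations with the comparison principle: a supersolution stays above every
truncation. No finiteness of the mean of the full population is presupposed. -/
theorem meanTrunc_le (hr : ∀ i, 0 < r i)
    (hmean : ∀ i j, Integrable (fun n : Fin k → ℕ => (n j : ℝ)) (p i).toMeasure)
    {c : Fin k → ℝ} (hc : ∀ i, 0 ≤ c i) {g g' : Fin k → ℝ → ℝ}
    (hg : ∀ i x, HasDerivAt (g i) (g' i x) x) (hg' : ∀ i, Continuous (g' i))
    (h0 : ∀ i, c i ≤ g i 0) (hnn : ∀ i x, 0 ≤ x → 0 ≤ g i x)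
    (hsup : ∀ i x, 0 ≤ x → ∑ j, meanOffspring p i j * g j x ≤ g i x + g' i x / r i)
    (n : ℕ) (i : Fin k) {t : ℝ} (ht : 0 ≤ t) :
    meanTrunc r p (fun i => ENNReal.ofReal (c i)) n i t ≤ ENNReal.ofReal (g i t) := by
  induction n generalizing i t with
  | zero => simp [meanTrunc, aliveMassTrunc_zero]
  | succ n ih =>
    rw [meanTrunc_succ hr hmean]
    simp only [ht, true_and]
    refine lintegral_renewal_le (hr i) (hg i) (hg' i) (hc i) (h0 i)
      (φ := fun s => ∑ j, ENNReal.ofReal (meanOffspring p i j) *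
        meanTrunc r p (fun i => ENNReal.ofReal (c i)) n j s) (fun x hx => ?_) (fun x hx => ?_)
      (fun x hx => ?_) ht
    · refine le_trans ?_ (ENNReal.ofReal_le_ofReal (hsup i x hx))
      rw [ENNReal.ofReal_sum_of_nonneg fun j _ => mul_nonneg (meanOffspring_nonneg i j) (hnn j x hx)]
      refine Finset.sum_le_sum fun j _ => ?_
      rw [ENNReal.ofReal_mul (meanOffspring_nonneg i j)]
      gcongr
      exact ih j hx
    · exact (Finset.sum_nonneg fun j _ => mul_nonneg (meanOffspring_nonneg i j) (hnn j x hx)).trans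
        (hsup i x hx)
    · exact Finset.sum_eq_zero fun j _ => by rw [meanTrunc_of_neg hr hmean _ _ _ hx, mul_zero]

end Moments

/-! ### Exact value of the means; the square of a sum over children -/

section Moments

variable {k : ℕ} {r : Fin k → ℝ} {p : Fin k → PMF (Fin k → ℕ)}

/-- Truncated means are bounded below by a solution of the renewal equation, up to a geometrically
small error. -/
theorem le_meanTrunc_add (hr : ∀ i, 0 < r i)
    (hmean : ∀ i j, Integrable (fun n : Fin k → ℕ => (n j : ℝ)) (p i).toMeasure)
    {c : Fin k → ℝ} (hc : ∀ i, 0 ≤ c i) {g g' : Fin k → ℝ → ℝ}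
    (hg : ∀ i x, HasDerivAt (g i) (g' i x) x) (hg' : ∀ i, Continuous (g' i))
    (h0 : ∀ i, g i 0 = c i) (hnn : ∀ i x, 0 ≤ x → 0 ≤ g i x)
    (hsol : ∀ i x, 0 ≤ x → g i x + g' i x / r i = ∑ j, meanOffspring p i j * g j x)
    {C γ : ℝ} (hC : 0 ≤ C) (hγ0 : 0 ≤ γ) (hgC : ∀ i x, 0 ≤ x → g i x ≤ C * Real.exp (γ * x))
    (hγ : ∀ i, 2 * ∑ j, meanOffspring p i j ≤ 1 + γ / r i)
    (n : ℕ) (i : Fin k) {t : ℝ} (ht : 0 ≤ t) :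
    ENNReal.ofReal (g i t) ≤ meanTrunc r p (fun i => ENNReal.ofReal (c i)) n i t +
      ENNReal.ofReal (C * (1 / 2) ^ n * Real.exp (γ * t)) := by
  induction n generalizing i t with
  | zero =>
    refine le_add_left (ENNReal.ofReal_le_ofReal ?_)
    simpa using hgC i t ht
  | succ n ih =>
    have hM : ∀ j, 0 ≤ meanOffspring p i j := fun j => meanOffspring_nonneg i j
    have e1 : ∀ x, HasDerivAt (fun x : ℝ => C * (1 / 2) ^ (n + 1) * Real.exp (γ * x))
        (C * (1 / 2) ^ (n + 1) * (γ * Real.exp (γ * x))) x := by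
      intro x
      have := (((hasDerivAt_id x).const_mul γ).exp).const_mul (C * (1 / 2) ^ (n + 1))
      convert! this using 1
      simp only [id_eq, mul_one]
      ring
    have e2 := ofReal_eq_add_lintegral_expMeasure (hr i) (hg i) (hg' i)
      (by rw [h0]; exact hc i) (fun x hx => by
        rw [hsol i x hx]
        exact Finset.sum_nonneg fun j _ => mul_nonneg (hM j) (hnn j x hx)) ht
    have hγr : 0 ≤ γ / r i := div_nonneg hγ0 (hr i).le
    -- The error at level `n + 1` is a supersolution driven by the error at level `n`: the factor 2
    -- in `hγ` pays for the halving of the error. The root carries no error, hence `c := 0`.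
    have e3 := lintegral_renewal_le (hr i) (c := 0) e1 (by fun_prop) le_rfl (by positivity)
      (φ := fun x => if 0 ≤ x then ∑ j, ENNReal.ofReal (meanOffspring p i j) *
        ENNReal.ofReal (C * (1 / 2) ^ n * Real.exp (γ * x)) else 0)
      (fun x hx => by
        simp only [hx, if_true]
        rw [← Finset.sum_mul, ← ENNReal.ofReal_sum_of_nonneg fun j _ => hM j,
          ← ENNReal.ofReal_mul (Finset.sum_nonneg fun j _ => hM j)]
        refine ENNReal.ofReal_le_ofReal ?_
        have h1 : 0 ≤ C * (1 / 2) ^ (n + 1) * Real.exp (γ * x) := by positivity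
        calc (∑ j, meanOffspring p i j) * (C * (1 / 2) ^ n * Real.exp (γ * x))
            = (2 * ∑ j, meanOffspring p i j) * (C * (1 / 2) ^ (n + 1) * Real.exp (γ * x)) := by
              rw [pow_succ]; ring
          _ ≤ (1 + γ / r i) * (C * (1 / 2) ^ (n + 1) * Real.exp (γ * x)) := by
              gcongr; exact hγ i
          _ = _ := by ring)
      (fun x _ => by
        have h1 : 0 ≤ C * (1 / 2) ^ (n + 1) * Real.exp (γ * x) := by positivity
        have h2 : C * (1 / 2) ^ (n + 1) * (γ * Real.exp (γ * x)) / r i =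
          (γ / r i) * (C * (1 / 2) ^ (n + 1) * Real.exp (γ * x)) := by ring
        rw [h2]
        positivity)
      (fun x hx => if_neg (not_le.2 hx)) ht
    rw [← e2]
    refine le_trans ?_ (add_le_add_right e3 _)
    rw [meanTrunc_succ hr hmean]
    simp only [ht, true_and, ENNReal.ofReal_zero, ite_self, zero_add]
    have hm1 : Measurable fun l => if t < l then ENNReal.ofReal (c i) else 0 :=
      Measurable.ite measurableSet_Ioi measurable_const measurable_const
    rw [lintegral_add_left hm1, lintegral_expMeasure_ite_lt (hr i) ht, add_assoc,
      ← ENNReal.ofReal_mul (hc i), h0, mul_comm (c i)]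
    refine add_le_add_right ?_ _
    have hm2 : Measurable fun l => ∑ j, ENNReal.ofReal (meanOffspring p i j) *
        meanTrunc r p (fun i => ENNReal.ofReal (c i)) n j (t - l) :=
      Finset.measurable_fun_sum _ fun j _ =>
        ((measurable_meanTrunc hr _ n j).comp (measurable_const.sub measurable_id)).const_mul _
    rw [← lintegral_add_left hm2]
    refine lintegral_mono fun l => ?_
    dsimp only
    by_cases hl : l ≤ t
    · have hl' : 0 ≤ t - l := sub_nonneg.2 hl
      rw [if_pos hl, if_pos hl', hsol i _ hl', ← Finset.sum_add_distrib,
        ENNReal.ofReal_sum_of_nonneg fun j _ => mul_nonneg (hM j) (hnn j _ hl')]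
      refine Finset.sum_le_sum fun j _ => ?_
      rw [ENNReal.ofReal_mul (hM j), ← mul_add]
      gcongr
      exact ih j hl'
    · rw [if_neg hl]; exact zero_le

theorem lintegral_aliveMass_eq_iSup (c : Fin k → ℝ≥0∞) (i : Fin k) (t : ℝ) :
    ∫⁻ x, aliveMass c i t x ∂(treeLaw r p i) = ⨆ n, meanTrunc r p c n i t := by
  simp_rw [aliveMass_eq_iSup]
  exact lintegral_iSup (fun n => measurable_aliveMassTrunc_right c n i t) (aliveMassTrunc_mono c i t)

/-- This puts E' = EA, row by row, in the backward form g_i' = r_i (∑ m_{il} g_l - g_i), the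
differential version of the renewal equation. Only one row of `E` is involved, so a left eigenvector
can also be inserted. -/
theorem matrix_exp_meanGenerator_mul (r : Fin k → ℝ) (p : Fin k → PMF (Fin k → ℕ))
    (E : Matrix (Fin k) (Fin k) ℝ) (j i : Fin k) :
    (E * meanGenerator r p) j i = r i * (∑ l, meanOffspring p i l * E j l - E j i) := by
  rw [Matrix.mul_apply, mul_sub, Finset.mul_sum]
  simp only [meanGenerator, Matrix.of_apply, mul_sub]
  rw [Finset.sum_sub_distrib]
  congr 1
  · exact Finset.sum_congr rfl fun l _ => by ring
  · simp [mul_comm]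

theorem meanGenerator_offDiag_nonneg (hr : ∀ i, 0 < r i) (i j : Fin k) (hij : i ≠ j) :
    0 ≤ meanGenerator r p i j := by
  simp only [meanGenerator, Matrix.of_apply, hij, if_false, sub_zero]
  exact mul_nonneg (hr j).le (meanOffspring_nonneg j i)

/-- The mean number of type `j` particles at time `t`, starting from a particle of type `i`, is an
entry of the exponential of the mean generator. -/
theorem lintegral_aliveMass_single (hr : ∀ i, 0 < r i)
    (hmean : ∀ i j, Integrable (fun n : Fin k → ℕ => (n j : ℝ)) (p i).toMeasure)
    (j i : Fin k) {t : ℝ} (ht : 0 ≤ t) :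
    ∫⁻ x, aliveMass (fun l => ENNReal.ofReal ((Pi.single j 1 : Fin k → ℝ) l)) i t x
        ∂(treeLaw r p i) = ENNReal.ofReal (NormedSpace.exp (t • meanGenerator r p) j i) := by
  set A := meanGenerator r p with hA
  rw [lintegral_aliveMass_eq_iSup]
  have hc : ∀ i, 0 ≤ (Pi.single j 1 : Fin k → ℝ) i := fun i => by
    by_cases h : i = j
    · subst h; simp
    · simp [h]
  have hg : ∀ i x, HasDerivAt (fun x : ℝ => NormedSpace.exp (x • A) j i)
      ((NormedSpace.exp (x • A) * A) j i) x := fun i x => hasDerivAt_matrix_exp_apply A j i x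
  have hg' : ∀ i, Continuous fun x : ℝ => (NormedSpace.exp (x • A) * A) j i := fun i => by
    simp only [Matrix.mul_apply]
    exact continuous_finsetSum _ fun l _ => (continuous_matrix_exp_apply A j l).mul_const _
  have h0 : ∀ i, NormedSpace.exp ((0 : ℝ) • A) j i = (Pi.single j 1 : Fin k → ℝ) i := fun i => by
    rw [zero_smul, NormedSpace.exp_zero, Matrix.one_apply, Pi.single_apply]
    simp [eq_comm]
  have hnn : ∀ (i : Fin k) (x : ℝ), 0 ≤ x → 0 ≤ NormedSpace.exp (x • A) j i := fun i x hx =>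
    matrix_exp_nonneg (A := A) (meanGenerator_offDiag_nonneg hr) hx j i
  have hsol : ∀ (i : Fin k) (x : ℝ), 0 ≤ x → NormedSpace.exp (x • A) j i +
      (NormedSpace.exp (x • A) * A) j i / r i =
      ∑ l, meanOffspring p i l * NormedSpace.exp (x • A) j l := fun i x _ => by
    rw [hA, matrix_exp_meanGenerator_mul, mul_div_cancel_left₀ _ (hr i).ne']
    ring
  apply le_antisymm
  · exact iSup_le fun n => meanTrunc_le hr hmean hc hg hg' (fun i => (h0 i).ge) hnn
      (fun i x hx => (hsol i x hx).ge) n i ht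
  · obtain ⟨C, hC0, hC⟩ := exists_abs_matrix_exp_apply_le A (lt_add_one (largestEigenvalue A))
    -- The rate has to dominate the growth of the exponential and satisfy 2∑ m ≤ 1 + γ/r for every
    -- type. Both parts are nonnegative, so their sum serves both purposes.
    set γ : ℝ := max 0 (largestEigenvalue A + 1) + ∑ i, r i * (2 * ∑ j, meanOffspring p i j) with hγ
    have hterm : ∀ i, 0 ≤ r i * (2 * ∑ j, meanOffspring p i j) := fun i =>
      mul_nonneg (hr i).le (mul_nonneg zero_le_two
        (Finset.sum_nonneg fun j _ => meanOffspring_nonneg i j))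
    have hsum0 : 0 ≤ ∑ i, r i * (2 * ∑ j, meanOffspring p i j) :=
      Finset.sum_nonneg fun i _ => hterm i
    have hγ1 : largestEigenvalue A + 1 ≤ γ := by
      have := le_max_right 0 (largestEigenvalue A + 1); linarith
    have hγ0 : 0 ≤ γ := by
      have := le_max_left 0 (largestEigenvalue A + 1); linarith
    have hγ2 : ∀ i, 2 * ∑ j, meanOffspring p i j ≤ 1 + γ / r i := fun i => by
      have h1 : r i * (2 * ∑ j, meanOffspring p i j) ≤ γ := by
        have := Finset.single_le_sum (f := fun i => r i * (2 * ∑ j, meanOffspring p i j))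
          (fun i _ => hterm i) (Finset.mem_univ i)
        have h2 := le_max_left 0 (largestEigenvalue A + 1)
        linarith
      have h3 : 2 * ∑ j, meanOffspring p i j ≤ γ / r i := by
        rw [le_div_iff₀ (hr i)]; linarith
      linarith
    have hlow := fun n => le_meanTrunc_add hr hmean hc hg hg' h0 hnn hsol hC0 hγ0
      (fun i x hx => (le_abs_self _).trans ((hC x hx j i).trans (by gcongr))) hγ2 n i ht
    have hlim : Tendsto (fun n : ℕ =>
        (⨆ n, meanTrunc r p (fun l => ENNReal.ofReal ((Pi.single j 1 : Fin k → ℝ) l)) n i t) +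
        ENNReal.ofReal (C * (1 / 2) ^ n * Real.exp (γ * t))) atTop
        (𝓝 ((⨆ n, meanTrunc r p (fun l => ENNReal.ofReal ((Pi.single j 1 : Fin k → ℝ) l)) n i t)
          + 0)) := by
      refine tendsto_const_nhds.add ?_
      rw [← ENNReal.ofReal_zero]
      refine ENNReal.tendsto_ofReal ?_
      have := (tendsto_pow_atTop_nhds_zero_of_lt_one (r := (1 / 2 : ℝ)) (by norm_num)
        (by norm_num)).const_mul C
      simpa using this.mul_const (Real.exp (γ * t))
    rw [add_zero] at hlim
    exact ge_of_tendsto' hlim fun n => (hlow n).trans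
      (add_le_add_left (le_iSup (fun n => meanTrunc r p _ n i t) n) _)

theorem sq_tsum_eq {α : Type*} (f : α → ℝ≥0∞) : (∑' a, f a) ^ 2 = ∑' a, ∑' b, f a * f b := by
  rw [sq, ← ENNReal.tsum_mul_right]
  exact tsum_congr fun a => ENNReal.tsum_mul_left.symm

/-- Expand the square over pairs of children. Distinct children are independent, so their cross
terms factor into means; adding the nonnegative diagonal products completes the square of the mean.
The diagonal contributes second moments. -/
theorem lintegral_sq_sum_children_le (hr : ∀ i, 0 < r i) (c : Fin k → ℝ≥0∞) (n : ℕ) (s : ℝ)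
    (y : Fin k → ℕ) :
    ∫⁻ X, (∑' a : Fin k × ℕ, if a.2 < y a.1 then aliveMassTrunc c n a.1 s (X a) else 0) ^ 2
      ∂(Measure.infinitePi fun a : Fin k × ℕ => treeLaw r p a.1) ≤
    (∑ j, (y j : ℝ≥0∞) * meanTrunc r p c n j s) ^ 2 +
      ∑ j, (y j : ℝ≥0∞) * sqMeanTrunc r p c n j s := by
  classical
  have := fun i => isProbabilityMeasure_treeLaw hr p i
  set Z : Fin k × ℕ → (Fin k × ℕ → FamilyTree k) → ℝ≥0∞ := fun a X =>
    if a.2 < y a.1 then aliveMassTrunc c n a.1 s (X a) else 0 with hZ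
  have hZm : ∀ a, Measurable (Z a) := fun a => by
    simp only [hZ]
    split_ifs
    · exact (measurable_aliveMassTrunc_right c n a.1 s).comp (measurable_pi_apply a)
    · exact measurable_const
  have hprod : ∀ a b, ∫⁻ X, Z a X * Z b X
      ∂(Measure.infinitePi fun a : Fin k × ℕ => treeLaw r p a.1) ≤
      (if a.2 < y a.1 then meanTrunc r p c n a.1 s else 0) *
        (if b.2 < y b.1 then meanTrunc r p c n b.1 s else 0) +
      (if a = b then (if a.2 < y a.1 then sqMeanTrunc r p c n a.1 s else 0) else 0) := by
    intro a b
    by_cases ha : a.2 < y a.1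
    · by_cases hb : b.2 < y b.1
      · by_cases hab : a = b
        · subst hab
          simp only [hZ, ha, if_true]
          refine le_add_left (le_of_eq ?_)
          simp_rw [← sq]
          exact lintegral_infinitePi_treeLaw_eval hr a
            ((measurable_aliveMassTrunc_right c n a.1 s).pow_const 2)
        · simp only [hZ, ha, hb, hab, if_true, if_false, add_zero]
          have hmap := Measure.infinitePi_map_eval_prod
            (P := fun a : Fin k × ℕ => treeLaw r p a.1) hab
          have hm : Measurable fun q : FamilyTree k × FamilyTree k =>
              aliveMassTrunc c n a.1 s q.1 * aliveMassTrunc c n b.1 s q.2 :=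
            ((measurable_aliveMassTrunc_right c n a.1 s).comp measurable_fst).mul
              ((measurable_aliveMassTrunc_right c n b.1 s).comp measurable_snd)
          have h1 := lintegral_map (μ := Measure.infinitePi fun a : Fin k × ℕ => treeLaw r p a.1)
            hm (g := fun X => (X a, X b)) (by fun_prop)
          rw [hmap, lintegral_prod_mul (measurable_aliveMassTrunc_right c n a.1 s).aemeasurable
            (measurable_aliveMassTrunc_right c n b.1 s).aemeasurable] at h1
          exact h1.ge
      · simp [hZ, hb]
    · simp [hZ, ha]
  have hsum : ∫⁻ X, (∑' a, Z a X) ^ 2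
      ∂(Measure.infinitePi fun a : Fin k × ℕ => treeLaw r p a.1) = ∑' a, ∑' b,
      ∫⁻ X, Z a X * Z b X ∂(Measure.infinitePi fun a : Fin k × ℕ => treeLaw r p a.1) := by
    simp_rw [sq_tsum_eq]
    rw [lintegral_tsum (f := fun a X => ∑' b, Z a X * Z b X)
      fun a => (Measurable.tsum fun b => (hZm a).mul (hZm b)).aemeasurable]
    exact tsum_congr fun a => lintegral_tsum (f := fun b X => Z a X * Z b X)
      fun b => ((hZm a).mul (hZm b)).aemeasurable
  refine hsum.le.trans ?_
  refine (ENNReal.tsum_le_tsum fun a => ENNReal.tsum_le_tsum fun b => hprod a b).trans ?_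
  simp_rw [ENNReal.tsum_add]
  rw [← sq_tsum_eq, tsum_ite_snd_lt y (fun j => meanTrunc r p c n j s)]
  have hdiag : ∀ a : Fin k × ℕ, ∑' b, (if a = b then
      (if a.2 < y a.1 then sqMeanTrunc r p c n a.1 s else 0) else 0) =
      if a.2 < y a.1 then sqMeanTrunc r p c n a.1 s else 0 := fun a => by
    rw [tsum_eq_single a fun b hb => if_neg hb.symm, if_pos rfl]
  simp_rw [hdiag]
  rw [tsum_ite_snd_lt y (fun j => sqMeanTrunc r p c n j s)]

end Moments

/-! ### Growth of the second moments -/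

section Moments

variable {k : ℕ} {r : Fin k → ℝ} {p : Fin k → PMF (Fin k → ℕ)}

theorem aliveMassTrunc_ae_eq_zero_of_neg (hr : ∀ i, 0 < r i)
    (hmean : ∀ i j, Integrable (fun n : Fin k → ℕ => (n j : ℝ)) (p i).toMeasure)
    (c : Fin k → ℝ≥0∞) (n : ℕ) (i : Fin k) {t : ℝ} (ht : t < 0) :
    aliveMassTrunc c n i t =ᵐ[treeLaw r p i] 0 :=
  (lintegral_eq_zero_iff (measurable_aliveMassTrunc_right c n i t)).1
    (meanTrunc_of_neg hr hmean c n i ht)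

theorem sqMeanTrunc_of_neg (hr : ∀ i, 0 < r i)
    (hmean : ∀ i j, Integrable (fun n : Fin k → ℕ => (n j : ℝ)) (p i).toMeasure)
    (c : Fin k → ℝ≥0∞) (n : ℕ) (i : Fin k) {t : ℝ} (ht : t < 0) : sqMeanTrunc r p c n i t = 0 := by
  refine (lintegral_congr_ae ?_).trans lintegral_zero
  filter_upwards [aliveMassTrunc_ae_eq_zero_of_neg hr hmean c n i ht] with x hx
  simp [hx]

/-- The square of root term plus progeny term has no mixed part: while the root lives, the progeny
is evaluated at a negative time and vanishes almost surely. -/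
theorem sqMeanTrunc_succ_le (hr : ∀ i, 0 < r i)
    (hmean : ∀ i j, Integrable (fun n : Fin k → ℕ => (n j : ℝ)) (p i).toMeasure)
    (c : Fin k → ℝ≥0∞) (n : ℕ) (i : Fin k) {t : ℝ} (ht : 0 ≤ t) :
    sqMeanTrunc r p c (n + 1) i t ≤ ∫⁻ l, (if t < l then c i ^ 2 else 0) +
      (∫⁻ y, (∑ j, (y j : ℝ≥0∞) * meanTrunc r p c n j (t - l)) ^ 2 ∂(p i).toMeasure +
        ∑ j, ENNReal.ofReal (meanOffspring p i j) * sqMeanTrunc r p c n j (t - l))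
        ∂(expMeasure (r i)) := by
  classical
  have := fun i => isProbabilityMeasure_treeLaw hr p i
  rw [sqMeanTrunc, lintegral_treeLaw hr p i
    ((measurable_aliveMassTrunc_right c _ i t).pow_const 2)]
  refine lintegral_mono fun l => ?_
  have h1 : ∀ y : Fin k → ℕ, ∫⁻ X, aliveMassTrunc c (n + 1) i t (joinTree ((l, y), X)) ^ 2
      ∂(Measure.infinitePi fun a : Fin k × ℕ => treeLaw r p a.1) ≤
      (if t < l then c i ^ 2 else 0) + ((∑ j, (y j : ℝ≥0∞) * meanTrunc r p c n j (t - l)) ^ 2 +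
        ∑ j, (y j : ℝ≥0∞) * sqMeanTrunc r p c n j (t - l)) := by
    intro y
    simp_rw [aliveMassTrunc_succ_joinTree]
    simp only [ht, true_and]
    by_cases hl : t < l
    · simp only [hl, if_true]
      refine le_add_right (le_of_eq ?_)
      have hae : ∀ a : Fin k × ℕ,
          ∀ᵐ X ∂(Measure.infinitePi fun a : Fin k × ℕ => treeLaw r p a.1),
          aliveMassTrunc c n a.1 (t - l) (X a) = 0 := fun a =>
        (measurePreserving_eval_infinitePi (fun a : Fin k × ℕ => treeLaw r p a.1)
          a).quasiMeasurePreserving.ae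
          (aliveMassTrunc_ae_eq_zero_of_neg hr hmean c n a.1 (by linarith))
      have : ∀ᵐ X ∂(Measure.infinitePi fun a : Fin k × ℕ => treeLaw r p a.1),
          (c i + ∑' a : Fin k × ℕ, if a.2 < y a.1 then aliveMassTrunc c n a.1 (t - l) (X a)
            else 0) ^ 2 = c i ^ 2 := by
        filter_upwards [ae_all_iff.2 hae] with X hX
        simp [hX]
      rw [lintegral_congr_ae this, lintegral_const, measure_univ, mul_one]
    · simp only [hl, if_false, zero_add]
      exact lintegral_sq_sum_children_le hr c n (t - l) y
  refine (lintegral_mono h1).trans (le_of_eq ?_)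
  rw [lintegral_add_left measurable_const, lintegral_const, measure_univ, mul_one,
    lintegral_add_left Measurable.of_discrete, lintegral_finsetSum _ fun j _ => Measurable.of_discrete]
  congr 2
  refine Finset.sum_congr rfl fun j _ => ?_
  rw [lintegral_mul_const _ Measurable.of_discrete, lintegral_natCast_offspring hmean]

theorem lintegral_sq_offspring_lt_top
    (hsq : ∀ i j, Integrable (fun n : Fin k → ℕ => (n j : ℝ) ^ 2) (p i).toMeasure)
    (v : Fin k → ℝ) (i : Fin k) :
    ∫⁻ y, (∑ j, (y j : ℝ≥0∞) * ENNReal.ofReal (v j)) ^ 2 ∂(p i).toMeasure < ∞ := by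
  have h1 : ∀ j, ∫⁻ y, (y j : ℝ≥0∞) ^ 2 ∂(p i).toMeasure < ∞ := fun j => by
    have := (hsq i j).2
    rw [hasFiniteIntegral_iff_ofReal (Eventually.of_forall fun y => by positivity)] at this
    refine lt_of_le_of_lt (le_of_eq (lintegral_congr fun y => ?_)) this
    rw [ENNReal.ofReal_pow (Nat.cast_nonneg _), ENNReal.ofReal_natCast]
  have h2 : ∀ y : Fin k → ℕ, (∑ j, (y j : ℝ≥0∞) * ENNReal.ofReal (v j)) ^ 2 ≤
      (k : ℝ≥0∞) * ∑ j, (y j : ℝ≥0∞) ^ 2 * ENNReal.ofReal (v j) ^ 2 := fun y => by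
    -- Cauchy–Schwarz against the constant vector 1; the factor `k` is the squared norm of that
    -- vector.
    have h3 := ENNReal.inner_le_Lp_mul_Lq Finset.univ (fun _ => 1)
      (fun j => (y j : ℝ≥0∞) * ENNReal.ofReal (v j)) (p := 2) (q := 2)
      (Real.HolderConjugate.two_two)
    have h4 := pow_le_pow_left₀ zero_le h3 2
    simp only [one_mul, ENNReal.one_rpow, Finset.sum_const, Finset.card_univ, Fintype.card_fin,
      nsmul_eq_mul, mul_one] at h4
    refine h4.trans (le_of_eq ?_)
    rw [mul_pow, ← ENNReal.rpow_natCast, ← ENNReal.rpow_natCast, ← ENNReal.rpow_mul,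
      ← ENNReal.rpow_mul]
    norm_num [mul_pow]
  refine (lintegral_mono h2).trans_lt ?_
  rw [lintegral_const_mul _ Measurable.of_discrete,
    lintegral_finsetSum _ fun j _ => Measurable.of_discrete]
  refine ENNReal.mul_lt_top (ENNReal.natCast_lt_top k) (ENNReal.sum_lt_top.2 fun j _ => ?_)
  rw [lintegral_mul_const _ Measurable.of_discrete]
  exact ENNReal.mul_lt_top (h1 j) (ENNReal.pow_lt_top ENNReal.ofReal_lt_top)

/-- Equivalently, v_i e^{ρt} solves the renewal equation exactly, so it bounds the mean of the
population weighted by `v`. -/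
theorem sum_meanOffspring_mul_left_eigenvector (hr : ∀ i, 0 < r i) {v : Fin k → ℝ} {ρ : ℝ}
    (hv : v ᵥ* meanGenerator r p = ρ • v) (i : Fin k) :
    ∑ j, meanOffspring p i j * v j = v i + ρ * v i / r i := by
  have h1 := congrFun hv i
  have h2 : (v ᵥ* meanGenerator r p) i = r i * (∑ j, meanOffspring p i j * v j - v i) :=
    matrix_exp_meanGenerator_mul r p (fun _ => v) i i
  rw [h2, Pi.smul_apply, smul_eq_mul] at h1
  have := (hr i).ne'
  field_simp
  linarith

/-- B v_i e^{2ρt} is a supersolution for the second moment. At rate ρ the weights `v` balance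
exactly; at rate 2ρ there remains a surplus B ρ v_i / r_i, positive because ρ > 0, which absorbs the
squared mean term coming from the offspring. -/
theorem exists_sqMeanTrunc_le (hr : ∀ i, 0 < r i)
    (hmean : ∀ i j, Integrable (fun n : Fin k → ℕ => (n j : ℝ)) (p i).toMeasure)
    (hsq : ∀ i j, Integrable (fun n : Fin k → ℕ => (n j : ℝ) ^ 2) (p i).toMeasure)
    {v : Fin k → ℝ} {ρ : ℝ} (hρ : 0 < ρ) (hv0 : ∀ i, 0 < v i)
    (hv : v ᵥ* meanGenerator r p = ρ • v) :
    ∃ B, 0 ≤ B ∧ ∀ n i t, 0 ≤ t → sqMeanTrunc r p (fun i => ENNReal.ofReal (v i)) n i t ≤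
      ENNReal.ofReal (B * v i * Real.exp (2 * ρ * t)) := by
  set D : Fin k → ℝ := fun i =>
    (∫⁻ y, (∑ j, (y j : ℝ≥0∞) * ENNReal.ofReal (v j)) ^ 2 ∂(p i).toMeasure).toReal with hD
  have hDv : ∀ i, ∫⁻ y, (∑ j, (y j : ℝ≥0∞) * ENNReal.ofReal (v j)) ^ 2 ∂(p i).toMeasure =
      ENNReal.ofReal (D i) := fun i =>
    (ENNReal.ofReal_toReal (lintegral_sq_offspring_lt_top hsq v i).ne).symm
  have hD0 : ∀ i, 0 ≤ D i := fun i => ENNReal.toReal_nonneg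
  -- The first summand gives B v_i ≥ v_i² at time 0, the second gives D_i ≤ B ρ v_i / r_i.
  set B : ℝ := ∑ i, (v i + D i * r i / (v i * ρ)) with hB
  have hterm : ∀ i, 0 ≤ D i * r i / (v i * ρ) := fun i =>
    div_nonneg (mul_nonneg (hD0 i) (hr i).le) (mul_nonneg (hv0 i).le hρ.le)
  have hBi : ∀ i, v i + D i * r i / (v i * ρ) ≤ B := fun i =>
    Finset.single_le_sum (f := fun i => v i + D i * r i / (v i * ρ))
      (fun i _ => add_nonneg (hv0 i).le (hterm i)) (Finset.mem_univ i)
  have hB0 : 0 ≤ B := Finset.sum_nonneg fun i _ => add_nonneg (hv0 i).le (hterm i)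
  have hexp : ∀ a x : ℝ, HasDerivAt (fun x => Real.exp (a * x)) (a * Real.exp (a * x)) x := by
    intro a x
    have := ((hasDerivAt_id x).const_mul a).exp
    convert! this using 1
    simp only [id_eq, mul_one]
    ring
  have hmeanv : ∀ n j s, meanTrunc r p (fun i => ENNReal.ofReal (v i)) n j s ≤
      if 0 ≤ s then ENNReal.ofReal (v j * Real.exp (ρ * s)) else 0 := by
    intro n j s
    split_ifs with hs
    · refine meanTrunc_le hr hmean (fun i => (hv0 i).le)
        (g := fun i x => v i * Real.exp (ρ * x)) (g' := fun i x => v i * (ρ * Real.exp (ρ * x)))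
        (fun i x => (hexp ρ x).const_mul (v i)) (fun i => by fun_prop) (fun i => by simp)
        (fun i x _ => mul_nonneg (hv0 i).le (Real.exp_pos _).le) (fun i x _ => le_of_eq ?_) n j hs
      simp_rw [← mul_assoc]
      rw [← Finset.sum_mul, sum_meanOffspring_mul_left_eigenvector hr hv]
      ring
    · exact (meanTrunc_of_neg hr hmean _ n j (not_le.1 hs)).le
  refine ⟨B, hB0, fun n => ?_⟩
  induction n with
  | zero => intro i t _; simp [sqMeanTrunc, aliveMassTrunc_zero]
  | succ n ih =>
    intro i t ht
    refine (sqMeanTrunc_succ_le hr hmean _ n i ht).trans ?_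
    have hc : ENNReal.ofReal (v i) ^ 2 = ENNReal.ofReal (v i ^ 2) :=
      (ENNReal.ofReal_pow (hv0 i).le 2).symm
    simp only [hc]
    have hnn : ∀ x : ℝ, 0 ≤ B * v i * Real.exp (2 * ρ * x) +
        B * v i * (2 * ρ * Real.exp (2 * ρ * x)) / r i := fun x => by
      have := hr i
      have := hv0 i
      positivity
    refine lintegral_renewal_le (hr i) (g := fun x => B * v i * Real.exp (2 * ρ * x))
      (g' := fun x => B * v i * (2 * ρ * Real.exp (2 * ρ * x)))
      (fun x => (hexp (2 * ρ) x).const_mul (B * v i)) (by fun_prop) (sq_nonneg _) ?_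
      (φ := fun s => ∫⁻ y, (∑ j, (y j : ℝ≥0∞) *
        meanTrunc r p (fun i => ENNReal.ofReal (v i)) n j s) ^ 2 ∂(p i).toMeasure +
        ∑ j, ENNReal.ofReal (meanOffspring p i j) *
          sqMeanTrunc r p (fun i => ENNReal.ofReal (v i)) n j s) (fun x hx => ?_)
      (fun x _ => hnn x) (fun x hx => ?_) ht
    · simp only [mul_zero, Real.exp_zero, mul_one, sq]
      have := hBi i
      exact mul_le_mul_of_nonneg_right (by linarith [hterm i]) (hv0 i).le
    · have h1 : ∫⁻ y, (∑ j, (y j : ℝ≥0∞) *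
          meanTrunc r p (fun i => ENNReal.ofReal (v i)) n j x) ^ 2 ∂(p i).toMeasure ≤
          ENNReal.ofReal (D i * Real.exp (2 * ρ * x)) := by
        rw [ENNReal.ofReal_mul (hD0 i), ← hDv, ← lintegral_mul_const _ Measurable.of_discrete]
        refine lintegral_mono fun y => ?_
        have h2 : Real.exp (2 * ρ * x) = Real.exp (ρ * x) ^ 2 := by
          rw [← Real.exp_nat_mul]; congr 1; push_cast; ring
        rw [h2, ENNReal.ofReal_pow (Real.exp_pos _).le, ← mul_pow, Finset.sum_mul]
        refine pow_le_pow_left₀ zero_le (Finset.sum_le_sum fun j _ => ?_) 2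
        have h3 := hmeanv n j x
        rw [if_pos hx, ENNReal.ofReal_mul (hv0 j).le] at h3
        rw [mul_assoc]
        gcongr
      have h4 : ∑ j, ENNReal.ofReal (meanOffspring p i j) *
          sqMeanTrunc r p (fun i => ENNReal.ofReal (v i)) n j x ≤
          ENNReal.ofReal (∑ j, meanOffspring p i j * (B * v j * Real.exp (2 * ρ * x))) := by
        rw [ENNReal.ofReal_sum_of_nonneg fun j _ => mul_nonneg (meanOffspring_nonneg i j)
          (mul_nonneg (mul_nonneg hB0 (hv0 j).le) (Real.exp_pos _).le)]
        refine Finset.sum_le_sum fun j _ => ?_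
        rw [ENNReal.ofReal_mul (meanOffspring_nonneg i j)]
        gcongr
        exact ih j x hx
      refine (add_le_add h1 h4).trans ?_
      rw [← ENNReal.ofReal_add (mul_nonneg (hD0 i) (Real.exp_pos _).le)
        (Finset.sum_nonneg fun j _ => mul_nonneg (meanOffspring_nonneg i j)
          (mul_nonneg (mul_nonneg hB0 (hv0 j).le) (Real.exp_pos _).le))]
      refine ENNReal.ofReal_le_ofReal ?_
      have h5 : ∑ j, meanOffspring p i j * (B * v j * Real.exp (2 * ρ * x)) =
          B * (v i + ρ * v i / r i) * Real.exp (2 * ρ * x) := by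
        rw [← sum_meanOffspring_mul_left_eigenvector hr hv, Finset.mul_sum, Finset.sum_mul]
        exact Finset.sum_congr rfl fun j _ => by ring
      have h6 : D i ≤ B * (ρ * v i / r i) := by
        have h7 : D i = (D i * r i / (v i * ρ)) * (ρ * v i / r i) := by
          have := (hr i).ne'
          have := (hv0 i).ne'
          field_simp
        rw [h7]
        have : 0 ≤ ρ * v i / r i := div_nonneg (mul_nonneg hρ.le (hv0 i).le) (hr i).le
        exact mul_le_mul_of_nonneg_right (by linarith [hBi i, hv0 i]) this
      rw [h5]
      calc _ = (D i + B * (v i + ρ * v i / r i)) * Real.exp (2 * ρ * x) := by ring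
        _ ≤ (B * (ρ * v i / r i) + B * (v i + ρ * v i / r i)) * Real.exp (2 * ρ * x) := by gcongr
        _ = _ := by ring
    · rw [Finset.sum_eq_zero fun j _ => by rw [sqMeanTrunc_of_neg hr hmean _ _ _ hx, mul_zero],
        add_zero]
      simp [meanTrunc_of_neg hr hmean _ _ _ hx]

end Moments

/-! ### The numbers of particles in one family -/

section TreeCount

variable {k : ℕ} {r : Fin k → ℝ} {p : Fin k → PMF (Fin k → ℕ)}

/-- The vector of the numbers of particles of each type alive at time `t`. -/
noncomputable def treeCount (i : Fin k) (t : ℝ) (x : FamilyTree k) (j : Fin k) : ℝ :=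
  aliveCount i (fun w => (x w).1) (fun w => (x w).2) t j

theorem treeCount_nonneg (i : Fin k) (t : ℝ) (x : FamilyTree k) (j : Fin k) :
    0 ≤ treeCount i t x j := Nat.cast_nonneg _

theorem measurable_aliveCount (i j : Fin k) : Measurable fun q : ℝ × FamilyTree k =>
    aliveCount i (fun w => (q.2 w).1) (fun w => (q.2 w).2) q.1 j := by
  refine measurable_ncard_of_measurableSet fun w => ?_
  exact (MeasurableSet.const _).inter (measurableSet_isAlive w)

theorem measurable_treeCount_prod (i : Fin k) :
    Measurable fun q : ℝ × FamilyTree k => treeCount i q.1 q.2 :=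
  measurable_pi_lambda _ fun j => measurable_from_nat.comp (measurable_aliveCount i j)

theorem measurable_treeCount (i : Fin k) (t : ℝ) : Measurable (treeCount (k := k) i t) :=
  (measurable_treeCount_prod i).comp (g := fun q : ℝ × FamilyTree k => treeCount i q.1 q.2)
    (f := fun x => (t, x)) measurable_prodMk_left

theorem treeCount_eq_toReal_aliveMass (i : Fin k) (t : ℝ) (x : FamilyTree k) (j : Fin k) :
    treeCount i t x j =
      (aliveMass (fun l => ENNReal.ofReal ((Pi.single j 1 : Fin k → ℝ) l)) i t x).toReal := by
  classical
  rw [treeCount, aliveCount, natCast_ncard_eq_toReal_tsum, aliveMass]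
  congr 1
  refine tsum_congr fun w => ?_
  rw [Set.indicator_apply]
  by_cases h2 : IsAlive t x w
  · by_cases h1 : particleType i w = j
    · rw [if_pos h2, if_pos ⟨h1, h2⟩, h1]; simp
    · rw [if_neg fun h => h1 h.1]; simp [h1]
  · rw [if_neg h2, if_neg fun h => h2 h.2]

theorem measurable_aliveMass_right (c : Fin k → ℝ≥0∞) (i : Fin k) (t : ℝ) :
    Measurable (aliveMass c i t) :=
  (measurable_aliveMass c i).comp (g := fun q : ℝ × FamilyTree k => aliveMass c i q.1 q.2)
    (f := fun x => (t, x)) measurable_prodMk_left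

/-- A finite mean excludes infinitely many living particles almost surely. Hence the default value 0
of `ncard` on infinite sets is harmless. -/
theorem aliveMass_single_ae_lt_top (hr : ∀ i, 0 < r i)
    (hmean : ∀ i j, Integrable (fun n : Fin k → ℕ => (n j : ℝ)) (p i).toMeasure) (i j : Fin k)
    {t : ℝ} (ht : 0 ≤ t) : ∀ᵐ x ∂(treeLaw r p i),
      aliveMass (fun l => ENNReal.ofReal ((Pi.single j 1 : Fin k → ℝ) l)) i t x < ∞ := by
  refine ae_lt_top (measurable_aliveMass_right _ i t) ?_
  rw [lintegral_aliveMass_single hr hmean j i ht]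
  exact ENNReal.ofReal_ne_top

theorem ofReal_treeCount_ae_eq (hr : ∀ i, 0 < r i)
    (hmean : ∀ i j, Integrable (fun n : Fin k → ℕ => (n j : ℝ)) (p i).toMeasure) (i j : Fin k)
    {t : ℝ} (ht : 0 ≤ t) : ∀ᵐ x ∂(treeLaw r p i), ENNReal.ofReal (treeCount i t x j) =
      aliveMass (fun l => ENNReal.ofReal ((Pi.single j 1 : Fin k → ℝ) l)) i t x := by
  filter_upwards [aliveMass_single_ae_lt_top hr hmean i j ht] with x hx
  rw [treeCount_eq_toReal_aliveMass, ENNReal.ofReal_toReal hx.ne]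

theorem lintegral_treeCount (hr : ∀ i, 0 < r i)
    (hmean : ∀ i j, Integrable (fun n : Fin k → ℕ => (n j : ℝ)) (p i).toMeasure) (i j : Fin k)
    {t : ℝ} (ht : 0 ≤ t) : ∫⁻ x, ENNReal.ofReal (treeCount i t x j) ∂(treeLaw r p i) =
      ENNReal.ofReal (NormedSpace.exp (t • meanGenerator r p) j i) := by
  rw [lintegral_congr_ae (ofReal_treeCount_ae_eq hr hmean i j ht),
    lintegral_aliveMass_single hr hmean j i ht]

theorem matrix_exp_meanGenerator_nonneg (hr : ∀ i, 0 < r i) {t : ℝ} (ht : 0 ≤ t) (i j : Fin k) :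
    0 ≤ NormedSpace.exp (t • meanGenerator r p) i j :=
  matrix_exp_nonneg (meanGenerator_offDiag_nonneg hr) ht i j

theorem integrable_treeCount (hr : ∀ i, 0 < r i)
    (hmean : ∀ i j, Integrable (fun n : Fin k → ℕ => (n j : ℝ)) (p i).toMeasure) (i j : Fin k)
    {t : ℝ} (ht : 0 ≤ t) : Integrable (fun x => treeCount i t x j) (treeLaw r p i) := by
  refine ⟨((measurable_pi_apply j).comp (measurable_treeCount i t)).aestronglyMeasurable, ?_⟩
  rw [hasFiniteIntegral_iff_ofReal (Eventually.of_forall fun x => treeCount_nonneg i t x j),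
    lintegral_treeCount hr hmean i j ht]
  exact ENNReal.ofReal_lt_top

theorem integral_treeCount (hr : ∀ i, 0 < r i)
    (hmean : ∀ i j, Integrable (fun n : Fin k → ℕ => (n j : ℝ)) (p i).toMeasure) (i j : Fin k)
    {t : ℝ} (ht : 0 ≤ t) : ∫ x, treeCount i t x j ∂(treeLaw r p i) =
      NormedSpace.exp (t • meanGenerator r p) j i := by
  rw [integral_eq_lintegral_of_nonneg_ae (Eventually.of_forall fun x => treeCount_nonneg i t x j)
    ((measurable_pi_apply j).comp (measurable_treeCount i t)).aestronglyMeasurable,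
    lintegral_treeCount hr hmean i j ht,
    ENNReal.toReal_ofReal (matrix_exp_meanGenerator_nonneg hr ht j i)]

/-- Since each type is only a part of the `v`-weighted population, a second moment bound for the
latter passes to single types after division by v_j². -/
theorem ofReal_mul_treeCount_le (v : Fin k → ℝ) (i j : Fin k) (t : ℝ) (x : FamilyTree k) :
    ENNReal.ofReal (v j) * aliveMass (fun l => ENNReal.ofReal ((Pi.single j 1 : Fin k → ℝ) l)) i t x ≤
      aliveMass (fun l => ENNReal.ofReal (v l)) i t x := by
  classical
  rw [aliveMass, ← ENNReal.tsum_mul_left]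
  refine ENNReal.tsum_le_tsum fun w => ?_
  split_ifs
  · by_cases h : particleType i w = j
    · simp [h]
    · simp [h]
  · simp

/-- A bound for the second moments of the numbers of particles in the supercritical case. -/
theorem exists_integral_treeCount_sq_le (hr : ∀ i, 0 < r i)
    (hmean : ∀ i j, Integrable (fun n : Fin k → ℕ => (n j : ℝ)) (p i).toMeasure)
    (hsq : ∀ i j, Integrable (fun n : Fin k → ℕ => (n j : ℝ) ^ 2) (p i).toMeasure)
    {v : Fin k → ℝ} {ρ : ℝ} (hρ : 0 < ρ) (hv0 : ∀ i, 0 < v i)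
    (hv : v ᵥ* meanGenerator r p = ρ • v) (i j : Fin k) :
    ∃ C, 0 ≤ C ∧ ∀ t, 0 ≤ t → Integrable (fun x => treeCount i t x j ^ 2) (treeLaw r p i) ∧
      ∫ x, treeCount i t x j ^ 2 ∂(treeLaw r p i) ≤ C * Real.exp (2 * ρ * t) := by
  obtain ⟨B, hB0, hB⟩ := exists_sqMeanTrunc_le hr hmean hsq hρ hv0 hv
  refine ⟨B * v i / v j ^ 2, by have := hv0 i; have := hv0 j; positivity, fun t ht => ?_⟩
  have hmass : ∫⁻ x, aliveMass (fun l => ENNReal.ofReal (v l)) i t x ^ 2 ∂(treeLaw r p i) ≤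
      ENNReal.ofReal (B * v i * Real.exp (2 * ρ * t)) := by
    have h1 : ∀ x, aliveMass (fun l => ENNReal.ofReal (v l)) i t x ^ 2 =
        ⨆ n, aliveMassTrunc (fun l => ENNReal.ofReal (v l)) n i t x ^ 2 := fun x => by
      refine (tendsto_nhds_unique (tendsto_atTop_iSup fun m n h =>
        pow_le_pow_left₀ zero_le (aliveMassTrunc_mono _ i t h x) 2) ?_).symm
      rw [aliveMass_eq_iSup]
      exact ((ENNReal.continuous_pow 2).tendsto _).comp
        (tendsto_atTop_iSup fun m n h => aliveMassTrunc_mono _ i t h x)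
    simp_rw [h1]
    rw [lintegral_iSup (fun n => (measurable_aliveMassTrunc_right _ n i t).pow_const 2)
      fun m n h x => pow_le_pow_left₀ zero_le (aliveMassTrunc_mono _ i t h x) 2]
    exact iSup_le fun n => hB n i t ht
  have hlin : ∫⁻ x, ENNReal.ofReal (treeCount i t x j ^ 2) ∂(treeLaw r p i) ≤
      ENNReal.ofReal (B * v i / v j ^ 2 * Real.exp (2 * ρ * t)) := by
    have h2 : ENNReal.ofReal (B * v i / v j ^ 2 * Real.exp (2 * ρ * t)) =
        ENNReal.ofReal ((v j)⁻¹ ^ 2) * ENNReal.ofReal (B * v i * Real.exp (2 * ρ * t)) := by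
      rw [← ENNReal.ofReal_mul (sq_nonneg _)]
      congr 1
      field_simp
    rw [h2]
    refine le_trans ?_ (mul_le_mul_right hmass _)
    rw [← lintegral_const_mul' _ _ ENNReal.ofReal_ne_top]
    refine lintegral_mono_ae ?_
    filter_upwards [ofReal_treeCount_ae_eq hr hmean i j ht] with x hx
    rw [ENNReal.ofReal_pow (treeCount_nonneg i t x j), hx,
      ENNReal.ofReal_pow (inv_nonneg.2 (hv0 j).le), ← mul_pow]
    refine pow_le_pow_left₀ zero_le ?_ 2
    refine le_trans (le_of_eq ?_) (mul_le_mul_right (ofReal_mul_treeCount_le v i j t x) _)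
    rw [← mul_assoc, ← ENNReal.ofReal_mul (inv_nonneg.2 (hv0 j).le),
      inv_mul_cancel₀ (hv0 j).ne', ENNReal.ofReal_one, one_mul]
  have hm : AEStronglyMeasurable (fun x => treeCount i t x j ^ 2) (treeLaw r p i) :=
    (((measurable_pi_apply j).comp (measurable_treeCount i t)).pow_const 2).aestronglyMeasurable
  refine ⟨⟨hm, ?_⟩, ?_⟩
  · rw [hasFiniteIntegral_iff_ofReal (Eventually.of_forall fun x => sq_nonneg _)]
    exact hlin.trans_lt ENNReal.ofReal_lt_top
  · rw [integral_eq_lintegral_of_nonneg_ae (Eventually.of_forall fun x => sq_nonneg _) hm]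
    exact ENNReal.toReal_le_of_le_ofReal (by have := hv0 i; have := hv0 j; positivity) hlin

end TreeCount

/-! ### Generating functionals of the process with immigration -/

section Population

theorem integral_prod_infinitePi {E : Type*} [MeasurableSpace E] (ν : Measure E)
    [IsProbabilityMeasure ν] {g : ℕ → E → ℂ} (hg : ∀ n, Measurable (g n)) (N : ℕ) :
    ∫ X, ∏ n ∈ Finset.range N, g n (X n) ∂(Measure.infinitePi fun _ : ℕ => ν) =
      ∏ n ∈ Finset.range N, ∫ x, g n x ∂ν := by
  have hind : iIndepFun (fun (n : Finset.range N) (X : ℕ → E) => g n (X n))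
      (Measure.infinitePi fun _ : ℕ => ν) :=
    (iIndepFun_infinitePi (P := fun _ : ℕ => ν) (X := g) hg).precomp
      (g := fun n : Finset.range N => (n : ℕ)) Subtype.val_injective
  have h1 := hind.integral_fun_prod_eq_prod_integral
    fun n => ((hg n).comp (measurable_pi_apply _)).aestronglyMeasurable
  have h2 : ∀ n : ℕ, ∫ X, g n (X n) ∂(Measure.infinitePi fun _ : ℕ => ν) = ∫ x, g n x ∂ν :=
    fun n => (integral_map (measurable_pi_apply n).aemeasurable
      (hg n).aestronglyMeasurable).symm.trans
        (by rw [(measurePreserving_eval_infinitePi (fun _ : ℕ => ν) n).map_eq])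
  simp only [h2] at h1
  rw [← Finset.prod_coe_sort (Finset.range N) (fun n => ∫ x, g n x ∂ν), ← h1]
  exact integral_congr_ae (Eventually.of_forall fun X =>
    (Finset.prod_coe_sort (Finset.range N) (fun n => g n (X n))).symm)

theorem measurable_comp_uncurry {α β γ δ : Type*} [MeasurableSpace α] [MeasurableSpace β]
    [MeasurableSpace γ] [MeasurableSpace δ] {f : β → γ → δ} (hf : Measurable (Function.uncurry f))
    {a : α → β} {b : α → γ} (ha : Measurable a) (hb : Measurable b) :
    Measurable fun q => f (a q) (b q) :=
  hf.comp (ha.prodMk hb)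

theorem norm_cexp_sum_le_one {ι : Type*} [Fintype ι] {ζ : ι → ℂ} (hζ : ∀ j, (ζ j).re ≤ 0)
    {x : ι → ℝ} (hx : ∀ j, 0 ≤ x j) : ‖Complex.exp (∑ j, ζ j * (x j : ℂ))‖ ≤ 1 := by
  rw [Complex.norm_exp, Real.exp_le_one_iff, Complex.re_sum]
  refine Finset.sum_nonpos fun j _ => ?_
  rw [Complex.re_mul_ofReal]
  exact mul_nonpos_of_nonpos_of_nonneg (hζ j) (hx j)

theorem measurable_cexp_sum {ι : Type*} [Fintype ι] (ζ : ι → ℂ) :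
    Measurable fun x : ι → ℝ => Complex.exp (∑ j, ζ j * (x j : ℂ)) := by
  fun_prop

/-- The family trees of all immigrants. -/
def familyTrees {Ω : Type*} {k : ℕ} (L : ℕ → ParticleLabel k → Ω → ℝ)
    (Y : ℕ → ParticleLabel k → Ω → Fin k → ℕ) (ω : Ω) (n : ℕ) : FamilyTree k :=
  fun w => (L n w ω, Y n w ω)

theorem treePopulation_eq_treeCount {Ω : Type*} {k : ℕ} [NeZero k]
    (L : ℕ → ParticleLabel k → Ω → ℝ) (Y : ℕ → ParticleLabel k → Ω → Fin k → ℕ) (n : ℕ) (t : ℝ)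
    (ω : Ω) : treePopulation L Y n t ω = treeCount 0 t (familyTrees L Y ω n) := rfl

variable {Ω : Type*} [MeasurableSpace Ω] {P : Measure Ω} {k : ℕ} [NeZero k]
  {r : Fin k → ℝ} {p : Fin k → PMF (Fin k → ℕ)} {lam : ℝ → ℝ}
  {T : ℕ → Ω → ℝ} {L : ℕ → ParticleLabel k → Ω → ℝ} {Y : ℕ → ParticleLabel k → Ω → Fin k → ℕ}

namespace IsBranchingModel

theorem measurable_familyTrees (h : IsBranchingModel P r p lam T L Y) :
    Measurable (familyTrees L Y) :=
  measurable_pi_lambda _ fun n => measurable_pi_lambda _ fun w =>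
    (h.measurable_lifetime n w).prodMk (h.measurable_offspring n w)

theorem map_familyTrees [IsProbabilityMeasure P] (h : IsBranchingModel P r p lam T L Y)
    (hr : ∀ i, 0 < r i) :
    P.map (familyTrees L Y) = Measure.infinitePi fun _ : ℕ => treeLaw r p 0 := by
  have hp := fun i => isProbabilityMeasure_particleLaw hr p i
  have hm : Measurable fun ω (x : ℕ × ParticleLabel k) => (L x.1 x.2 ω, Y x.1 x.2 ω) :=
    measurable_pi_lambda _ fun x =>
      (h.measurable_lifetime x.1 x.2).prodMk (h.measurable_offspring x.1 x.2)
  have h1 := (iIndepFun.hasLaw_infinitePi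
    (μ := fun x : ℕ × ParticleLabel k => particleLaw r p (particleType 0 x.2))
    (fun x => h.law_particle x.1 x.2) h.indep_particles hm.aemeasurable).map_eq
  have h2 := Measure.infinitePi_map_curry
    (fun (_ : ℕ) (w : ParticleLabel k) => particleLaw r p (particleType 0 w))
  rw [← h1, Measure.map_map (MeasurableEquiv.measurable _) hm] at h2
  exact h2

theorem map_arrivals_familyTrees [IsProbabilityMeasure P] (h : IsBranchingModel P r p lam T L Y)
    (hr : ∀ i, 0 < r i) :
    P.map (fun ω => ((fun n => T n ω), familyTrees L Y ω)) =
      (P.map fun ω n => T n ω).prod (Measure.infinitePi fun _ : ℕ => treeLaw r p 0) := by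
  have hT : Measurable fun ω n => T n ω := measurable_pi_lambda _ h.arrivals.measurable
  rw [← h.map_familyTrees hr]
  refine IndepFun.map_prod_eq_prod_map_map hT.aemeasurable h.measurable_familyTrees.aemeasurable ?_
  exact h.indep_arrivals.comp measurable_id
    (MeasurableEquiv.curry ℕ (ParticleLabel k) (ℝ × (Fin k → ℕ))).measurable

theorem map_familyTrees_apply [IsProbabilityMeasure P] (h : IsBranchingModel P r p lam T L Y)
    (hr : ∀ i, 0 < r i) (n : ℕ) : P.map (fun ω => familyTrees L Y ω n) = treeLaw r p 0 := by
  have := isProbabilityMeasure_treeLaw hr p 0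
  rw [← (measurePreserving_eval_infinitePi (fun _ : ℕ => treeLaw r p 0) n).map_eq,
    ← h.map_familyTrees hr, Measure.map_map (measurable_pi_apply n) h.measurable_familyTrees]
  rfl

/-- Generating functional of the marked Poisson process of immigrants with their family trees. -/
theorem integral_prod [IsProbabilityMeasure P] (h : IsBranchingModel P r p lam T L Y)
    (hr : ∀ i, 0 < r i) (hpos : ∀ t, 0 ≤ t → 0 < lam t)
    (hint : LocallyIntegrableOn lam (Set.Ici 0)) {f : ℝ → FamilyTree k → ℂ}
    (hf : Measurable (Function.uncurry f)) (hf1 : ∀ y x, ‖f y x‖ ≤ 1) {t : ℝ} (ht : 0 < t) :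
    ∫ ω, ∏ n ∈ Finset.range (arrivalCount (fun m => T m ω) t),
        f (t - T n ω) (familyTrees L Y ω n) ∂P =
      Complex.exp (∫ y in 0..t, (lam (t - y) : ℂ) * (∫ x, f y x ∂(treeLaw r p 0) - 1)) := by
  have := isProbabilityMeasure_treeLaw hr p 0
  have hT : Measurable fun ω n => T n ω := measurable_pi_lambda _ h.arrivals.measurable
  have := Measure.isProbabilityMeasure_map hT.aemeasurable (μ := P)
  set G : ℝ → ℂ := fun s => ∫ x, f (t - s) x ∂(treeLaw r p 0) with hG
  have hGm : Measurable G := by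
    have : StronglyMeasurable fun q : ℝ × FamilyTree k => f (t - q.1) q.2 :=
      (measurable_comp_uncurry hf (measurable_const.sub measurable_fst)
        measurable_snd).stronglyMeasurable
    exact this.integral_prod_right.measurable
  have hG1 : ∀ s, ‖G s‖ ≤ 1 := fun s => by
    refine (norm_integral_le_of_norm_le_const (Eventually.of_forall (hf1 (t - s)))).trans ?_
    simp
  set F : (ℕ → ℝ) × (ℕ → FamilyTree k) → ℂ := fun q =>
    ∏ n ∈ Finset.range (arrivalCount q.1 t), f (t - q.1 n) (q.2 n) with hF
  have hFm : Measurable F := by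
    refine measurable_prod_range ((measurable_arrivalCount t).comp measurable_fst) fun n => ?_
    exact measurable_comp_uncurry hf
      (measurable_const.sub ((measurable_pi_apply n).comp measurable_fst))
      ((measurable_pi_apply n).comp measurable_snd)
  have hF1 : ∀ q, ‖F q‖ ≤ 1 := fun q => by
    rw [hF, norm_prod]
    exact Finset.prod_le_one (fun _ _ => norm_nonneg _) fun n _ => hf1 _ _
  have hjoint := integral_map (μ := P) (hT.prodMk h.measurable_familyTrees).aemeasurable
    (f := F) hFm.aestronglyMeasurable
  rw [h.map_arrivals_familyTrees hr, MeasureTheory.integral_prod _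
    (Integrable.of_bound hFm.aestronglyMeasurable 1 (Eventually.of_forall hF1))] at hjoint
  rw [← hjoint]
  -- For frozen arrival times the families are independent with common law, so the expectation is a
  -- product over arrivals of a single function `G`, to which the unmarked functional applies.
  have hinner : ∀ τ : ℕ → ℝ, ∫ X, F (τ, X) ∂(Measure.infinitePi fun _ : ℕ => treeLaw r p 0) =
      ∏ n ∈ Finset.range (arrivalCount τ t), G (τ n) := fun τ =>
    integral_prod_infinitePi (treeLaw r p 0) (g := fun n x => f (t - τ n) x)
      (fun n => hf.comp measurable_prodMk_left) (arrivalCount τ t)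
  simp_rw [hinner]
  rw [integral_map hT.aemeasurable (measurable_prod_range (measurable_arrivalCount t)
    (f := fun n τ => G (τ n)) fun n => hGm.comp (measurable_pi_apply n)).aestronglyMeasurable,
    h.arrivals.integral_prod hpos hint hGm hG1 ht,
    integral_intensityMeasure hpos hint ht.le]
  congr 1
  have := intervalIntegral.integral_comp_sub_left (a := 0) (b := t)
    (fun x => (lam x : ℂ) * (G x - 1)) t
  rw [sub_self, sub_zero] at this
  rw [← this]
  simp only [hG, sub_sub_cancel]

end IsBranchingModel

/-- The transform `E[exp ⟨ζ, N(y)⟩]` of the population at time `y` of a single family. -/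
noncomputable def treeTransform (r : Fin k → ℝ) (p : Fin k → PMF (Fin k → ℕ)) (ζ : Fin k → ℂ)
    (y : ℝ) : ℂ :=
  ∫ x, Complex.exp (∑ j, ζ j * (treeCount 0 y x j : ℂ)) ∂(treeLaw r p 0)

namespace IsBranchingModel

theorem measurable_population (h : IsBranchingModel P r p lam T L Y) (t : ℝ) :
    Measurable (population T L Y t) := by
  have hN := h.arrivals.measurable_arrivalCount_comp t
  have : population T L Y t = (fun q : Ω × ℕ => ∑ n ∈ Finset.range q.2,
      treeCount 0 (t - T n q.1) (familyTrees L Y q.1 n)) ∘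
      fun ω => (ω, arrivalCount (fun m => T m ω) t) := rfl
  rw [this]
  refine Measurable.comp (measurable_from_prod_countable_left fun N => ?_) (measurable_id.prodMk hN)
  have h1 : ∀ n, Measurable fun ω => treeCount 0 (t - T n ω) (familyTrees L Y ω n) := fun n =>
    measurable_comp_uncurry (measurable_treeCount_prod 0)
      (measurable_const.sub (h.arrivals.measurable n))
      ((measurable_pi_apply n).comp h.measurable_familyTrees)
  exact Finset.measurable_fun_sum (Finset.range N) fun n _ => h1 n

/-- The exponential of the total population is the product over immigrants of the exponentials of
their families. Complex `ζ` cover Laplace and Fourier transforms at once. -/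
theorem integral_cexp_population [IsProbabilityMeasure P] (h : IsBranchingModel P r p lam T L Y)
    (hr : ∀ i, 0 < r i) (hpos : ∀ t, 0 ≤ t → 0 < lam t)
    (hint : LocallyIntegrableOn lam (Set.Ici 0)) {ζ : Fin k → ℂ} (hζ : ∀ j, (ζ j).re ≤ 0)
    {t : ℝ} (ht : 0 < t) :
    ∫ ω, Complex.exp (∑ j, ζ j * (population T L Y t ω j : ℂ)) ∂P =
      Complex.exp (∫ y in 0..t, (lam (t - y) : ℂ) * (treeTransform r p ζ y - 1)) := by
  unfold treeTransform
  rw [← h.integral_prod hr hpos hint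
    (f := fun y x => Complex.exp (∑ j, ζ j * (treeCount 0 y x j : ℂ)))
    ((measurable_cexp_sum ζ).comp (measurable_treeCount_prod 0))
    (fun y x => norm_cexp_sum_le_one hζ (treeCount_nonneg 0 y x)) ht]
  refine integral_congr_ae (Eventually.of_forall fun ω => ?_)
  simp only [← Complex.exp_sum, population, Finset.sum_apply, Complex.ofReal_sum, Finset.mul_sum,
    treePopulation_eq_treeCount]
  rw [Finset.sum_comm]

theorem vectorLaplace_treePopulation [IsProbabilityMeasure P]
    (h : IsBranchingModel P r p lam T L Y) (hr : ∀ i, 0 < r i) (n : ℕ) (y : ℝ) (s : Fin k → ℝ) :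
    (vectorLaplace P (treePopulation L Y n y) s : ℂ) = treeTransform r p (fun j => s j) y := by
  have hm : Measurable fun x : FamilyTree k => Real.exp (s ⬝ᵥ treeCount 0 y x) := by
    have := measurable_treeCount (k := k) 0 y
    simp only [dotProduct]
    fun_prop
  rw [treeTransform, vectorLaplace, ← h.map_familyTrees_apply hr n]
  have h1 := integral_map (μ := P)
    ((measurable_pi_apply n).comp h.measurable_familyTrees).aemeasurable
    (f := fun x : FamilyTree k => Real.exp (s ⬝ᵥ treeCount 0 y x)) hm.aestronglyMeasurable
  refine (congrArg _ h1.symm).trans ?_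
  rw [← integral_complex_ofReal]
  simp [dotProduct, Function.comp_def]

end IsBranchingModel

end Population

/-! ### Limits of convolution integrals -/

section Convolution

theorem intervalIntegrable_comp_sub_mul {ℓ : ℝ → ℝ} {t : ℝ} (ht : 0 ≤ t)
    (hint : IntervalIntegrable ℓ volume 0 t) {q : ℝ → ℂ} (hqm : Measurable q) {K : ℝ}
    (hq : ∀ y, 0 < y → y ≤ t → ‖q y‖ ≤ K) :
    IntervalIntegrable (fun y => (ℓ (t - y) : ℂ) * q y) volume 0 t := by
  have h1 : IntervalIntegrable (fun y => ℓ (t - y)) volume 0 t := by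
    have := (hint.comp_sub_left t).symm
    rwa [sub_self, sub_zero] at this
  rw [intervalIntegrable_iff_integrableOn_Ioc_of_le ht] at h1 ⊢
  refine Integrable.mul_bdd (c := K) h1.ofReal hqm.aestronglyMeasurable ?_
  exact (ae_restrict_iff' measurableSet_Ioc).2 (Eventually.of_forall fun y hy => hq y hy.1 hy.2)

/-- Choose `t₁` beyond which ℓ is bounded. For y ≤ t - t₁ the decay of `q` allows dominated
convergence. On the last stretch ℓ is merely integrable, so that part is estimated separately. -/
theorem tendsto_integral_comp_sub_mul {ℓ : ℝ → ℝ} {c : ℝ} (hℓ : Tendsto ℓ atTop (𝓝 c))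
    (hint : ∀ t, 0 ≤ t → IntervalIntegrable ℓ volume 0 t) {q : ℝ → ℝ → ℂ} {Q : ℝ → ℂ} {C γ : ℝ}
    (hγ : 0 < γ) (hqm : ∀ t, Measurable (q t))
    (hq : ∀ t y, 0 < y → ‖q t y‖ ≤ C * Real.exp (-(γ * y)))
    (hlim : ∀ y, 0 < y → Tendsto (fun t => q t y) atTop (𝓝 (Q y))) :
    Tendsto (fun t => ∫ y in 0..t, (ℓ (t - y) : ℂ) * q t y) atTop
      (𝓝 (c * ∫ y in Set.Ioi (0 : ℝ), Q y)) := by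
  have hC : 0 ≤ C := by
    have := (norm_nonneg _).trans (hq 0 1 one_pos)
    exact nonneg_of_mul_nonneg_left this (Real.exp_pos _)
  have hqC : ∀ t y, 0 < y → ‖q t y‖ ≤ C := fun t y hy => by
    refine (hq t y hy).trans (mul_le_of_le_one_right hC (Real.exp_le_one_iff.2 ?_))
    have := mul_pos hγ hy
    linarith
  obtain ⟨t₁, ht₁, hb⟩ : ∃ t₁, 0 ≤ t₁ ∧ ∀ x, t₁ ≤ x → |ℓ x| ≤ |c| + 1 := by
    have h := hℓ.abs.eventually (eventually_le_nhds (lt_add_one |c|))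
    obtain ⟨t₁, h1⟩ := eventually_atTop.1 (h.and (eventually_ge_atTop 0))
    exact ⟨t₁, (h1 t₁ le_rfl).2, fun x hx => (h1 x hx).1⟩
  have hii : ∀ t, 0 ≤ t → IntervalIntegrable (fun y => (ℓ (t - y) : ℂ) * q t y) volume 0 t :=
    fun t ht => intervalIntegrable_comp_sub_mul ht (hint t ht) (hqm t) fun y hy _ => hqC t y hy
  have hA : Tendsto (fun t => ∫ y in Set.Ioi (0 : ℝ),
      (Set.Iic (t - t₁)).indicator (fun y => (ℓ (t - y) : ℂ) * q t y) y) atTop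
      (𝓝 (∫ y in Set.Ioi (0 : ℝ), (c : ℂ) * Q y)) := by
    refine tendsto_integral_filter_of_dominated_convergence
      (fun y => (|c| + 1) * (C * Real.exp (-(γ * y)))) ?_ ?_ ?_ ?_
    · filter_upwards [eventually_ge_atTop t₁] with t ht
      rw [aestronglyMeasurable_indicator_iff measurableSet_Iic,
        Measure.restrict_restrict measurableSet_Iic]
      have := ((intervalIntegrable_iff_integrableOn_Ioc_of_le (ht₁.trans ht)).1
        (hii t (ht₁.trans ht))).aestronglyMeasurable
      refine this.mono_measure (Measure.restrict_mono ?_ le_rfl)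
      intro y hy
      exact ⟨hy.2, by have := hy.1; simp only [Set.mem_Iic] at this; linarith⟩
    · refine Eventually.of_forall fun t => (ae_restrict_iff' measurableSet_Ioi).2
        (Eventually.of_forall fun y hy => ?_)
      by_cases h : y ≤ t - t₁
      · rw [Set.indicator_of_mem (Set.mem_Iic.2 h), norm_mul, Complex.norm_real, Real.norm_eq_abs]
        exact mul_le_mul (hb _ (by linarith)) (hq t y hy) (norm_nonneg _) (by positivity)
      · rw [Set.indicator_of_notMem (by simpa using h), norm_zero]
        positivity
    · have := (exp_neg_integrableOn_Ioi 0 hγ).const_mul C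
      simpa [neg_mul] using this.const_mul (|c| + 1)
    · refine (ae_restrict_iff' measurableSet_Ioi).2 (Eventually.of_forall fun y hy => ?_)
      have h1 : Tendsto (fun t => (ℓ (t - y) : ℂ) * q t y) atTop (𝓝 ((c : ℂ) * Q y)) :=
        ((Complex.continuous_ofReal.tendsto c).comp
          (hℓ.comp (tendsto_atTop_add_const_right _ (-y) tendsto_id))).mul (hlim y hy)
      refine h1.congr' ?_
      filter_upwards [eventually_ge_atTop (y + t₁)] with t ht
      rw [Set.indicator_of_mem (Set.mem_Iic.2 (by linarith))]
  -- Here `q` is at most C e^{-γ(t-t₁)}, while |ℓ| has the fixed integral over [0, t₁].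
  have hB : Tendsto (fun t => ∫ y in (t - t₁)..t, (ℓ (t - y) : ℂ) * q t y) atTop (𝓝 0) := by
    have h0 : Tendsto (fun t => C * Real.exp (-(γ * (t - t₁))) * ∫ x in 0..t₁, |ℓ x|) atTop
        (𝓝 (C * 0 * ∫ x in 0..t₁, |ℓ x|)) := by
      refine ((Real.tendsto_exp_atBot.comp ?_).const_mul C).mul_const _
      refine tendsto_neg_atTop_atBot.comp (Tendsto.const_mul_atTop hγ ?_)
      exact tendsto_atTop_add_const_right _ (-t₁) tendsto_id
    rw [mul_zero, zero_mul] at h0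
    refine squeeze_zero_norm' ?_ h0
    filter_upwards [eventually_gt_atTop t₁] with t ht
    have h1 : ∫ y in (t - t₁)..t, C * Real.exp (-(γ * (t - t₁))) * |ℓ (t - y)| =
        C * Real.exp (-(γ * (t - t₁))) * ∫ x in 0..t₁, |ℓ x| := by
      rw [intervalIntegral.integral_const_mul,
        intervalIntegral.integral_comp_sub_left (fun x => |ℓ x|) t, sub_self, sub_sub_cancel]
    rw [← h1]
    refine intervalIntegral.norm_integral_le_of_norm_le (by linarith)
      (Eventually.of_forall fun y hy => ?_) ?_
    · rw [norm_mul, Complex.norm_real, Real.norm_eq_abs, mul_comm]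
      refine mul_le_mul_of_nonneg_right ((hq t y (by linarith [hy.1])).trans ?_) (abs_nonneg _)
      gcongr
      exact hy.1.le
    · have := ((hint t₁ ht₁).abs.comp_sub_left t).symm
      rw [sub_zero] at this
      exact this.const_mul _
  rw [← integral_const_mul, ← add_zero (∫ y in Set.Ioi (0 : ℝ), _)]
  refine (hA.add hB).congr' ?_
  filter_upwards [eventually_ge_atTop t₁] with t ht
  have h1 : Set.Iic (t - t₁) ∩ Set.Ioi 0 = Set.Ioc 0 (t - t₁) := by
    rw [Set.inter_comm, Set.Ioi_inter_Iic]
  rw [integral_indicator measurableSet_Iic, Measure.restrict_restrict measurableSet_Iic, h1,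
    ← intervalIntegral.integral_of_le (by linarith)]
  have h2 := hii t (ht₁.trans ht)
  refine intervalIntegral.integral_add_adjacent_intervals (h2.mono_set ?_) (h2.mono_set ?_)
  · rw [Set.uIcc_of_le (by linarith), Set.uIcc_of_le (by linarith)]
    exact Set.Icc_subset_Icc_right (by linarith)
  · rw [Set.uIcc_of_le (by linarith), Set.uIcc_of_le (by linarith)]
    exact Set.Icc_subset_Icc_left (by linarith)

theorem tendsto_average_abs_zero {g : ℝ → ℝ} (hg : Tendsto g atTop (𝓝 0))
    (hint : ∀ t, 0 ≤ t → IntervalIntegrable g volume 0 t) :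
    Tendsto (fun t => t⁻¹ * ∫ x in 0..t, |g x|) atTop (𝓝 0) := by
  rw [Metric.tendsto_atTop]
  intro ε hε
  obtain ⟨t₁, h1⟩ := eventually_atTop.1 ((hg.abs.eventually
    (eventually_le_nhds (show |(0 : ℝ)| < ε / 2 by simpa using hε))).and (eventually_gt_atTop 0))
  have ht₁ : 0 < t₁ := (h1 t₁ le_rfl).2
  set D := ∫ x in 0..t₁, |g x| with hD
  have hD0 : 0 ≤ D := intervalIntegral.integral_nonneg ht₁.le fun _ _ => abs_nonneg _
  refine ⟨max t₁ (2 * D / ε + 1), fun t ht => ?_⟩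
  have htt : t₁ ≤ t := (le_max_left _ _).trans ht
  have ht0 : 0 < t := ht₁.trans_le htt
  have hi := (hint t ht0.le).abs
  have hi1 : IntervalIntegrable (fun x => |g x|) volume 0 t₁ := (hint t₁ ht₁.le).abs
  have hi2 : IntervalIntegrable (fun x => |g x|) volume t₁ t := hi1.symm.trans hi
  have h2 : ∫ x in t₁..t, |g x| ≤ ε / 2 * (t - t₁) := by
    have h3 : ∫ _ in t₁..t, ε / 2 = ε / 2 * (t - t₁) := by
      rw [intervalIntegral.integral_const, smul_eq_mul, mul_comm]
    rw [← h3]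
    exact intervalIntegral.integral_mono_on htt hi2 intervalIntegrable_const
      fun x hx => (h1 x hx.1).1
  have h4 : ∫ x in 0..t, |g x| = D + ∫ x in t₁..t, |g x| :=
    (intervalIntegral.integral_add_adjacent_intervals hi1 hi2).symm
  have h5 : 0 ≤ ∫ x in 0..t, |g x| := intervalIntegral.integral_nonneg ht0.le fun _ _ => abs_nonneg _
  rw [Real.dist_0_eq_abs, abs_of_nonneg (mul_nonneg (inv_nonneg.2 ht0.le) h5), inv_mul_lt_iff₀ ht0]
  have h6 : 2 * D / ε < t := by
    have := (le_max_right _ _).trans ht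
    linarith
  rw [div_lt_iff₀ hε] at h6
  nlinarith

/-- Write ℓ q - c m/t = (ℓ - c) q + c (q - m/t). Since `q` is O(1/t), the first term is controlled
by the Cesàro mean of |ℓ - c|; the second is O(1/t²) on an interval of length t. What remains is c
times the average of `m`. -/
theorem tendsto_integral_comp_sub_mul_average {ℓ : ℝ → ℝ} {c : ℝ} (hℓ : Tendsto ℓ atTop (𝓝 c))
    (hint : ∀ t, 0 ≤ t → IntervalIntegrable ℓ volume 0 t) {q : ℝ → ℝ → ℂ} {m : ℝ → ℝ}
    {C K l : ℝ} (hqm : ∀ t, Measurable (q t)) (hm : Continuous m)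
    (hmK : ∀ y, 0 ≤ y → |m y| ≤ K)
    (hq : ∀ t y, 0 < t → 0 < y → y ≤ t → ‖q t y - (m y / t : ℝ)‖ ≤ C / t ^ 2)
    (hlim : Tendsto (fun t => t⁻¹ * ∫ y in 0..t, m y) atTop (𝓝 l)) :
    Tendsto (fun t => ∫ y in 0..t, (ℓ (t - y) : ℂ) * q t y) atTop (𝓝 ((c * l : ℝ) : ℂ)) := by
  have hmain : Tendsto (fun t => (∫ y in 0..t, (ℓ (t - y) : ℂ) * q t y) -
      ((c * (t⁻¹ * ∫ y in 0..t, m y) : ℝ) : ℂ)) atTop (𝓝 0) := by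
    have hc : Tendsto (fun x => ℓ x - c) atTop (𝓝 0) := by
      simpa using hℓ.sub_const c
    have hci : ∀ t, 0 ≤ t → IntervalIntegrable (fun x => ℓ x - c) volume 0 t :=
      fun t ht => (hint t ht).sub intervalIntegrable_const
    have hav := tendsto_average_abs_zero hc hci
    have hinv : Tendsto (fun t : ℝ => C * t⁻¹) atTop (𝓝 0) := by
      simpa using tendsto_inv_atTop_zero.const_mul C
    have h0 : Tendsto (fun t : ℝ => (C * t⁻¹ + K) * (t⁻¹ * ∫ x in 0..t, |ℓ x - c|) +
        |c| * (C * t⁻¹)) atTop (𝓝 ((0 + K) * 0 + |c| * 0)) :=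
      ((hinv.add_const K).mul hav).add (hinv.const_mul |c|)
    rw [mul_zero, mul_zero, add_zero] at h0
    refine squeeze_zero_norm' ?_ h0
    filter_upwards [eventually_gt_atTop 0] with t ht
    have hmt : IntervalIntegrable (fun y => ((c * (t⁻¹ * m y) : ℝ) : ℂ)) volume 0 t :=
      (Complex.continuous_ofReal.comp (by fun_prop)).intervalIntegrable _ _
    have hqb : ∀ y, 0 < y → y ≤ t → ‖q t y‖ ≤ C / t ^ 2 + K / t := fun y hy hyt => by
      have h1 : q t y = (q t y - (m y / t : ℝ)) + (m y / t : ℝ) := by ring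
      rw [h1]
      refine (norm_add_le _ _).trans (add_le_add (hq t y ht hy hyt) ?_)
      rw [Complex.norm_real, Real.norm_eq_abs, abs_div, abs_of_pos ht]
      exact div_le_div_of_nonneg_right (hmK y hy.le) ht.le
    have h1 : (∫ y in 0..t, (ℓ (t - y) : ℂ) * q t y) - ((c * (t⁻¹ * ∫ y in 0..t, m y) : ℝ) : ℂ) =
        ∫ y in 0..t, ((ℓ (t - y) : ℂ) * q t y - ((c * (t⁻¹ * m y) : ℝ) : ℂ)) := by
      rw [intervalIntegral.integral_sub
        (intervalIntegrable_comp_sub_mul ht.le (hint t ht.le) (hqm t) hqb) hmt,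
        intervalIntegral.integral_ofReal, intervalIntegral.integral_const_mul,
        intervalIntegral.integral_const_mul]
    have h2 : ∫ y in 0..t, ((C / t ^ 2 + K / t) * |ℓ (t - y) - c| + |c| * (C / t ^ 2)) =
        (C * t⁻¹ + K) * (t⁻¹ * ∫ x in 0..t, |ℓ x - c|) + |c| * (C * t⁻¹) := by
      have h3 := intervalIntegral.integral_comp_sub_left (a := 0) (b := t)
        (fun x => |ℓ x - c|) t
      rw [sub_self, sub_zero] at h3
      have h4 := ((hci t ht.le).abs.comp_sub_left t).symm
      rw [sub_self, sub_zero] at h4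
      rw [intervalIntegral.integral_add (h4.const_mul _) intervalIntegrable_const,
        intervalIntegral.integral_const_mul, h3, intervalIntegral.integral_const]
      simp only [sub_zero, smul_eq_mul]
      field_simp
    rw [h1, ← h2]
    refine intervalIntegral.norm_integral_le_of_norm_le ht.le
      (Eventually.of_forall fun y hy => ?_) ?_
    · have h5 : (ℓ (t - y) : ℂ) * q t y - ((c * (t⁻¹ * m y) : ℝ) : ℂ) =
          ((ℓ (t - y) - c : ℝ) : ℂ) * q t y + (c : ℂ) * (q t y - (m y / t : ℝ)) := by
        push_cast
        ring
      rw [h5]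
      refine (norm_add_le _ _).trans (add_le_add ?_ ?_)
      · rw [norm_mul, Complex.norm_real, Real.norm_eq_abs, mul_comm]
        exact mul_le_mul_of_nonneg_right (hqb y hy.1 hy.2) (abs_nonneg _)
      · rw [norm_mul, Complex.norm_real, Real.norm_eq_abs]
        exact mul_le_mul_of_nonneg_left (hq t y ht hy.1 hy.2) (abs_nonneg _)
    · have h4 := ((hci t ht.le).abs.comp_sub_left t).symm
      rw [sub_self, sub_zero] at h4
      exact (h4.const_mul _).add intervalIntegrable_const
  have h := hmain.add ((Complex.continuous_ofReal.tendsto _).comp (hlim.const_mul c))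
  rw [zero_add] at h
  refine h.congr fun t => ?_
  simp only [Function.comp_apply, sub_add_cancel]

end Convolution

/-! ### Convergence in probability from Laplace transforms -/

section ConvergenceInProbability

theorem exp_neg_mul_one_sub_le {x y ε : ℝ} (h : ε ≤ |y - x|) :
    Real.exp (-x) * (1 - Real.exp (-ε)) ≤ |Real.exp (-y) - Real.exp (-x)| := by
  rcases le_abs.1 h with h1 | h1
  · have h2 : Real.exp (-y) ≤ Real.exp (-x) * Real.exp (-ε) := by
      rw [← Real.exp_add]
      exact Real.exp_le_exp.2 (by linarith)
    rw [abs_sub_comm]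
    exact le_trans (by linarith) (le_abs_self _)
  · have h2 : Real.exp (-x) * Real.exp ε ≤ Real.exp (-y) := by
      rw [← Real.exp_add]
      exact Real.exp_le_exp.2 (by linarith)
    refine le_trans ?_ (le_abs_self _)
    have h3 : 2 ≤ Real.exp ε + Real.exp (-ε) := by
      linarith [Real.add_one_le_exp ε, Real.add_one_le_exp (-ε)]
    nlinarith [Real.exp_pos (-x)]

variable {Ω : Type*} [MeasurableSpace Ω] {P : Measure Ω} [IsProbabilityMeasure P]

/-- The two limits give E(e^{-X} - e^{-x})² → 0. A deviation of `X` from `x` by ε moves e^{-X} by at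
least the constant `c`, so Markov's inequality for the square concludes. -/
theorem tendsto_measureReal_of_tendsto_laplace {ι : Type*} {l : Filter ι} {X : ι → Ω → ℝ}
    (hX : ∀ t, Measurable (X t)) (hX0 : ∀ᶠ t in l, ∀ ω, 0 ≤ X t ω) {x : ℝ}
    (h1 : Tendsto (fun t => ∫ ω, Real.exp (-X t ω) ∂P) l (𝓝 (Real.exp (-x))))
    (h2 : Tendsto (fun t => ∫ ω, Real.exp (-(2 * X t ω)) ∂P) l (𝓝 (Real.exp (-(2 * x)))))
    {ε : ℝ} (hε : 0 < ε) : Tendsto (fun t => P.real {ω | ε ≤ |X t ω - x|}) l (𝓝 0) := by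
  set c := Real.exp (-x) * (1 - Real.exp (-ε)) with hc
  have hc0 : 0 < c := mul_pos (Real.exp_pos _)
    (sub_pos.2 (by simpa using hε))
  have h3 : Tendsto (fun t => (c ^ 2)⁻¹ * (∫ ω, Real.exp (-(2 * X t ω)) ∂P -
      2 * Real.exp (-x) * ∫ ω, Real.exp (-X t ω) ∂P + Real.exp (-(2 * x)))) l
      (𝓝 ((c ^ 2)⁻¹ * (Real.exp (-(2 * x)) - 2 * Real.exp (-x) * Real.exp (-x) +
        Real.exp (-(2 * x))))) :=
    ((h2.sub (h1.const_mul _)).add_const _).const_mul _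
  have hsq : ∀ a : ℝ, Real.exp (-(2 * a)) = Real.exp (-a) ^ 2 := fun a => by
    rw [← Real.exp_nat_mul]; congr 1; push_cast; ring
  have h4 : (c ^ 2)⁻¹ * (Real.exp (-(2 * x)) - 2 * Real.exp (-x) * Real.exp (-x) +
        Real.exp (-(2 * x))) = 0 := by rw [hsq]; ring
  rw [h4] at h3
  refine squeeze_zero' (Eventually.of_forall fun _ => measureReal_nonneg) ?_ h3
  filter_upwards [hX0] with t ht
  have hi : ∀ θ : ℝ, 0 ≤ θ → Integrable (fun ω => Real.exp (-(θ * X t ω))) P := fun θ hθ =>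
    Integrable.of_bound (by have := hX t; fun_prop) 1 (Eventually.of_forall fun ω => by
      rw [Real.norm_eq_abs, Real.abs_exp, Real.exp_le_one_iff]
      have := mul_nonneg hθ (ht ω)
      linarith)
  have hi1 : Integrable (fun ω => Real.exp (-X t ω)) P := by simpa using hi 1 zero_le_one
  have hi2 := hi 2 zero_le_two
  have h6 : ∀ ω, (Real.exp (-X t ω) - Real.exp (-x)) ^ 2 = Real.exp (-(2 * X t ω)) -
      2 * Real.exp (-x) * Real.exp (-X t ω) + Real.exp (-(2 * x)) := fun ω => by
    rw [hsq, hsq]; ring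
  have hi3 : Integrable (fun ω => Real.exp (-(2 * X t ω)) -
      2 * Real.exp (-x) * Real.exp (-X t ω)) P := hi2.sub (hi1.const_mul _)
  have h5 : ∫ ω, (Real.exp (-X t ω) - Real.exp (-x)) ^ 2 ∂P =
      ∫ ω, Real.exp (-(2 * X t ω)) ∂P -
      2 * Real.exp (-x) * ∫ ω, Real.exp (-X t ω) ∂P + Real.exp (-(2 * x)) := by
    simp_rw [h6]
    rw [integral_add hi3 (integrable_const _), integral_sub hi2 (hi1.const_mul _),
      integral_const_mul]
    simp
  rw [← h5, ← div_eq_inv_mul, le_div_iff₀ (by positivity), mul_comm]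
  have h7 : Integrable (fun ω => (Real.exp (-X t ω) - Real.exp (-x)) ^ 2) P := by
    simp_rw [h6]
    exact hi3.add (integrable_const _)
  refine le_trans ?_ (mul_meas_ge_le_integral_of_nonneg (Eventually.of_forall fun ω => sq_nonneg _)
    h7 (c ^ 2))
  refine mul_le_mul_of_nonneg_left (measureReal_mono ?_) (by positivity)
  intro ω hω
  have h8 := exp_neg_mul_one_sub_le hω
  have h9 := pow_le_pow_left₀ hc0.le h8 2
  rwa [sq_abs] at h9

theorem tendstoInMeasure_const_of_tendsto_laplace {ι κ : Type*} [Fintype κ] {l : Filter ι}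
    {X : ι → Ω → κ → ℝ}
    (hX : ∀ t, Measurable (X t)) (hX0 : ∀ᶠ t in l, ∀ ω j, 0 ≤ X t ω j) {x : κ → ℝ}
    (h : ∀ j (θ : ℝ), 0 < θ → Tendsto (fun t => ∫ ω, Real.exp (-(θ * X t ω j)) ∂P) l
      (𝓝 (Real.exp (-(θ * x j))))) : TendstoInMeasure P X l fun _ => x := by
  rw [tendstoInMeasure_iff_measureReal_norm]
  intro ε hε
  have h1 : Tendsto (fun t => ∑ j, P.real {ω | ε ≤ |X t ω j - x j|}) l (𝓝 (∑ _j : κ, 0)) := by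
    refine tendsto_finsetSum _ fun j _ => tendsto_measureReal_of_tendsto_laplace
      (fun t => (measurable_pi_apply j).comp (hX t)) (hX0.mono fun t ht ω => ht ω j)
      ?_ (h j 2 two_pos) hε
    simpa using h j 1 one_pos
  rw [Finset.sum_const_zero] at h1
  refine squeeze_zero (fun _ => measureReal_nonneg) (fun t => ?_) h1
  refine le_trans (measureReal_mono ?_) (measureReal_iUnion_fintype_le _)
  intro ω hω
  rw [Set.mem_iUnion]
  by_contra! hcon
  refine absurd (show ε ≤ ‖X t ω - x‖ from hω) (not_le.2 ((pi_norm_lt_iff hε).2 fun j => ?_))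
  have := hcon j
  exact not_le.1 this

end ConvergenceInProbability

/-! ### Estimates for the transform of one family -/

section Transform

variable {k : ℕ} [NeZero k] {r : Fin k → ℝ} {p : Fin k → PMF (Fin k → ℕ)}

/-- Mean value inequality on the closed left half-plane, which is convex and where |exp| ≤ 1. -/
theorem norm_cexp_sub_one_le {z : ℂ} (hz : z.re ≤ 0) : ‖Complex.exp z - 1‖ ≤ ‖z‖ := by
  have h := (convex_halfSpace_re_le 0).norm_image_sub_le_of_norm_hasDerivWithin_le
    (f := Complex.exp) (f' := Complex.exp) (C := 1) (x := 0) (y := z)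
    (fun x _ => (Complex.hasDerivAt_exp x).hasDerivWithinAt)
    (fun x hx => by rw [Complex.norm_exp, Real.exp_le_one_iff]; exact hx) (by simp) hz
  simpa using h

theorem norm_cexp_sum_sub_one_le {ι : Type*} [Fintype ι] {ζ : ι → ℂ} (hζ : ∀ j, (ζ j).re ≤ 0)
    {x : ι → ℝ} (hx : ∀ j, 0 ≤ x j) :
    ‖Complex.exp (∑ j, ζ j * (x j : ℂ)) - 1‖ ≤ ∑ j, ‖ζ j‖ * x j := by
  refine (norm_cexp_sub_one_le ?_).trans ((norm_sum_le _ _).trans (le_of_eq ?_))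
  · rw [Complex.re_sum]
    refine Finset.sum_nonpos fun j _ => ?_
    rw [Complex.re_mul_ofReal]
    exact mul_nonpos_of_nonpos_of_nonneg (hζ j) (hx j)
  · refine Finset.sum_congr rfl fun j _ => ?_
    rw [norm_mul, Complex.norm_real, Real.norm_eq_abs, abs_of_nonneg (hx j)]

theorem measurable_treeTransform (hr : ∀ i, 0 < r i) (ζ : Fin k → ℂ) :
    Measurable (treeTransform r p ζ) := by
  have := isProbabilityMeasure_treeLaw hr p 0
  have h : StronglyMeasurable fun q : ℝ × FamilyTree k =>
      Complex.exp (∑ j, ζ j * (treeCount 0 q.1 q.2 j : ℂ)) :=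
    ((measurable_cexp_sum ζ).comp (measurable_treeCount_prod 0)).stronglyMeasurable
  exact h.integral_prod_right.measurable

theorem treeTransform_sub_one (hr : ∀ i, 0 < r i) {ζ : Fin k → ℂ} (hζ : ∀ j, (ζ j).re ≤ 0)
    (y : ℝ) : treeTransform r p ζ y - 1 =
      ∫ x, (Complex.exp (∑ j, ζ j * (treeCount 0 y x j : ℂ)) - 1) ∂(treeLaw r p 0) := by
  have := isProbabilityMeasure_treeLaw hr p 0
  rw [integral_sub _ (integrable_const _)]
  · simp [treeTransform]
  · exact Integrable.of_bound
      ((measurable_cexp_sum ζ).comp (measurable_treeCount 0 y)).aestronglyMeasurable 1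
      (Eventually.of_forall fun x => norm_cexp_sum_le_one hζ (treeCount_nonneg 0 y x))

theorem norm_treeTransform_sub_one_le (hr : ∀ i, 0 < r i)
    (hmean : ∀ i j, Integrable (fun n : Fin k → ℕ => (n j : ℝ)) (p i).toMeasure)
    {ζ : Fin k → ℂ} (hζ : ∀ j, (ζ j).re ≤ 0) {y : ℝ} (hy : 0 ≤ y) :
    ‖treeTransform r p ζ y - 1‖ ≤
      ∑ j, ‖ζ j‖ * NormedSpace.exp (y • meanGenerator r p) j 0 := by
  rw [treeTransform_sub_one hr hζ]
  have hi : ∀ j, Integrable (fun x => ‖ζ j‖ * treeCount 0 y x j) (treeLaw r p 0) :=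
    fun j => (integrable_treeCount hr hmean 0 j hy).const_mul _
  refine (norm_integral_le_of_norm_le (integrable_finsetSum _ fun j _ => hi j)
    (Eventually.of_forall fun x => norm_cexp_sum_sub_one_le hζ (treeCount_nonneg 0 y x))).trans
    (le_of_eq ?_)
  rw [integral_finsetSum _ fun j _ => hi j]
  refine Finset.sum_congr rfl fun j _ => ?_
  rw [integral_const_mul, integral_treeCount hr hmean 0 j hy]

theorem sum_single_mul {ι : Type*} [Fintype ι] [DecidableEq ι] (j : ι) (η : ℝ) (x : ι → ℝ) :
    ∑ i, (Pi.single j (-(η : ℂ)) : ι → ℂ) i * (x i : ℂ) = ((-(η * x j) : ℝ) : ℂ) := by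
  simp [Pi.single_apply, ite_mul]

theorem re_single_nonpos {ι : Type*} [DecidableEq ι] (j : ι) {η : ℝ} (hη : 0 ≤ η) (i : ι) :
    ((Pi.single j (-(η : ℂ)) : ι → ℂ) i).re ≤ 0 := by
  rcases eq_or_ne i j with rfl | h
  · simpa using hη
  · simp [h]

theorem treeTransform_single_sub_one (hr : ∀ i, 0 < r i) (j : Fin k) {η : ℝ} (hη : 0 ≤ η) (y : ℝ) :
    treeTransform r p (Pi.single j (-(η : ℂ))) y - 1 =
      ((∫ x, (Real.exp (-(η * treeCount 0 y x j)) - 1) ∂(treeLaw r p 0) : ℝ) : ℂ) := by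
  rw [treeTransform_sub_one hr (re_single_nonpos j hη), ← integral_complex_ofReal]
  simp only [sum_single_mul]
  push_cast
  rfl

theorem abs_exp_neg_sub_one_le {z : ℝ} (hz : 0 ≤ z) : |Real.exp (-z) - 1| ≤ z := by
  rw [abs_sub_comm, abs_of_nonneg (by simpa using hz)]
  linarith [Real.add_one_le_exp (-z)]

theorem abs_exp_neg_sub_one_add_le {z : ℝ} (hz : 0 ≤ z) : |Real.exp (-z) - 1 + z| ≤ z ^ 2 := by
  rw [abs_of_nonneg (by linarith [Real.add_one_le_exp (-z)])]
  have h1 : Real.exp (-z) * (1 + z) ≤ 1 := by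
    have := mul_le_mul_of_nonneg_left (Real.add_one_le_exp z) (Real.exp_pos (-z)).le
    rw [← Real.exp_add, neg_add_cancel, Real.exp_zero] at this
    linarith
  have h2 : Real.exp (-z) ≤ 1 / (1 + z) := by
    rw [le_div_iff₀ (by linarith)]
    exact h1
  have h3 : 1 / (1 + z) ≤ 1 - z + z ^ 2 := by
    rw [div_le_iff₀ (by linarith)]
    nlinarith [pow_nonneg hz 3]
  linarith

theorem tendsto_inv_mul_exp_sub_one (a : ℝ) :
    Tendsto (fun ε : ℝ => ε⁻¹ * (Real.exp (-(ε * a)) - 1)) (𝓝[≠] 0) (𝓝 (-a)) := by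
  have h : HasDerivAt (fun ε : ℝ => Real.exp (-(ε * a))) (-a) 0 := by
    have := ((hasDerivAt_id (0 : ℝ)).mul_const a).neg.exp
    simpa using this
  have h1 := hasDerivAt_iff_tendsto_slope_zero.1 h
  simpa using h1

theorem abs_integral_exp_neg_sub_one_add_le (hr : ∀ i, 0 < r i)
    (hmean : ∀ i j, Integrable (fun n : Fin k → ℕ => (n j : ℝ)) (p i).toMeasure) (j : Fin k)
    {η : ℝ} (hη : 0 ≤ η) {y : ℝ} (hy : 0 ≤ y)
    (hsq : Integrable (fun x => treeCount 0 y x j ^ 2) (treeLaw r p 0)) :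
    |∫ x, (Real.exp (-(η * treeCount 0 y x j)) - 1) ∂(treeLaw r p 0) +
      η * NormedSpace.exp (y • meanGenerator r p) j 0| ≤
        η ^ 2 * ∫ x, treeCount 0 y x j ^ 2 ∂(treeLaw r p 0) := by
  have := isProbabilityMeasure_treeLaw hr p 0
  have hNi := (integrable_treeCount hr hmean 0 j hy).const_mul η
  have hexp : Integrable (fun x => Real.exp (-(η * treeCount 0 y x j)) - 1) (treeLaw r p 0) := by
    refine hNi.mono' ?_ (Eventually.of_forall fun x =>
      abs_exp_neg_sub_one_le (mul_nonneg hη (treeCount_nonneg 0 y x j)))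
    have := (measurable_pi_apply j).comp (measurable_treeCount (k := k) 0 y)
    simp only [Function.comp_def] at this
    fun_prop
  rw [← integral_treeCount hr hmean 0 j hy, ← integral_const_mul, ← integral_add hexp hNi,
    ← integral_const_mul]
  exact norm_integral_le_of_norm_le (hsq.const_mul (η ^ 2))
    (f := fun x => Real.exp (-(η * treeCount 0 y x j)) - 1 + η * treeCount 0 y x j)
    (Eventually.of_forall fun x => (abs_exp_neg_sub_one_add_le (mul_nonneg hη (treeCount_nonneg 0 y x j))).trans_eq
      (mul_pow _ _ _))

/-- With η = θ e^{-δt}/t, the second order remainder is at most η² C e^{2δy}. Multiplied by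
e^{δ(t-y)} it becomes θ² C t^{-2} e^{δ(y-t)}, and y ≤ t. -/
theorem norm_scaled_treeTransform_sub_le (hr : ∀ i, 0 < r i)
    (hmean : ∀ i j, Integrable (fun n : Fin k → ℕ => (n j : ℝ)) (p i).toMeasure) {j : Fin k}
    {C δ θ t y : ℝ} (hδ : 0 < δ) (hθ : 0 < θ) (ht : 0 < t) (hy : 0 ≤ y) (hyt : y ≤ t) (hC0 : 0 ≤ C)
    (hsq : Integrable (fun x => treeCount 0 y x j ^ 2) (treeLaw r p 0))
    (hC : ∫ x, treeCount 0 y x j ^ 2 ∂(treeLaw r p 0) ≤ C * Real.exp (2 * δ * y)) :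
    ‖((Real.exp (-(δ * y)) * Real.exp (δ * t) : ℝ) : ℂ) *
      (treeTransform r p (Pi.single j (-((θ * (Real.exp (-(δ * t)) / t) : ℝ) : ℂ))) y - 1) -
      ((-θ * (Real.exp (-(δ * y)) * NormedSpace.exp (y • meanGenerator r p) j 0) / t : ℝ) : ℂ)‖ ≤
        θ ^ 2 * C / t ^ 2 := by
  set η : ℝ := θ * (Real.exp (-(δ * t)) / t) with hη
  have hη0 : 0 ≤ η := by positivity
  have h0 := abs_integral_exp_neg_sub_one_add_le hr hmean j hη0 hy hsq
  rw [treeTransform_single_sub_one hr j hη0, ← Complex.ofReal_mul, ← Complex.ofReal_sub,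
    Complex.norm_real, Real.norm_eq_abs]
  set J := ∫ x, (Real.exp (-(η * treeCount 0 y x j)) - 1) ∂(treeLaw r p 0)
  set M := NormedSpace.exp (y • meanGenerator r p) j 0
  have h2 : Real.exp (δ * t) * η = θ / t := by
    rw [hη, Real.exp_neg]
    field_simp
  have h1 : Real.exp (-(δ * y)) * Real.exp (δ * t) * J - -θ * (Real.exp (-(δ * y)) * M) / t =
      Real.exp (-(δ * y)) * Real.exp (δ * t) * (J + η * M) := by
    linear_combination (-(Real.exp (-(δ * y)) * M)) * h2
  rw [h1, abs_mul, abs_of_pos (mul_pos (Real.exp_pos _) (Real.exp_pos _))]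
  calc _ ≤ Real.exp (-(δ * y)) * Real.exp (δ * t) * (η ^ 2 * (C * Real.exp (2 * δ * y))) :=
        mul_le_mul_of_nonneg_left
          (h0.trans (mul_le_mul_of_nonneg_left hC (sq_nonneg _))) (by positivity)
    _ = θ ^ 2 * C / t ^ 2 * (Real.exp (-(δ * y)) * Real.exp (δ * t) *
        (Real.exp (-(δ * t)) * Real.exp (-(δ * t))) * Real.exp (2 * δ * y)) := by
        rw [hη]; ring
    _ = θ ^ 2 * C / t ^ 2 * Real.exp (δ * (y - t)) := by
        rw [← Real.exp_add, ← Real.exp_add, ← Real.exp_add, ← Real.exp_add]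
        ring_nf
    _ ≤ _ := by
        refine mul_le_of_le_one_right (by positivity) (Real.exp_le_one_iff.2 ?_)
        exact mul_nonpos_of_nonneg_of_nonpos hδ.le (by linarith)

theorem measurable_scaled_treeTransform (hr : ∀ i, 0 < r i) (ζ : Fin k → ℂ) (δ c : ℝ) :
    Measurable fun y : ℝ => ((Real.exp (-(δ * y)) * c : ℝ) : ℂ) * (treeTransform r p ζ y - 1) :=
  (by fun_prop : Measurable fun y : ℝ => ((Real.exp (-(δ * y)) * c : ℝ) : ℂ)).mul
    ((measurable_treeTransform hr ζ).sub_const 1)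

end Transform

/-! ### Convergence in probability of the normalized process -/

section Limits

variable {Ω : Type*} [MeasurableSpace Ω] {P : Measure Ω} [IsProbabilityMeasure P] {k : ℕ} [NeZero k]
  {r : Fin k → ℝ} {p : Fin k → PMF (Fin k → ℕ)} {lam : ℝ → ℝ}
  {T : ℕ → Ω → ℝ} {L : ℕ → ParticleLabel k → Ω → ℝ} {Y : ℕ → ParticleLabel k → Ω → Fin k → ℕ}

theorem population_nonneg {Ω : Type*} {k : ℕ} [NeZero k] (T : ℕ → Ω → ℝ)
    (L : ℕ → ParticleLabel k → Ω → ℝ) (Y : ℕ → ParticleLabel k → Ω → Fin k → ℕ) (t : ℝ) (ω : Ω)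
    (j : Fin k) : 0 ≤ population T L Y t ω j := by
  simp only [population, Finset.sum_apply]
  exact Finset.sum_nonneg fun n _ => Nat.cast_nonneg _

/-- Used to write λ(t-y) as ℓ(t-y) e^{δ(t-y)}, where ℓ is the normalized intensity with a finite
limit; the exponential is moved into the second factor of the convolution. -/
theorem mul_exp_neg_sub_mul (a δ t y : ℝ) :
    a * Real.exp (-(δ * (t - y))) * (Real.exp (-(δ * y)) * Real.exp (δ * t)) = a := by
  rw [mul_assoc, ← Real.exp_add, ← Real.exp_add]
  ring_nf
  simp

theorem tendsto_mul_exp_neg_of_isEquivalent {δ c : ℝ} (hc : 0 < c)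
    (hlam : Asymptotics.IsEquivalent atTop lam (fun t => c * Real.exp (δ * t))) :
    Tendsto (fun t => lam t * Real.exp (-(δ * t))) atTop (𝓝 c) := by
  have h := (Asymptotics.isEquivalent_iff_tendsto_one (Eventually.of_forall fun t =>
    (mul_pos hc (Real.exp_pos (δ * t))).ne')).1 hlam
  have h2 := h.const_mul c
  rw [mul_one] at h2
  refine h2.congr fun t => ?_
  rw [Pi.div_apply, Real.exp_neg]
  field_simp

theorem intervalIntegrable_mul_exp_neg (hint : LocallyIntegrableOn lam (Set.Ici 0)) (δ : ℝ) {t : ℝ}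
    (ht : 0 ≤ t) : IntervalIntegrable (fun t => lam t * Real.exp (-(δ * t))) volume 0 t :=
  (intervalIntegrable_of_locallyIntegrableOn_Ici hint le_rfl ht).mul_continuousOn (by fun_prop)

namespace IsBranchingModel

/-- Reduces convergence in probability to that of the Poisson exponent at ζ = -θ a(t) e_j. The
normalisation depends on `t` and enters through the argument of the transform. -/
theorem tendstoInMeasure_smul_population (h : IsBranchingModel P r p lam T L Y)
    (hr : ∀ i, 0 < r i) (hpos : ∀ t, 0 ≤ t → 0 < lam t)
    (hint : LocallyIntegrableOn lam (Set.Ici 0)) {a : ℝ → ℝ} (ha : ∀ᶠ t in atTop, 0 ≤ a t)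
    {x : Fin k → ℝ} (hx : ∀ j (θ : ℝ), 0 < θ → Tendsto (fun t => ∫ y in 0..t, (lam (t - y) : ℂ) *
      (treeTransform r p (Pi.single j (-((θ * a t : ℝ) : ℂ))) y - 1)) atTop
      (𝓝 ((-(θ * x j) : ℝ) : ℂ))) :
    TendstoInMeasure P (fun (t : ℝ) ω => a t • population T L Y t ω) atTop fun _ => x := by
  refine tendstoInMeasure_const_of_tendsto_laplace
    (fun t => (h.measurable_population t).const_smul (a t)) ?_ fun j θ hθ => ?_
  · filter_upwards [ha] with t ht ω j
    exact mul_nonneg ht (population_nonneg T L Y t ω j)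
  · have h1 := (Complex.continuous_exp.tendsto _).comp (hx j θ hθ)
    rw [← Complex.ofReal_exp] at h1
    refine (Complex.continuous_re.tendsto _).comp h1 |>.congr' ?_
    filter_upwards [ha, eventually_gt_atTop 0] with t ht ht0
    simp only [Function.comp_apply]
    rw [← h.integral_cexp_population hr hpos hint
      (re_single_nonpos j (mul_nonneg hθ.le ht)) ht0]
    simp only [sum_single_mul, ← Complex.ofReal_exp]
    rw [integral_complex_ofReal, Complex.ofReal_re]
    refine integral_congr_ae (Eventually.of_forall fun ω => ?_)
    simp only [Pi.smul_apply, smul_eq_mul, mul_assoc]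

/-- Here e^{δt}(φ_y - 1) tends to -θ times the mean for fixed `y`. Only first moments are needed,
because the mean itself dominates, and e^{-δy} times the mean decays like e^{-(δ-β)y} for any β
between the largest eigenvalue and δ. -/
theorem tendstoInMeasure_of_largestEigenvalue_lt (h : IsBranchingModel P r p lam T L Y)
    (hr : ∀ i, 0 < r i)
    (hmean : ∀ i j, Integrable (fun n : Fin k → ℕ => (n j : ℝ)) (p i).toMeasure)
    (hpos : ∀ t, 0 ≤ t → 0 < lam t)
    (hint : LocallyIntegrableOn lam (Set.Ici 0)) {δ c : ℝ} (hδ0 : 0 < δ) (hc : 0 < c)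
    (hlam : Asymptotics.IsEquivalent atTop lam (fun t => c * Real.exp (δ * t)))
    (hδ : largestEigenvalue (meanGenerator r p) < δ) :
    TendstoInMeasure P (fun (t : ℝ) ω => Real.exp (-(δ * t)) • population T L Y t ω) atTop
      (fun _ => c • ((δ • (1 : Matrix (Fin k) (Fin k) ℝ) - meanGenerator r p)⁻¹ *ᵥ
          Pi.single (0 : Fin k) (1 : ℝ))) := by
  have := isProbabilityMeasure_treeLaw hr p 0
  refine h.tendstoInMeasure_smul_population hr hpos hint
    (Eventually.of_forall fun t => (Real.exp_pos _).le) fun j θ hθ => ?_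
  obtain ⟨β, hβ1, hβ2⟩ := exists_between hδ
  obtain ⟨C, hC0, hC⟩ := exists_abs_matrix_exp_apply_le (meanGenerator r p) hβ1
  set I : ℝ → ℝ → ℝ := fun t y =>
    ∫ x, (Real.exp (-(θ * Real.exp (-(δ * t)) * treeCount 0 y x j)) - 1) ∂(treeLaw r p 0) with hI
  have hη : ∀ t, 0 ≤ θ * Real.exp (-(δ * t)) := fun t => by positivity
  have htI : ∀ t y, treeTransform r p (Pi.single j (-((θ * Real.exp (-(δ * t)) : ℝ) : ℂ))) y - 1 =
      (I t y : ℂ) := fun t y => treeTransform_single_sub_one hr j (hη t) y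
  set q : ℝ → ℝ → ℂ := fun t y =>
    (Real.exp (-(δ * y)) * Real.exp (δ * t) : ℝ) *
      (treeTransform r p (Pi.single j (-((θ * Real.exp (-(δ * t)) : ℝ) : ℂ))) y - 1) with hq
  have hbound : ∀ t y x, ‖Real.exp (δ * t) *
      (Real.exp (-(θ * Real.exp (-(δ * t)) * treeCount 0 y x j)) - 1)‖ ≤
        θ * treeCount 0 y x j := fun t y x => by
    rw [norm_mul, Real.norm_eq_abs, Real.norm_eq_abs, Real.abs_exp]
    have h1 := abs_exp_neg_sub_one_le (mul_nonneg (hη t) (treeCount_nonneg 0 y x j))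
    calc _ ≤ Real.exp (δ * t) * (θ * Real.exp (-(δ * t)) * treeCount 0 y x j) := by gcongr
      _ = _ := by rw [Real.exp_neg]; field_simp
  have hqI : ∀ t y, q t y = ((Real.exp (-(δ * y)) * ∫ x, (Real.exp (δ * t) *
      (Real.exp (-(θ * Real.exp (-(δ * t)) * treeCount 0 y x j)) - 1)) ∂(treeLaw r p 0) : ℝ) : ℂ) :=
    fun t y => by
      rw [hq, integral_const_mul]
      simp only [htI]
      push_cast
      ring
  have hconv := tendsto_integral_comp_sub_mul (tendsto_mul_exp_neg_of_isEquivalent hc hlam)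
    (fun t ht => intervalIntegrable_mul_exp_neg hint δ ht) (q := q) (C := θ * C) (γ := δ - β)
    (Q := fun y => ((-θ * (Real.exp (-(δ * y)) *
      NormedSpace.exp (y • meanGenerator r p) j 0) : ℝ) : ℂ)) (sub_pos.2 hβ2)
    (fun t => measurable_scaled_treeTransform hr _ δ _)
    (fun t y hy => ?_) (fun y hy => ?_)
  · rw [integral_complex_ofReal, integral_const_mul, integral_exp_mul_matrix_exp _ hδ] at hconv
    convert! hconv using 1
    · funext t
      refine intervalIntegral.integral_congr fun y _ => ?_
      simp only [hq]
      rw [← mul_assoc, ← Complex.ofReal_mul, mul_exp_neg_sub_mul]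
    · simp only [Pi.smul_apply, smul_eq_mul, Matrix.mulVec_single_one, Matrix.col_apply]
      push_cast
      ring_nf
  · rw [hqI, Complex.norm_real, norm_mul, Real.norm_eq_abs, Real.abs_exp]
    have h1 := norm_integral_le_of_norm_le ((integrable_treeCount hr hmean 0 j hy.le).const_mul θ)
      (Eventually.of_forall (hbound t y))
    rw [integral_const_mul θ, integral_treeCount hr hmean 0 j hy.le] at h1
    calc _ ≤ Real.exp (-(δ * y)) * (θ * (C * Real.exp (β * y))) := by
          gcongr
          refine h1.trans ?_
          gcongr
          exact (le_abs_self _).trans (hC y hy.le j 0)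
      _ = θ * C * (Real.exp (-(δ * y)) * Real.exp (β * y)) := by ring
      _ = _ := by rw [← Real.exp_add]; ring_nf
  · simp only [hqI]
    refine (Complex.continuous_ofReal.tendsto _).comp ?_
    have h1 : Tendsto (fun t => ∫ x, (Real.exp (δ * t) *
        (Real.exp (-(θ * Real.exp (-(δ * t)) * treeCount 0 y x j)) - 1)) ∂(treeLaw r p 0)) atTop
        (𝓝 (∫ x, -(θ * treeCount 0 y x j) ∂(treeLaw r p 0))) := by
      refine tendsto_integral_filter_of_dominated_convergence (fun x => θ * treeCount 0 y x j)
        (Eventually.of_forall fun t => ?_)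
        (Eventually.of_forall fun t => Eventually.of_forall (hbound t y))
        ((integrable_treeCount hr hmean 0 j hy.le).const_mul θ) (Eventually.of_forall fun x => ?_)
      · have := (measurable_pi_apply j).comp (measurable_treeCount (k := k) 0 y)
        simp only [Function.comp_def] at this
        fun_prop
      · have h2 : Tendsto (fun t => Real.exp (-(δ * t))) atTop (𝓝[≠] 0) := by
          refine tendsto_nhdsWithin_iff.2 ⟨?_, Eventually.of_forall fun t => (Real.exp_pos _).ne'⟩
          exact Real.tendsto_exp_neg_atTop_nhds_zero.comp (tendsto_id.const_mul_atTop hδ0)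
        refine ((tendsto_inv_mul_exp_sub_one (θ * treeCount 0 y x j)).comp h2).congr fun t => ?_
        simp only [Function.comp_apply]
        rw [← Real.exp_neg, neg_neg]
        ring_nf
    rw [integral_neg, integral_const_mul, integral_treeCount hr hmean 0 j hy.le] at h1
    convert! h1.const_mul (Real.exp (-(δ * y))) using 2
    ring

/-- At the critical rate e^{-δy} times the mean stays bounded without decaying. The leading term of
the exponent is its time average, with limit u_j v_0, and the second moment estimate makes the
linearisation error O(1/t²) uniformly in y ≤ t. -/
theorem tendstoInMeasure_of_eigenvector (h : IsBranchingModel P r p lam T L Y)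
    (hr : ∀ i, 0 < r i)
    (hmean : ∀ i j, Integrable (fun n : Fin k → ℕ => (n j : ℝ)) (p i).toMeasure)
    (hsq : ∀ i j, Integrable (fun n : Fin k → ℕ => (n j : ℝ) ^ 2) (p i).toMeasure)
    (hreg : IsRegularMatrix (meanGenerator r p))
    (hpos : ∀ t, 0 ≤ t → 0 < lam t)
    (hint : LocallyIntegrableOn lam (Set.Ici 0)) {δ c : ℝ} (hδ0 : 0 < δ) (hc : 0 < c)
    (hlam : Asymptotics.IsEquivalent atTop lam (fun t => c * Real.exp (δ * t)))
    {u v : Fin k → ℝ} (hu0 : ∀ i, 0 < u i) (hv0 : ∀ i, 0 < v i)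
    (hu : meanGenerator r p *ᵥ u = δ • u) (hv : v ᵥ* meanGenerator r p = δ • v)
    (huv : u ⬝ᵥ v = 1) :
    TendstoInMeasure P (fun (t : ℝ) ω => (Real.exp (-(δ * t)) / t) • population T L Y t ω) atTop
      (fun _ => (c * v 0) • u) := by
  have := isProbabilityMeasure_treeLaw hr p 0
  refine h.tendstoInMeasure_smul_population hr hpos hint
    ((eventually_gt_atTop 0).mono fun t ht => (div_pos (Real.exp_pos _) ht).le) fun j θ hθ => ?_
  obtain ⟨C, hC0, hC⟩ := exists_integral_treeCount_sq_le hr hmean hsq hδ0 hv0 hv 0 j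
  obtain ⟨t₀, -, hA⟩ := hreg
  set q : ℝ → ℝ → ℂ := fun t y => (Real.exp (-(δ * y)) * Real.exp (δ * t) : ℝ) *
    (treeTransform r p (Pi.single j (-((θ * (Real.exp (-(δ * t)) / t) : ℝ) : ℂ))) y - 1) with hq
  set m : ℝ → ℝ := fun y => -θ * (Real.exp (-(δ * y)) *
    NormedSpace.exp (y • meanGenerator r p) j 0) with hm
  have hmc : Continuous m := continuous_const.mul ((by fun_prop : Continuous fun y : ℝ =>
    Real.exp (-(δ * y))).mul (continuous_matrix_exp_apply (meanGenerator r p) j 0))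
  have hav : Tendsto (fun t => t⁻¹ * ∫ y in 0..t, m y) atTop (𝓝 (-θ * (u j * v 0))) := by
    refine ((tendsto_average_matrix_exp (meanGenerator_offDiag_nonneg hr) hA hu0 hv0 hu hv huv j 0).const_mul (-θ)).congr
      fun t => ?_
    rw [hm, intervalIntegral.integral_const_mul]
    ring
  have hconv := tendsto_integral_comp_sub_mul_average (tendsto_mul_exp_neg_of_isEquivalent hc hlam)
    (fun t ht => intervalIntegrable_mul_exp_neg hint δ ht) (q := q) (m := m)
    (C := θ ^ 2 * C) (K := θ * (v 0 / v j))
    (fun t => measurable_scaled_treeTransform hr _ δ _)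
    hmc
    (fun y hy => ?_) (fun t y ht hy hyt => ?_) hav
  · convert! hconv using 1
    · funext t
      refine intervalIntegral.integral_congr fun y _ => ?_
      simp only [hq]
      rw [← mul_assoc, ← Complex.ofReal_mul, mul_exp_neg_sub_mul]
    · simp only [Pi.smul_apply, smul_eq_mul]
      congr 2
      ring
  · have h1 := exists_matrix_exp_apply_le (meanGenerator_offDiag_nonneg hr) hv0 hv j 0 hy
    have h2 := matrix_exp_meanGenerator_nonneg (p := p) hr hy j 0
    rw [hm, abs_mul, abs_neg, abs_of_pos hθ, abs_of_nonneg (mul_nonneg (Real.exp_pos _).le h2)]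
    gcongr
    calc _ ≤ Real.exp (-(δ * y)) * (v 0 / v j * Real.exp (δ * y)) := by gcongr
      _ = v 0 / v j * (Real.exp (-(δ * y)) * Real.exp (δ * y)) := by ring
      _ = _ := by rw [← Real.exp_add, neg_add_cancel, Real.exp_zero, mul_one]
  · exact norm_scaled_treeTransform_sub_le hr hmean hδ0 hθ ht hy.le hyt hC0 (hC y hy.le).1
      (hC y hy.le).2

end IsBranchingModel

end Limits

/-! ### Compound Poisson laws and the limit law of the subcritical process -/

section CompoundPoisson

/-- Existence of compound Poisson laws. -/
theorem exists_compoundPoisson {S : Type*} [AddCommMonoid S] [MeasurableSpace S] [MeasurableAdd₂ S]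
    (M : Measure S) [IsFiniteMeasure M] :
    ∃ ν : Measure S, IsProbabilityMeasure ν ∧ ∀ f : S → ℂ, Measurable f → (∀ x, ‖f x‖ ≤ 1) →
      f 0 = 1 → (∀ x y, f (x + y) = f x * f y) →
      ∫ x, f x ∂ν = Complex.exp (∫ x, (f x - 1) ∂M) := by
  -- The added unit mass at 0 keeps the rate positive even when `M = 0`, so that κ is a probability
  -- measure. It leaves the transform unchanged because f(0) = 1.
  set a : ℝ≥0 := (M Set.univ).toNNReal + 1 with ha
  have haM : (a : ℝ≥0∞) = M Set.univ + 1 := by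
    rw [ha, ENNReal.coe_add, ENNReal.coe_toNNReal (measure_ne_top _ _), ENNReal.coe_one]
  have ha0 : a ≠ 0 := by positivity
  set κ : Measure S := (a : ℝ≥0∞)⁻¹ • (M + Measure.dirac 0) with hκ
  have : IsProbabilityMeasure κ := ⟨by
    rw [hκ, Measure.smul_apply, Measure.add_apply, measure_univ (μ := Measure.dirac (0 : S)), ← haM,
      smul_eq_mul, ENNReal.inv_mul_cancel (by simpa using ha0) ENNReal.coe_ne_top]⟩
  have hsum : Measurable fun q : ℕ × (ℕ → S) => ∑ i ∈ Finset.range q.1, q.2 i :=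
    measurable_from_prod_countable_right fun n =>
      Finset.measurable_fun_sum (Finset.range n) fun i _ => measurable_pi_apply i
  refine ⟨((poissonMeasure a).prod (Measure.infinitePi fun _ : ℕ => κ)).map
    fun q => ∑ i ∈ Finset.range q.1, q.2 i, Measure.isProbabilityMeasure_map hsum.aemeasurable,
    fun f hf hf1 hf0 hadd => ?_⟩
  have hfsum : ∀ (X : ℕ → S) (n : ℕ), f (∑ i ∈ Finset.range n, X i) =
      ∏ i ∈ Finset.range n, f (X i) := fun X n => by
    induction n with
    | zero => simp [hf0]
    | succ n ih => rw [Finset.sum_range_succ, Finset.prod_range_succ, hadd, ih]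
  have hfi : ∀ (μ : Measure S) [IsFiniteMeasure μ], Integrable f μ := fun μ _ =>
    Integrable.of_bound hf.aestronglyMeasurable 1 (Eventually.of_forall hf1)
  rw [integral_map hsum.aemeasurable hf.aestronglyMeasurable,
    MeasureTheory.integral_prod (fun q : ℕ × (ℕ → S) => f (∑ i ∈ Finset.range q.1, q.2 i))
      (Integrable.of_bound (hf.comp hsum).aestronglyMeasurable 1
      (Eventually.of_forall fun _ => hf1 _))]
  simp only [hfsum, integral_prod_infinitePi κ (g := fun _ => f) (fun _ => hf), Finset.prod_const,
    Finset.card_range]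
  rw [integral_pow_poissonMeasure]
  congr 1
  rw [hκ, integral_smul_measure, integral_add_measure (hfi M) (hfi _), integral_dirac' _ _
    hf.stronglyMeasurable, hf0, integral_sub (hfi M) (integrable_const _), integral_const]
  have hreal : M.real Set.univ = (a : ℝ) - 1 := by
    rw [ha, measureReal_def]
    simp only [NNReal.coe_add, NNReal.coe_one, add_sub_cancel_right]
    rfl
  have ha0' : ((a : ℝ) : ℂ) ≠ 0 := by exact_mod_cast ha0
  rw [hreal, ENNReal.toReal_inv, ENNReal.coe_toReal]
  simp only [Complex.real_smul, Complex.ofReal_inv, Complex.ofReal_sub, Complex.ofReal_one, mul_one]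
  have : ((a : ℝ≥0) : ℂ) = ((a : ℝ) : ℂ) := rfl
  field_simp
  ring

end CompoundPoisson

/-! ### Convergence in law from characteristic functions -/

section ConvergenceInLaw

theorem charFun_map_toLp {ι Ω : Type*} [Fintype ι] [MeasurableSpace Ω] (Q : Measure Ω)
    {Z : Ω → ι → ℝ} (hZ : Measurable Z) (θ : EuclideanSpace ℝ ι) :
    charFun (Q.map fun ω => (WithLp.toLp 2 (Z ω) : EuclideanSpace ℝ ι)) θ =
      ∫ ω, Complex.exp (∑ j, (θ j * Complex.I) * (Z ω j : ℂ)) ∂Q := by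
  have hm : Measurable fun ω => (WithLp.toLp 2 (Z ω) : EuclideanSpace ℝ ι) :=
    (PiLp.continuous_toLp 2 fun _ : ι => ℝ).measurable.comp hZ
  rw [charFun_apply, integral_map hm.aemeasurable (by fun_prop)]
  refine integral_congr_ae (Eventually.of_forall fun ω => ?_)
  simp only [PiLp.inner_apply, Complex.ofReal_sum, Finset.sum_mul]
  congr 1
  refine Finset.sum_congr rfl fun j _ => ?_
  simp
  ring

theorem tendstoInDistribution_of_tendsto_charFun {ι Ω : Type*} [Fintype ι] [MeasurableSpace Ω]
    {P : Measure Ω} [IsProbabilityMeasure P] {X : ℝ → Ω → ι → ℝ} (hX : ∀ t, Measurable (X t))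
    {ν : Measure (ι → ℝ)} [IsProbabilityMeasure ν]
    (h : ∀ θ : ι → ℝ, Tendsto (fun t => ∫ ω, Complex.exp (∑ j, (θ j * Complex.I) * (X t ω j : ℂ)) ∂P)
      atTop (𝓝 (∫ x, Complex.exp (∑ j, (θ j * Complex.I) * (x j : ℂ)) ∂ν))) :
    TendstoInDistribution X atTop (fun x : ι → ℝ => x) (fun _ => P) ν := by
  have hto : Measurable (WithLp.toLp 2 : (ι → ℝ) → EuclideanSpace ℝ ι) :=
    (PiLp.continuous_toLp 2 fun _ : ι => ℝ).measurable
  have hE : TendstoInDistribution (fun t ω => (WithLp.toLp 2 (X t ω) : EuclideanSpace ℝ ι)) atTop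
      (fun x : ι → ℝ => (WithLp.toLp 2 x : EuclideanSpace ℝ ι)) (fun _ => P) ν := by
    refine ⟨fun t => (hto.comp (hX t)).aemeasurable, hto.aemeasurable, ?_⟩
    -- Lévy's continuity theorem is applied along arbitrary sequences of times, in the Euclidean
    -- space, where characteristic functions use the inner product; the last line transfers the
    -- result back by a continuous map.
    refine tendsto_of_seq_tendsto fun s hs => ?_
    refine ProbabilityMeasure.tendsto_of_tendsto_charFun fun θ => ?_
    have h1 : Tendsto (fun n => charFun (P.map fun ω =>
        (WithLp.toLp 2 (X (s n) ω) : EuclideanSpace ℝ ι)) θ) atTop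
        (𝓝 (charFun (ν.map fun x => (WithLp.toLp 2 x : EuclideanSpace ℝ ι)) θ)) := by
      rw [charFun_map_toLp ν (Z := fun x => x) measurable_id θ]
      simp only [charFun_map_toLp P (hX _) θ]
      exact (h θ).comp hs
    exact h1
  exact hE.continuous_comp (PiLp.continuous_ofLp 2 fun _ : ι => ℝ)

end ConvergenceInLaw

/-! ### The limit law in the subcritical case -/

section StationaryLaw

variable {k : ℕ} [NeZero k] {r : Fin k → ℝ} {p : Fin k → PMF (Fin k → ℕ)}

theorem exists_norm_treeTransform_sub_one_le (hr : ∀ i, 0 < r i)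
    (hmean : ∀ i j, Integrable (fun n : Fin k → ℕ => (n j : ℝ)) (p i).toMeasure)
    (hρ : largestEigenvalue (meanGenerator r p) < 0) {ζ : Fin k → ℂ} (hζ : ∀ j, (ζ j).re ≤ 0) :
    ∃ C γ : ℝ, 0 < γ ∧ ∀ y, 0 < y → ‖treeTransform r p ζ y - 1‖ ≤ C * Real.exp (-(γ * y)) := by
  obtain ⟨β, hβ1, hβ2⟩ := exists_between hρ
  obtain ⟨C, hC0, hC⟩ := exists_abs_matrix_exp_apply_le (meanGenerator r p) hβ1
  refine ⟨∑ j, ‖ζ j‖ * C, -β, neg_pos.2 hβ2, fun y hy => ?_⟩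
  refine (norm_treeTransform_sub_one_le hr hmean hζ hy.le).trans ?_
  rw [Finset.sum_mul]
  refine Finset.sum_le_sum fun j _ => ?_
  rw [mul_assoc, neg_mul, neg_neg]
  exact mul_le_mul_of_nonneg_left ((le_abs_self _).trans (hC y hy.le j 0)) (norm_nonneg _)

theorem integrableOn_treeTransform_sub_one (hr : ∀ i, 0 < r i)
    (hmean : ∀ i j, Integrable (fun n : Fin k → ℕ => (n j : ℝ)) (p i).toMeasure)
    (hρ : largestEigenvalue (meanGenerator r p) < 0) {ζ : Fin k → ℂ} (hζ : ∀ j, (ζ j).re ≤ 0) :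
    IntegrableOn (fun y => treeTransform r p ζ y - 1) (Set.Ioi 0) := by
  obtain ⟨C, γ, hγ, hC⟩ := exists_norm_treeTransform_sub_one_le hr hmean hρ hζ
  have h1 : IntegrableOn (fun y => C * Real.exp (-(γ * y))) (Set.Ioi 0) := by
    simpa [IntegrableOn, neg_mul] using (exp_neg_integrableOn_Ioi 0 hγ).const_mul C
  exact h1.mono' ((measurable_treeTransform hr ζ).sub_const 1).aestronglyMeasurable
    ((ae_restrict_iff' measurableSet_Ioi).2 (Eventually.of_forall hC))

/-- The limit law in the subcritical case. -/
theorem exists_stationaryLaw (hr : ∀ i, 0 < r i)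
    (hmean : ∀ i j, Integrable (fun n : Fin k → ℕ => (n j : ℝ)) (p i).toMeasure)
    (hρ : largestEigenvalue (meanGenerator r p) < 0) {c : ℝ} (hc : 0 < c) :
    ∃ ν : Measure (Fin k → ℝ), IsProbabilityMeasure ν ∧ (∀ᵐ x ∂ν, 0 ≤ x) ∧
      ∀ ζ : Fin k → ℂ, (∀ j, (ζ j).re ≤ 0) →
        ∫ x, Complex.exp (∑ j, ζ j * (x j : ℂ)) ∂ν =
          Complex.exp (c * ∫ y in Set.Ioi (0 : ℝ), (treeTransform r p ζ y - 1)) := by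
  have := isProbabilityMeasure_treeLaw hr p 0
  set S : Measure (ℝ × FamilyTree k) := (volume.restrict (Set.Ioi 0)).prod (treeLaw r p 0) with hS
  set N : ℝ × FamilyTree k → Fin k → ℕ := fun q =>
    aliveCount 0 (fun w => (q.2 w).1) (fun w => (q.2 w).2) q.1 with hN
  have hNm : Measurable N := measurable_pi_lambda _ fun j => measurable_aliveCount 0 j
  have hNjm : ∀ j, Measurable fun q => ENNReal.ofReal (N q j) := fun j =>
    ((measurable_pi_apply j).comp (measurable_treeCount_prod 0)).ennreal_ofReal
  have hlin : ∀ j, ∫⁻ q, ENNReal.ofReal (N q j) ∂S < ∞ := fun j => by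
    rw [hS, lintegral_prod _ (hNjm j).aemeasurable]
    have h2 : ∫⁻ y in Set.Ioi (0 : ℝ), ∫⁻ x, ENNReal.ofReal (N (y, x) j) ∂(treeLaw r p 0) =
        ∫⁻ y in Set.Ioi (0 : ℝ), ENNReal.ofReal (NormedSpace.exp (y • meanGenerator r p) j 0) :=
      setLIntegral_congr_fun measurableSet_Ioi fun y hy =>
        lintegral_treeCount hr hmean 0 j (le_of_lt hy)
    rw [h2]
    have h3 := integrableOn_exp_mul_matrix_exp (meanGenerator r p) hρ j 0
    simp only [zero_mul, neg_zero, Real.exp_zero, one_mul] at h3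
    exact h3.lintegral_lt_top
  have hNi : ∀ j, Integrable (fun q => (N q j : ℝ)) S := fun j =>
    ⟨((measurable_pi_apply j).comp (measurable_treeCount_prod 0)).aestronglyMeasurable, by
      rw [hasFiniteIntegral_iff_ofReal (Eventually.of_forall fun _ => Nat.cast_nonneg _)]
      exact hlin j⟩
  -- `S` has infinite mass, but outside the empty population the integer counts sum to at least 1,
  -- so the mass there is at most the integrated mean, which is finite since ρ < 0.
  set M : Measure (Fin k → ℕ) := (S.map N).restrict {0}ᶜ with hM
  have : IsFiniteMeasure M := ⟨by
    rw [hM, Measure.restrict_apply_univ, Measure.map_apply hNm (measurableSet_singleton 0).compl]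
    refine lt_of_le_of_lt ?_ (ENNReal.sum_lt_top.2 fun j (_ : j ∈ Finset.univ) => hlin j)
    rw [← lintegral_finsetSum _ fun j _ => hNjm j,
      ← lintegral_indicator_one (hNm (measurableSet_singleton 0).compl)]
    refine lintegral_mono fun q => ?_
    by_cases hq : q ∈ N ⁻¹' {0}ᶜ
    swap
    · rw [Set.indicator_of_notMem hq]
      exact zero_le
    rw [Set.indicator_of_mem hq]
    obtain ⟨j, hj⟩ := Function.ne_iff.1 (show N q ≠ 0 from hq)
    refine le_trans ?_ (Finset.single_le_sum (f := fun j => ENNReal.ofReal (N q j))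
      (fun j _ => (zero_le : 0 ≤ ENNReal.ofReal (N q j))) (Finset.mem_univ j))
    rw [Pi.one_apply, ← ENNReal.ofReal_one]
    refine ENNReal.ofReal_le_ofReal ?_
    exact_mod_cast Nat.one_le_iff_ne_zero.2 hj⟩
  obtain ⟨ν, hν, hνf⟩ := exists_compoundPoisson (c.toNNReal • M)
  have hcast : Measurable fun (n : Fin k → ℕ) j => (n j : ℝ) := Measurable.of_discrete
  refine ⟨ν.map fun n j => (n j : ℝ), Measure.isProbabilityMeasure_map hcast.aemeasurable, ?_,
    fun ζ hζ => ?_⟩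
  · rw [ae_map_iff hcast.aemeasurable measurableSet_Ici]
    exact Eventually.of_forall fun n j => Nat.cast_nonneg _
  · set f : (Fin k → ℕ) → ℂ := fun n => Complex.exp (∑ j, ζ j * ((n j : ℝ) : ℂ)) with hf
    have hf1 : ∀ n, ‖f n‖ ≤ 1 := fun n =>
      norm_cexp_sum_le_one (x := fun j => (n j : ℝ)) hζ fun j => Nat.cast_nonneg _
    have hfm : Measurable f := Measurable.of_discrete
    rw [integral_map hcast.aemeasurable (measurable_cexp_sum ζ).aestronglyMeasurable,
      hνf f hfm hf1 (by simp [hf]) fun x y => by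
        simp only [hf, ← Complex.exp_add, ← Finset.sum_add_distrib]
        congr 1
        refine Finset.sum_congr rfl fun j _ => ?_
        simp
        ring]
    congr 1
    have hint : Integrable (fun q => f (N q) - 1) S := by
      refine (integrable_finsetSum Finset.univ fun j _ => (hNi j).const_mul ‖ζ j‖).mono'
        ((hfm.comp hNm).sub_const 1).aestronglyMeasurable (Eventually.of_forall fun q => ?_)
      exact norm_cexp_sum_sub_one_le (x := fun j => (N q j : ℝ)) hζ fun j => Nat.cast_nonneg _
    -- Discarding the atom at 0 changes nothing, as `f - 1` vanishes there; Fubini then recovers the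
    -- transform of one family.
    have h0 : ∫ n, (f n - 1) ∂M = ∫ y in Set.Ioi (0 : ℝ), (treeTransform r p ζ y - 1) := by
      rw [hM, setIntegral_eq_integral_of_forall_compl_eq_zero fun n hn => by
        have : n = 0 := by simpa using hn
        simp [this, hf], integral_map hNm.aemeasurable (hfm.sub_const 1).aestronglyMeasurable, hS,
        MeasureTheory.integral_prod _ hint]
      simp only [treeTransform_sub_one hr hζ]
      rfl
    rw [← h0, integral_smul_nnreal_measure, NNReal.smul_def, Real.coe_toNNReal _ hc.le,
      Complex.real_smul]

end StationaryLaw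

/-! ### The three regimes -/

theorem theorem2 {Ω : Type*} [MeasurableSpace Ω] (P : Measure Ω) [IsProbabilityMeasure P]
    (k : ℕ) [NeZero k]
    (r : Fin k → ℝ) (hr : ∀ i, 0 < r i)
    (p : Fin k → PMF (Fin k → ℕ))
    (hmean : ∀ i j, Integrable (fun n : Fin k → ℕ => (n j : ℝ)) (p i).toMeasure)
    (hreg : IsRegularMatrix (meanGenerator r p))
    (lam : ℝ → ℝ) (hlam_pos : ∀ t, 0 ≤ t → 0 < lam t)
    (hlam_int : LocallyIntegrableOn lam (Set.Ici 0))
    (delta lamInf : ℝ) (hdelta : 0 ≤ delta) (hlamInf : 0 < lamInf)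
    (hlam : Asymptotics.IsEquivalent atTop lam (fun t => lamInf * Real.exp (delta * t)))
    (T : ℕ → Ω → ℝ) (L : ℕ → ParticleLabel k → Ω → ℝ)
    (Y : ℕ → ParticleLabel k → Ω → Fin k → ℕ)
    (hmodel : IsBranchingModel P r p lam T L Y) :
    -- (i)
    (largestEigenvalue (meanGenerator r p) < 0 → delta = 0 →
      ∃ (ν : Measure (Fin k → ℝ)) (_ : IsProbabilityMeasure ν),
        (∀ᵐ x ∂ν, 0 ≤ x) ∧
        (∀ s : Fin k → ℝ, s ≤ 0 →
          IntegrableOn (fun y => vectorLaplace P (treePopulation L Y 0 y) s - 1) (Set.Ioi 0) ∧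
          ∫ x, Real.exp (s ⬝ᵥ x) ∂ν =
            Real.exp (lamInf *
              ∫ y in Set.Ioi (0 : ℝ), (vectorLaplace P (treePopulation L Y 0 y) s - 1))) ∧
        TendstoInDistribution (fun (t : ℝ) ω => population T L Y t ω) atTop
          (fun x : Fin k → ℝ => x) (fun _ => P) ν) ∧
    -- (ii)
    ((largestEigenvalue (meanGenerator r p) ≤ 0 ∧ 0 < delta) ∨
        (0 < largestEigenvalue (meanGenerator r p) ∧
          largestEigenvalue (meanGenerator r p) < delta) →
      IsUnit (delta • (1 : Matrix (Fin k) (Fin k) ℝ) - meanGenerator r p) ∧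
      TendstoInMeasure P
        (fun (t : ℝ) ω => Real.exp (-(delta * t)) • population T L Y t ω) atTop
        (fun _ => lamInf • ((delta • (1 : Matrix (Fin k) (Fin k) ℝ) - meanGenerator r p)⁻¹ *ᵥ
          Pi.single (0 : Fin k) (1 : ℝ)))) ∧
    -- (iii), with finite second moments of the offspring numbers
    ((∀ i j, Integrable (fun n : Fin k → ℕ => (n j : ℝ) ^ 2) (p i).toMeasure) →
      largestEigenvalue (meanGenerator r p) = delta → 0 < delta →
      ∀ u v : Fin k → ℝ, (∀ i, 0 < u i) → (∀ i, 0 < v i) →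
        meanGenerator r p *ᵥ u = largestEigenvalue (meanGenerator r p) • u →
        v ᵥ* meanGenerator r p = largestEigenvalue (meanGenerator r p) • v →
        ∑ i, u i = 1 → u ⬝ᵥ v = 1 →
        TendstoInMeasure P
          (fun (t : ℝ) ω => (Real.exp (-(delta * t)) / t) • population T L Y t ω) atTop
          (fun _ => (lamInf * v 0) • u)) := by
  have hℓ := tendsto_mul_exp_neg_of_isEquivalent hlamInf hlam
  refine ⟨fun hρ hδ => ?_, fun hcase => ?_, fun hsq hρ hδ u v hu0 hv0 hu hv _ huv => ?_⟩
  · subst hδ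
    obtain ⟨ν, hν, hν0, hνζ⟩ := exists_stationaryLaw hr hmean hρ hlamInf
    refine ⟨ν, hν, hν0, fun s hs => ?_, ?_⟩
    · have hs' : ∀ j, ((s j : ℂ)).re ≤ 0 := hs
      have hV : ∀ y, treeTransform r p (fun j => (s j : ℂ)) y - 1 =
          ((vectorLaplace P (treePopulation L Y 0 y) s - 1 : ℝ) : ℂ) := fun y => by
        rw [← hmodel.vectorLaplace_treePopulation hr 0 y s]
        push_cast
        rfl
      have h1 := integrableOn_treeTransform_sub_one hr hmean hρ hs'
      have h2 := hνζ _ hs'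
      simp only [hV] at h1 h2
      refine ⟨by simpa [IntegrableOn] using h1.re, ?_⟩
      rw [integral_complex_ofReal] at h2
      have h3 : ∫ x, Complex.exp (∑ j, (s j : ℂ) * (x j : ℂ)) ∂ν =
          ((∫ x, Real.exp (s ⬝ᵥ x) ∂ν : ℝ) : ℂ) := by
        rw [← integral_complex_ofReal]
        simp [dotProduct]
      rw [h3] at h2
      exact_mod_cast h2
    · refine tendstoInDistribution_of_tendsto_charFun hmodel.measurable_population fun θ => ?_
      -- Purely imaginary exponents lie on the boundary of the admissible half-plane, so the formula
      -- for the limit law also gives its characteristic function.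
      have hθ : ∀ j, ((θ j : ℂ) * Complex.I).re ≤ 0 := fun j => by simp
      obtain ⟨C, γ, hγ, hC⟩ := exists_norm_treeTransform_sub_one_le hr hmean hρ hθ
      rw [hνζ _ hθ]
      simp only [zero_mul, neg_zero, Real.exp_zero, mul_one] at hℓ
      have h1 := tendsto_integral_comp_sub_mul hℓ
        (fun t ht => intervalIntegrable_of_locallyIntegrableOn_Ici hlam_int le_rfl ht)
        (q := fun _ y => treeTransform r p (fun j => (θ j : ℂ) * Complex.I) y - 1) hγ
        (fun _ => (measurable_treeTransform hr _).sub_const 1) (fun _ => hC)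
        (fun y _ => tendsto_const_nhds)
      refine ((Complex.continuous_exp.tendsto _).comp h1).congr' ?_
      filter_upwards [eventually_gt_atTop 0] with t ht
      exact (hmodel.integral_cexp_population hr hlam_pos hlam_int hθ ht).symm
  · have hδ : largestEigenvalue (meanGenerator r p) < delta := by
      rcases hcase with h | h
      · exact h.1.trans_lt h.2
      · exact h.2
    have hδ0 : 0 < delta := by
      rcases hcase with h | h
      · exact h.2
      · exact h.1.trans h.2
    exact ⟨isUnit_smul_one_sub _ hδ, hmodel.tendstoInMeasure_of_largestEigenvalue_lt hr hmean
      hlam_pos hlam_int hδ0 hlamInf hlam hδ⟩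
  · rw [hρ] at hu hv
    exact hmodel.tendstoInMeasure_of_eigenvector hr hmean hsq hreg hlam_pos hlam_int hδ hlamInf hlam
      hu0 hv0 hu hv huv
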